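/- Let $\mathbb K\in\{\mathbb R,\mathbb C\}$, $a<b$, and consider the linear hyperbolic boundary control system $$\partial_t x(\xi,t)=P_1\,\partial_\xi\big(\mathcal H(\xi)x(\xi,t)\big)+P_0(\xi)\mathcal H(\xi)x(\xi,t),\qquad \xi\in[a,b],\ t\ge 0,$$ $$u(t)=\widetilde W_B\begin{bmatrix}(\mathcal Hx)(b,t)\\(\mathcal Hx)(a,t)\end{bmatrix},\qquad y(t)=\widetilde W_C\begin{bmatrix}(\mathcal Hx)(b,t)\\(\mathcal Hx)(a,t)\end{bmatrix},$$ under the following assumptions. 1. $P_1\in\mathbb K^{n\times n}$ is invertible and self-adjoint. 2. $P_0\in L^\infty([a,b],\mathbb K^{n\times n})$. 3. $\mathcal H\in L^\infty([a,b],\mathbb K^{n\times n})$, $\mathcal H(\xi)$ is self-adjoint for a.e. $\xi$, and there are $m,M>0$ with $mI_n\le\mathcal H(\xi)\le MI_n$ for a.e. $\xi$. 4. $\widetilde W_B,\widetilde W_C\in\mathbb K^{n\times 2n}$, and both $\widetilde W_B$ and $\begin{bmatrix}\widetilde W_B\\ \widetilde W_C\end{bmatrix}\in\mathbb K^{2n\times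 2n}$ have full rank. 5. For $p\in\{1,2\}$ let $A_p x_0:=P_1(\mathcal Hx_0)'+P_0\mathcal Hx_0$ be the operator on $L^p([a,b],\mathbb K^n)$ with domain $$\mathrm D(A_p)=\Big\{x_0\in L^p([a,b],\mathbb K^n)\ \Big|\ \mathcal Hx_0\in W^{1,p}([a,b],\mathbb K^n),\ \widetilde W_B\begin{bmatrix}(\mathcal Hx_0)(b)\\(\mathcal Hx_0)(a)\end{bmatrix}=0\Big\}.$$ The operator $A_2$ generates a $C_0$-semigroup on $L^2([a,b],\mathbb K^n)$. 6. There are $S,\mathcal H^D\in C^1([a,b],\mathbb K^{n\times n})$ and $0\le m\le n$ such that $S$ is pointwise invertible, $\mathcal H^D$ is pointwise diagonal and positive definite, and $P_1\mathcal H=S^{-1}\begin{bmatrix}I_m&0\\0&-I_{n-m}\end{bmatrix}\mathcal H^DS$ a.e. on $[a,b]$. Suppose that the system is exponentially stable on the state space $L^1([a,b],\mathbb K^n)$, that is, $A_1$ generates a $C_0$-semigroup $(T(t))_{t\ge0}$ on $L^1([a,b],\mathbb K^n)$ and there are $M\in\mathbb R$, $\omega>0$ with $\|T(t)\|\le Me^{-\omega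 t}$ for all $t\ge0$. Then the system is BIBO stable: there is $c>0$ such that for every classical solution $(u,x,y)$, i.e. $u,y\in C([0,\infty),\mathbb K^n)$ and $x\in C^1([0,\infty),L^2([a,b],\mathbb K^n))$ satisfying the above equations for all $t\ge0$, with $x(0)=0$ and $u\in C_c^\infty([0,\infty),\mathbb K^n)$, and for every $t>0$, $$\|y\|_{L^\infty([0,t])}\le c\,\|u\|_{L^\infty([0,t])}.$$ -/

import Mathlib

open MeasureTheory Set Filter Topology
open scoped ComplexOrder NNReal ENNReal

/-- A strongly continuous (`C₀`-) semigroup of bounded operators on a Banach space `X`. -/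
structure C0Semigroup (𝕜 : Type*) [RCLike 𝕜] (X : Type*) [NormedAddCommGroup X]
    [NormedSpace 𝕜 X] where
  T : ℝ≥0 → X →L[𝕜] X
  map_zero : T 0 = ContinuousLinearMap.id 𝕜 X
  map_add : ∀ s t : ℝ≥0, T (s + t) = (T s).comp (T t)
  strongly_continuous : ∀ x : X, Tendsto (fun t => T t x) (𝓝 0) (𝓝 x)

namespace C0Semigroup

variable {𝕜 : Type*} [RCLike 𝕜] {X : Type*} [NormedAddCommGroup X] [NormedSpace 𝕜 X]

/-- `A`, an operator given by its graph, is the infinitesimal generator of the semigroup: a pair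
`(x, z)` lies in the graph iff `(T h x - x) / h` converges to `z` as `h ↓ 0`. In particular the
domain of `A` is exactly the set of `x` for which this limit exists. -/
def IsGenerator (S : C0Semigroup 𝕜 X) (A : Set (X × X)) : Prop :=
  ∀ x z : X, (x, z) ∈ A ↔
    Tendsto (fun h : ℝ≥0 => (((h : ℝ) : 𝕜))⁻¹ • (S.T h x - x)) (𝓝[>] 0) (𝓝 z)

/-- Exponential stability: `‖T t‖ ≤ M e^{-ω t}` for all `t ≥ 0`, with some `ω > 0`. -/
def IsExponentiallyStable (S : C0Semigroup 𝕜 X) : Prop :=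
  ∃ M ω : ℝ, 0 < ω ∧ ∀ t : ℝ≥0, ‖S.T t‖ ≤ M * Real.exp (-ω * t)

end C0Semigroup

/-- `v : [a,b] → E` is (the continuous representative of) an element of the Sobolev space
`W^{1,p}([a,b], E)` with weak derivative `g ∈ L^p([a,b], E)`. For `p = 2` this is `H¹`. -/
def IsSobolevOnInterval {E : Type*} [NormedAddCommGroup E] [NormedSpace ℝ E]
    (p : ℝ≥0∞) (a b : ℝ) (v g : ℝ → E) : Prop :=
  MemLp g p (volume.restrict (Icc a b)) ∧ ∀ ξ ∈ Icc a b, v ξ = v a + ∫ s in a..ξ, g s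

/-- The data of a linear hyperbolic boundary control system on the interval `[a,b]`:
`∂ₜ x = P₁ ∂_ξ (H x) + P₀ (H x)`, `u = W_B [(H x)(b); (H x)(a)]`, `y = W_C [(H x)(b); (H x)(a)]`.
The matrix functions `P₀` and `H` only matter almost everywhere on `[a,b]`. -/
structure HBCS (𝕜 : Type*) [RCLike 𝕜] (n : ℕ) where
  a : ℝ
  b : ℝ
  a_lt_b : a < b
  P₁ : Matrix (Fin n) (Fin n) 𝕜
  P₀ : ℝ → Matrix (Fin n) (Fin n) 𝕜
  H : ℝ → Matrix (Fin n) (Fin n) 𝕜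
  W_B : Matrix (Fin n) (Fin n ⊕ Fin n) 𝕜
  W_C : Matrix (Fin n) (Fin n ⊕ Fin n) 𝕜

namespace HBCS

variable {𝕜 : Type*} [RCLike 𝕜] {n : ℕ}

/-- Lebesgue measure on the spatial interval `[a,b]`. -/
noncomputable abbrev μ (sys : HBCS 𝕜 n) : Measure ℝ := volume.restrict (Icc sys.a sys.b)

/-- The space `L^p([a,b], 𝕜ⁿ)`. -/
abbrev StateSpace (sys : HBCS 𝕜 n) (p : ℝ≥0∞) : Type _ :=
  Lp (EuclideanSpace 𝕜 (Fin n)) p sys.μ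

/-- The boundary vector `[v(b); v(a)]` in `𝕜²ⁿ`. -/
def boundaryVector (sys : HBCS 𝕜 n) (v : ℝ → EuclideanSpace 𝕜 (Fin n)) :
    EuclideanSpace 𝕜 (Fin n ⊕ Fin n) :=
  WithLp.toLp 2 (Sum.elim (v sys.b).ofLp (v sys.a).ofLp)

/-- `x` and `z` in `L^p` and the function `v` satisfy: `v` is the continuous representative of
`H x ∈ W^{1,p}([a,b], 𝕜ⁿ)` and `z = P₁ ∂_ξ (H x) + P₀ (H x)`. No boundary condition is imposed. -/
def IsDiffExpr (sys : HBCS 𝕜 n) (p : ℝ≥0∞) (x z : sys.StateSpace p)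
    (v : ℝ → EuclideanSpace 𝕜 (Fin n)) : Prop :=
  (∀ᵐ ξ ∂sys.μ, v ξ = (sys.H ξ).toEuclideanLin (x ξ)) ∧
  ∃ g : ℝ → EuclideanSpace 𝕜 (Fin n),
    IsSobolevOnInterval p sys.a sys.b v g ∧
    ∀ᵐ ξ ∂sys.μ, z ξ = sys.P₁.toEuclideanLin (g ξ) + (sys.P₀ ξ).toEuclideanLin (v ξ)

/-- The graph of the operator `A = P₁ ∂_ξ H + P₀ H` on `L^p([a,b], 𝕜ⁿ)` with domain
`{x | H x ∈ W^{1,p}, W_B [(H x)(b); (H x)(a)] = 0}`. -/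
def operatorGraph (sys : HBCS 𝕜 n) (p : ℝ≥0∞) : Set (sys.StateSpace p × sys.StateSpace p) :=
  {q | ∃ v : ℝ → EuclideanSpace 𝕜 (Fin n), sys.IsDiffExpr p q.1 q.2 v ∧
    sys.W_B.toEuclideanLin (sys.boundaryVector v) = 0}

/-- The standing assumptions on a hyperbolic boundary control system. In the last one, the norm of
`L²([a,b], 𝕜ⁿ)` is used; the inner product `½ ∫ g* H f` induces an equivalent norm since `H` is
bounded and uniformly positive, and being a generator does not depend on this choice. -/
structure StandingAssumptions (sys : HBCS 𝕜 n) : Prop where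
  P₁_isUnit : IsUnit sys.P₁
  P₁_selfAdjoint : sys.P₁.IsHermitian
  P₀_bounded : ∀ i j, MemLp (fun ξ => sys.P₀ ξ i j) ∞ sys.μ
  H_bounded : ∀ i j, MemLp (fun ξ => sys.H ξ i j) ∞ sys.μ
  H_selfAdjoint : ∀ᵐ ξ ∂sys.μ, (sys.H ξ).IsHermitian
  H_bounds : ∃ m M : ℝ, 0 < m ∧ 0 < M ∧ ∀ᵐ ξ ∂sys.μ,
    (sys.H ξ - (m : 𝕜) • (1 : Matrix (Fin n) (Fin n) 𝕜)).PosSemidef ∧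
    ((M : 𝕜) • (1 : Matrix (Fin n) (Fin n) 𝕜) - sys.H ξ).PosSemidef
  W_B_fullRank : sys.W_B.rank = n
  W_fullRank : (Matrix.fromRows sys.W_B sys.W_C).rank = 2 * n
  generator : ∃ S : C0Semigroup 𝕜 (sys.StateSpace 2), S.IsGenerator (sys.operatorGraph 2)

/-- `C¹`-diagonalisability: `P₁ H = S⁻¹ P₁ᴰ Hᴰ S` with `S, Hᴰ ∈ C¹([a,b], 𝕜ⁿˣⁿ)`, `S` pointwise
invertible, `Hᴰ` diagonal and positive, and `P₁ᴰ = diag(I_m, -I_{n-m})`. The identity is one between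
`L^∞` functions, hence is required almost everywhere. -/
def IsC1Diagonalisable (sys : HBCS 𝕜 n) : Prop :=
  ∃ (S HD : ℝ → Matrix (Fin n) (Fin n) 𝕜) (m : ℕ), m ≤ n ∧
    (∀ i j, ContDiffOn ℝ 1 (fun ξ => S ξ i j) (Icc sys.a sys.b)) ∧
    (∀ i j, ContDiffOn ℝ 1 (fun ξ => HD ξ i j) (Icc sys.a sys.b)) ∧
    (∀ ξ ∈ Icc sys.a sys.b, IsUnit (S ξ) ∧ (HD ξ).IsDiag ∧ (HD ξ).PosDef) ∧
    ∀ᵐ ξ ∂sys.μ, sys.P₁ * sys.H ξ =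
      (S ξ)⁻¹ * Matrix.diagonal (fun i : Fin n => if (i : ℕ) < m then (1 : 𝕜) else -1) * HD ξ * S ξ

/-- Exponential stability of the system on the state space `L^p([a,b], 𝕜ⁿ)`: the operator `A`,
considered on `L^p([a,b], 𝕜ⁿ)`, generates an exponentially stable `C₀`-semigroup. -/
def IsExponentiallyStableOn (sys : HBCS 𝕜 n) (p : ℝ≥0∞) [Fact (1 ≤ p)] : Prop :=
  ∃ S : C0Semigroup 𝕜 (sys.StateSpace p),
    S.IsGenerator (sys.operatorGraph p) ∧ S.IsExponentiallyStable

/-- Classical solutions `(u, x, y)`: `u, y ∈ C([0,∞), 𝕜ⁿ)` and `x ∈ C¹([0,∞), L²([a,b], 𝕜ⁿ))`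
satisfy the differential equation, the input equation and the output equation for all `t ≥ 0`
(only the values at times `t ≥ 0` matter). -/
def IsClassicalSolution (sys : HBCS 𝕜 n) (u : ℝ → EuclideanSpace 𝕜 (Fin n))
    (x : ℝ → sys.StateSpace 2) (y : ℝ → EuclideanSpace 𝕜 (Fin n)) : Prop :=
  ContinuousOn u (Ici 0) ∧ ContinuousOn y (Ici 0) ∧
  ∃ x' : ℝ → sys.StateSpace 2, ContinuousOn x' (Ici 0) ∧
    ∀ t ∈ Ici (0 : ℝ), HasDerivWithinAt x (x' t) (Ici 0) t ∧
      ∃ v : ℝ → EuclideanSpace 𝕜 (Fin n), sys.IsDiffExpr 2 (x t) (x' t) v ∧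
        u t = sys.W_B.toEuclideanLin (sys.boundaryVector v) ∧
        y t = sys.W_C.toEuclideanLin (sys.boundaryVector v)

/-- BIBO stability: there is `c > 0` with `‖y‖_{L^∞([0,t])} ≤ c ‖u‖_{L^∞([0,t])}` for all `t > 0`
and all classical solutions with `x(0) = 0` and `u ∈ C_c^∞([0,∞), 𝕜ⁿ)`. -/
def IsBIBOStable (sys : HBCS 𝕜 n) : Prop :=
  ∃ c : ℝ≥0, 0 < c ∧
    ∀ (u : ℝ → EuclideanSpace 𝕜 (Fin n)) (x : ℝ → sys.StateSpace 2)
      (y : ℝ → EuclideanSpace 𝕜 (Fin n)),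
      sys.IsClassicalSolution u x y → x 0 = 0 →
      ContDiffOn ℝ (⊤ : ℕ∞) u (Ici 0) → (∃ R : ℝ, ∀ t, R < t → u t = 0) →
      ∀ t : ℝ, 0 < t →
        eLpNorm y ∞ (volume.restrict (Icc 0 t)) ≤
          c * eLpNorm u ∞ (volume.restrict (Icc 0 t))

end HBCS

/-!
Let `S` diagonalise the principal part `P₁ H`. The components of `S x` are transported along the
characteristics. Hence, in `L¹`, the sign functional yields a dissipation inequality: the norm
`∑ i, ‖w i • (S x) i‖`, with weights `w i` equal to a small `δ` at the inflow ends and to `1` at the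
outflow ends, decreases at the rate of the outgoing boundary values and grows at most at the rate of
`δ` times the incoming ones plus a multiple of `‖x‖`. If zero input and zero outgoing values force
all boundary values to vanish, then the incoming values can be absorbed, and over finite times the
final state and the `L¹`-norm of the output are controlled by the initial state and the `L¹`-norm of
the input.

That implication follows from the well-posedness of the system in `L¹`: otherwise, for every `l > 0`
there is an `x ≠ 0` in the domain of the generator `A`, concentrated near the inflow ends for large
`l`, with `‖l x - A x‖ ≤ C ‖x‖` for a `C` independent of `l`, contrary to the resolvent estimate
`l ‖x‖ ≤ M ‖l x - A x‖`.

Finally, by exponential stability the response to a smooth approximation of a unit impulse has an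
output in `L¹(0, ∞)`, with a bound independent of the approximation. By superposition, this bounds
the output pointwise by the supremum of the input.
-/

namespace C0Semigroup

variable {X : Type*} [NormedAddCommGroup X] [NormedSpace ℝ X]

theorem continuous_orbit (S : C0Semigroup ℝ X) {M : ℝ} (hM : ∀ t, ‖S.T t‖ ≤ M) (x : X) :
    Continuous fun t => S.T t x := by
  have increment_le : ∀ s t : ℝ≥0, s ≤ t → ‖S.T t x - S.T s x‖ ≤ M * ‖S.T (t - s) x - x‖ := by
    intro s t hst
    have h : S.T t x = S.T s (S.T (t - s) x) := by
      rw [← ContinuousLinearMap.comp_apply, ← S.map_add, add_tsub_cancel_of_le hst]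
    rw [h, ← map_sub]
    exact (S.T s).le_of_opNorm_le (hM s) _
  have tendsto_zero : Tendsto (fun r : ℝ≥0 => M * ‖S.T r x - x‖) (𝓝 0) (𝓝 0) := by
    simpa using ((S.strongly_continuous x).sub_const x).norm.const_mul M
  refine continuous_iff_continuousAt.2 fun t => ?_
  rw [ContinuousAt, tendsto_iff_norm_sub_tendsto_zero]
  have dist_tendsto : Tendsto (fun s : ℝ≥0 => max (s - t) (t - s)) (𝓝 t) (𝓝 0) := by
    have : Continuous fun s : ℝ≥0 => max (s - t) (t - s) := by fun_prop
    simpa using this.tendsto t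
  refine squeeze_zero (fun _ => norm_nonneg _) (fun s => ?_) (tendsto_zero.comp dist_tendsto)
  rcases le_total s t with h | h
  · simpa [norm_sub_rev, tsub_eq_zero_of_le h] using increment_le s t h
  · simpa [tsub_eq_zero_of_le h] using increment_le t s h

theorem IsExponentiallyStable.exists_norm_le {S : C0Semigroup ℝ X} (h : S.IsExponentiallyStable) :
    ∃ M : ℝ, ∀ t, ‖S.T t‖ ≤ M := by
  obtain ⟨M, ω, hω, hM⟩ := h
  have hM0 : 0 ≤ M := by simpa using (norm_nonneg _).trans (hM 0)
  refine ⟨M, fun t => (hM t).trans (mul_le_of_le_one_right hM0 (Real.exp_le_one_iff.2 ?_))⟩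
  nlinarith [t.coe_nonneg]

/-! ### Duhamel's formula -/

/-- The orbit of `p`, extended by zero to negative times. -/
noncomputable def extOrbit (S : C0Semigroup ℝ X) (p : X) : ℝ → X :=
  (Ici (0 : ℝ)).indicator fun s => S.T s.toNNReal p

theorem extOrbit_of_nonneg (S : C0Semigroup ℝ X) (p : X) {s : ℝ} (hs : 0 ≤ s) :
    S.extOrbit p s = S.T s.toNNReal p := indicator_of_mem (mem_Ici.2 hs) _

theorem extOrbit_of_neg (S : C0Semigroup ℝ X) (p : X) {s : ℝ} (hs : s < 0) :
    S.extOrbit p s = 0 := indicator_of_notMem (by simpa using hs) _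

theorem extOrbit_add (S : C0Semigroup ℝ X) (p : X) {s h : ℝ} (hs : 0 ≤ s) (hh : 0 ≤ h) :
    S.extOrbit p (s + h) = S.T h.toNNReal (S.extOrbit p s) := by
  rw [S.extOrbit_of_nonneg p hs, S.extOrbit_of_nonneg p (add_nonneg hs hh),
    ← ContinuousLinearMap.comp_apply, ← S.map_add, Real.toNNReal_add hs hh, add_comm]

theorem locallyIntegrable_extOrbit (S : C0Semigroup ℝ X) {M : ℝ} (hM : ∀ t, ‖S.T t‖ ≤ M) (p : X) :
    LocallyIntegrable (S.extOrbit p) volume := by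
  have : Continuous fun s : ℝ => S.T s.toNNReal p :=
    (S.continuous_orbit hM p).comp continuous_real_toNNReal
  exact this.locallyIntegrable.indicator measurableSet_Ici

/-- The solution of `z' = A z + φ p` with zero history, given by Duhamel's formula. -/
noncomputable def duhamel (S : C0Semigroup ℝ X) (φ : ℝ → ℝ) (p : X) : ℝ → X :=
  convolution φ (S.extOrbit p) (ContinuousLinearMap.lsmul ℝ ℝ)

theorem duhamel_apply (S : C0Semigroup ℝ X) (φ : ℝ → ℝ) (p : X) (t : ℝ) :
    S.duhamel φ p t = ∫ r, φ r • S.extOrbit p (t - r) := rfl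

theorem integrable_smul_extOrbit (S : C0Semigroup ℝ X) {M : ℝ} (hM : ∀ t, ‖S.T t‖ ≤ M) {φ : ℝ → ℝ}
    (hφ : Continuous φ) (hc : HasCompactSupport φ) (p : X) (t : ℝ) :
    Integrable fun r => φ r • S.extOrbit p (t - r) :=
  hc.convolutionExists_left (ContinuousLinearMap.lsmul ℝ ℝ) hφ
    (S.locallyIntegrable_extOrbit hM p) t

theorem continuous_duhamel (S : C0Semigroup ℝ X) {M : ℝ} (hM : ∀ t, ‖S.T t‖ ≤ M) {φ : ℝ → ℝ}
    (hφ : Continuous φ) (hc : HasCompactSupport φ) (p : X) : Continuous (S.duhamel φ p) :=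
  hc.continuous_convolution_left _ hφ (S.locallyIntegrable_extOrbit hM p)

theorem hasDerivAt_duhamel (S : C0Semigroup ℝ X) {M : ℝ} (hM : ∀ t, ‖S.T t‖ ≤ M) {φ : ℝ → ℝ}
    (hφ : ContDiff ℝ 1 φ) (hc : HasCompactSupport φ) (p : X) (t : ℝ) :
    HasDerivAt (S.duhamel φ p) (S.duhamel (deriv φ) p t) t :=
  hc.hasDerivAt_convolution_left _ hφ (S.locallyIntegrable_extOrbit hM p) t

theorem duhamel_of_nonpos (S : C0Semigroup ℝ X) {φ : ℝ → ℝ} (hφ : ∀ r ≤ 0, φ r = 0) (p : X)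
    {t : ℝ} (ht : t ≤ 0) : S.duhamel φ p t = 0 := by
  refine integral_eq_zero_of_ae (ae_of_all _ fun r => ?_)
  rcases le_or_gt r 0 with hr | hr
  · simp [hφ r hr]
  · simp [S.extOrbit_of_neg p (show t - r < 0 by linarith)]

variable [CompleteSpace X]

theorem map_duhamel (S : C0Semigroup ℝ X) {M : ℝ} (hM : ∀ t, ‖S.T t‖ ≤ M) {φ : ℝ → ℝ}
    (hφ : Continuous φ) (hc : HasCompactSupport φ) (p : X) (t : ℝ) {h : ℝ} (hh : 0 ≤ h) :
    S.T h.toNNReal (S.duhamel φ p t) = S.duhamel φ p (t + h) -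
      ∫ r in t..t + h, φ r • S.extOrbit p (t + h - r) := by
  have hi := S.integrable_smul_extOrbit hM hφ hc p (t + h)
  rw [intervalIntegral.integral_of_le (by linarith), ← integral_indicator measurableSet_Ioc,
    duhamel_apply, duhamel_apply,
    ← ContinuousLinearMap.integral_comp_comm _ (S.integrable_smul_extOrbit hM hφ hc p t),
    ← integral_sub hi (hi.indicator measurableSet_Ioc)]
  congr with r
  rw [map_smul]
  rcases le_or_gt r t with hr | hr
  · rw [indicator_of_notMem (fun h' => hr.not_gt h'.1), sub_zero,
      ← S.extOrbit_add p (by linarith) hh, sub_add_eq_add_sub]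
  rw [S.extOrbit_of_neg p (by linarith : t - r < 0)]
  rcases le_or_gt r (t + h) with hrh | hrh
  · simp [indicator_of_mem (show r ∈ Ioc t (t + h) from ⟨hr, hrh⟩)]
  · simp [S.extOrbit_of_neg p (by linarith : t + h - r < 0)]

theorem duhamel_eq_of_ge (S : C0Semigroup ℝ X) {M : ℝ} (hM : ∀ t, ‖S.T t‖ ≤ M) {φ : ℝ → ℝ}
    (hφ : Continuous φ) (hc : HasCompactSupport φ) (p : X) {t₀ t : ℝ}
    (hsupp : ∀ r, t₀ ≤ r → φ r = 0) (ht : t₀ ≤ t) :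
    S.duhamel φ p t = S.T (t - t₀).toNNReal (S.duhamel φ p t₀) := by
  rw [S.map_duhamel hM hφ hc p t₀ (sub_nonneg.2 ht), add_sub_cancel,
    intervalIntegral.integral_congr (g := fun _ => (0 : X)), intervalIntegral.integral_zero,
    sub_zero]
  intro r hr
  rw [uIcc_of_le ht] at hr
  simp [hsupp r hr.1]

theorem tendsto_average_extOrbit (S : C0Semigroup ℝ X) {M : ℝ} (hM : ∀ t, ‖S.T t‖ ≤ M)
    {φ : ℝ → ℝ} (hφ : Continuous φ) (p : X) (t : ℝ) :
    Tendsto (fun h : ℝ => h⁻¹ • ∫ r in t..t + h, φ r • S.extOrbit p (t + h - r)) (𝓝[>] 0)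
      (𝓝 (φ t • p)) := by
  set F : ℝ → ℝ → X := fun h s => φ (t + h * s) • S.T (h - h * s).toNNReal p with hF
  have F_continuous : Continuous (Function.uncurry F) :=
    (by fun_prop : Continuous fun q : ℝ × ℝ => φ (t + q.1 * q.2)).smul
      ((S.continuous_orbit hM p).comp (continuous_real_toNNReal.comp (by fun_prop)))
  have tendsto_F : Tendsto (fun h => ∫ s in (0 : ℝ)..1, F h s) (𝓝[>] 0) (𝓝 (φ t • p)) := by
    refine ((intervalIntegral.continuous_parametric_intervalIntegral_of_continuous'
      F_continuous 0 1).tendsto' 0 _ ?_).mono_left nhdsWithin_le_nhds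
    simp [hF, S.map_zero]
  refine tendsto_F.congr' ?_
  filter_upwards [self_mem_nhdsWithin] with h hh
  have hh : 0 < h := hh
  have rescale := intervalIntegral.integral_comp_add_mul (a := 0) (b := 1)
    (fun r => φ r • S.extOrbit p (t + h - r)) hh.ne' t
  rw [mul_zero, mul_one, add_zero] at rescale
  rw [← rescale]
  refine intervalIntegral.integral_congr fun s hs => ?_
  rw [uIcc_of_le zero_le_one] at hs
  simp only [hF]
  rw [show t + h - (t + h * s) = h - h * s by ring, S.extOrbit_of_nonneg]
  nlinarith [hs.2]

theorem IsGenerator.duhamel_mem {S : C0Semigroup ℝ X} {A : Set (X × X)} (hA : S.IsGenerator A)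
    {M : ℝ} (hM : ∀ t, ‖S.T t‖ ≤ M) {φ : ℝ → ℝ} (hφ : ContDiff ℝ 1 φ) (hc : HasCompactSupport φ)
    (p : X) (t : ℝ) : (S.duhamel φ p t, S.duhamel (deriv φ) p t - φ t • p) ∈ A := by
  rw [hA]
  have slope_tendsto :=
    (hasDerivAt_iff_tendsto_slope_zero.1 (S.hasDerivAt_duhamel hM hφ hc p t)).mono_left
      (nhdsWithin_mono 0 fun h (hh : 0 < h) => hh.ne')
  have coe_tendsto : Tendsto (fun h : ℝ≥0 => (h : ℝ)) (𝓝[>] 0) (𝓝[>] 0) :=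
    tendsto_nhdsWithin_iff.2
      ⟨(NNReal.continuous_coe.tendsto' 0 0 rfl).mono_left nhdsWithin_le_nhds,
        eventually_nhdsWithin_of_forall fun h hh => by simpa using hh⟩
  refine ((slope_tendsto.sub (S.tendsto_average_extOrbit hM hφ.continuous p t)).comp
    coe_tendsto).congr fun h => ?_
  have hmap := S.map_duhamel hM hφ.continuous hc p t h.2
  simp only [NNReal.val_eq_coe, Real.toNNReal_coe] at hmap
  simp only [Function.comp_apply, hmap, RCLike.ofReal_real_eq_id, id_eq]
  rw [← smul_sub, sub_right_comm]

end C0Semigroup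

/-! ### A Hille–Yosida estimate -/

namespace C0Semigroup

variable {X : Type*} [NormedAddCommGroup X] [NormedSpace ℝ X]
  {S : C0Semigroup ℝ X} {A : Set (X × X)} {x z : X}

theorem IsGenerator.hasDerivWithinAt (hA : S.IsGenerator A) (hx : (x, z) ∈ A) {t : ℝ}
    (ht : 0 ≤ t) :
    HasDerivWithinAt (fun s : ℝ => S.T s.toNNReal x) (S.T t.toNNReal z) (Ici t) t := by
  rw [← hasDerivWithinAt_Ioi_iff_Ici, hasDerivWithinAt_iff_tendsto_slope' self_notMem_Ioi]
  have shift_tendsto : Tendsto (fun s : ℝ => (s - t).toNNReal) (𝓝[>] t) (𝓝[>] 0) := by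
    refine tendsto_nhdsWithin_iff.2 ⟨?_, eventually_nhdsWithin_of_forall fun s (hs : t < s) => ?_⟩
    · have : Continuous fun s : ℝ => (s - t).toNNReal := by fun_prop
      exact (this.tendsto' t 0 (by simp)).mono_left nhdsWithin_le_nhds
    · simpa using hs
  refine ((((S.T t.toNNReal).continuous.tendsto z).comp ((hA x z).1 hx)).comp
    shift_tendsto).congr' ?_
  filter_upwards [self_mem_nhdsWithin] with s hs
  have hs : 0 ≤ s - t := sub_nonneg.2 (le_of_lt hs)
  have semigroup_law : S.T s.toNNReal x = S.T t.toNNReal (S.T (s - t).toNNReal x) := by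
    rw [← ContinuousLinearMap.comp_apply, ← S.map_add, ← Real.toNNReal_add ht hs, add_sub_cancel]
  simp only [Function.comp_apply, slope_def_module, RCLike.ofReal_real_eq_id, id_eq, map_smul,
    map_sub, semigroup_law, Real.coe_toNNReal _ hs]

theorem IsGenerator.norm_exp_smul_sub_le (hA : S.IsGenerator A) {M : ℝ} (hM : ∀ t, ‖S.T t‖ ≤ M)
    (hx : (x, z) ∈ A) {l : ℝ} (hl : 0 < l) {t : ℝ} (ht : 0 ≤ t) :
    ‖Real.exp (-l * t) • S.T t.toNNReal x - x‖ ≤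
      M * ‖z - l • x‖ / l * (1 - Real.exp (-l * t)) := by
  have exp_deriv (s : ℝ) : HasDerivAt (fun s => Real.exp (-l * s)) (Real.exp (-l * s) * -l) s := by
    simpa using ((hasDerivAt_id s).const_mul (-l)).exp
  have orbit_continuous : Continuous fun s : ℝ => Real.exp (-l * s) • S.T s.toNNReal x - x :=
    ((by fun_prop : Continuous fun s => Real.exp (-l * s)).smul
      ((S.continuous_orbit hM x).comp continuous_real_toNNReal)).sub continuous_const
  refine image_norm_le_of_norm_deriv_right_le_deriv_boundary (a := 0) (b := t)
    (f' := fun s => Real.exp (-l * s) • S.T s.toNNReal (z - l • x))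
    (B := fun s => M * ‖z - l • x‖ / l * (1 - Real.exp (-l * s)))
    (B' := fun s => M * ‖z - l • x‖ * Real.exp (-l * s))
    orbit_continuous.continuousOn (fun s hs => ?_) ?_ (fun s => ?_) (fun s _ => ?_)
    (right_mem_Icc.2 ht)
  · convert! ((exp_deriv s).hasDerivWithinAt.smul (hA.hasDerivWithinAt hx hs.1)).sub_const x using 1
    rw [map_sub, map_smul, smul_sub, mul_smul, neg_smul, smul_neg, sub_eq_add_neg]
  · simp [S.map_zero]
  · convert! ((exp_deriv s).const_sub 1).const_mul (M * ‖z - l • x‖ / l) using 1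
    field_simp
  · rw [norm_smul, Real.norm_of_nonneg (Real.exp_pos _).le, mul_comm]
    gcongr
    exact (S.T _).le_of_opNorm_le (hM _) _

theorem IsGenerator.mul_norm_le (hA : S.IsGenerator A) {M : ℝ} (hM : ∀ t, ‖S.T t‖ ≤ M)
    (hx : (x, z) ∈ A) {l : ℝ} (hl : 0 < l) : l * ‖x‖ ≤ M * ‖z - l • x‖ := by
  have exp_tendsto : Tendsto (fun t : ℝ => Real.exp (-l * t)) atTop (𝓝 0) :=
    Real.tendsto_exp_atBot.comp (tendsto_id.const_mul_atTop_of_neg (neg_neg_of_pos hl))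
  have orbit_tendsto : Tendsto (fun t : ℝ => Real.exp (-l * t) • S.T t.toNNReal x) atTop (𝓝 0) := by
    refine squeeze_zero_norm (fun t => ?_)
      (by simpa only [zero_mul] using exp_tendsto.mul_const (M * ‖x‖))
    rw [norm_smul, Real.norm_of_nonneg (Real.exp_pos _).le]
    exact mul_le_mul_of_nonneg_left ((S.T _).le_of_opNorm_le (hM _) _) (Real.exp_pos _).le
  have hlim := le_of_tendsto_of_tendsto (orbit_tendsto.sub_const x).norm
    ((exp_tendsto.const_sub 1).const_mul (M * ‖z - l • x‖ / l))
    ((eventually_ge_atTop 0).mono fun t ht => hA.norm_exp_smul_sub_le hM hx hl ht)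
  rw [zero_sub, norm_neg, sub_zero, mul_one, le_div_iff₀ hl] at hlim
  linarith

end C0Semigroup

/-! ### Bounded outputs from energy estimates -/

theorem continuous_integral_smul_comp_sub {E : Type*} [NormedAddCommGroup E] [NormedSpace ℝ E]
    {k : ℝ → ℝ} (hk : Continuous k) {w : ℝ → E} (hw : Continuous w) (a b : ℝ) :
    Continuous fun t => ∫ s in a..b, k s • w (t - s) :=
  intervalIntegral.continuous_parametric_intervalIntegral_of_continuous'
    ((hk.comp continuous_snd).smul (hw.comp (continuous_fst.sub continuous_snd))) a b

theorem hasDerivAt_integral_smul_comp_sub {E : Type*} [NormedAddCommGroup E] [NormedSpace ℝ E]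
    {k : ℝ → ℝ} (hk : Continuous k) {x x' : ℝ → E} (hx : ∀ t, HasDerivAt x (x' t) t)
    (hx' : Continuous x') (a b t : ℝ) :
    HasDerivAt (fun t => ∫ s in a..b, k s • x (t - s)) (∫ s in a..b, k s • x' (t - s)) t := by
  have hxc : Continuous x := continuous_iff_continuousAt.2 fun t => (hx t).continuousAt
  have kx_continuous (r : ℝ) : Continuous fun s => k s • x (r - s) := by fun_prop
  have kx'_continuous : Continuous fun q : ℝ × ℝ => k q.2 • x' (q.1 - q.2) := by fun_prop
  obtain ⟨C, hC⟩ := ((isCompact_closedBall t 1).prod (isCompact_uIcc (a := a) (b := b))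
    ).exists_bound_of_continuousOn kx'_continuous.continuousOn
  exact (intervalIntegral.hasDerivAt_integral_of_dominated_loc_of_deriv_le
    (F := fun t s => k s • x (t - s)) (F' := fun t s => k s • x' (t - s))
    (bound := fun _ => C) (Metric.ball_mem_nhds t one_pos)
    (Eventually.of_forall fun r => (kx_continuous r).aestronglyMeasurable)
    ((kx_continuous t).intervalIntegrable _ _)
    (by fun_prop : Continuous fun s => k s • x' (t - s)).aestronglyMeasurable
    (ae_of_all _ fun s hs r hr =>
      hC (r, s) ⟨Metric.ball_subset_closedBall hr, uIoc_subset_uIcc hs⟩)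
    intervalIntegrable_const
    (ae_of_all _ fun s _ r _ => ((hx (r - s)).comp_sub_const r s).const_smul (k s))).2

theorem map_integral_smul_comp_sub {E F : Type*} [NormedAddCommGroup E] [NormedSpace ℝ E]
    [CompleteSpace E] [NormedAddCommGroup F] [NormedSpace ℝ F] [CompleteSpace F] (L : E →L[ℝ] F)
    {k : ℝ → ℝ} (hk : Continuous k) {w : ℝ → E} (hw : Continuous w) (a b t : ℝ) :
    L (∫ s in a..b, k s • w (t - s)) = ∫ s in a..b, k s • L (w (t - s)) := by
  rw [← L.intervalIntegral_comp_comm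
    ((by fun_prop : Continuous fun s => k s • w (t - s)).intervalIntegrable a b)]
  simp only [map_smul]

theorem integral_smul_comp_sub_eq_zero {E : Type*} [NormedAddCommGroup E] [NormedSpace ℝ E]
    (k : ℝ → ℝ) {w : ℝ → E} (hw : ∀ t ≤ 0, w t = 0) {b t : ℝ} (hb : 0 ≤ b) (ht : t ≤ 0) :
    ∫ s in (0 : ℝ)..b, k s • w (t - s) = 0 := by
  rw [intervalIntegral.integral_congr (g := fun _ => (0 : E)), intervalIntegral.integral_zero]
  intro s hs
  rw [uIcc_of_le hb] at hs
  simp [hw (t - s) (by linarith [hs.1])]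

/-- Trajectories of the linear system described by `N`. The curve `w = (x, x')` consists of a
`C¹` curve `x` and its derivative, and the system equation reads `N (x, x') = 0`. -/
structure IsTrajectory {X W : Type*} [NormedAddCommGroup X] [NormedSpace ℝ X]
    [NormedAddCommGroup W] [NormedSpace ℝ W] (N : X × X →L[ℝ] W) (w : ℝ → X × X) : Prop where
  hasDerivAt_fst : ∀ t, HasDerivAt (fun s => (w s).1) (w t).2 t
  continuous : Continuous w
  map_eq_zero : ∀ t, N (w t) = 0

namespace IsTrajectory

variable {X W : Type*} [NormedAddCommGroup X] [NormedSpace ℝ X] [NormedAddCommGroup W]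
  [NormedSpace ℝ W] {N : X × X →L[ℝ] W} {w z : ℝ → X × X}

theorem sub (hw : IsTrajectory N w) (hz : IsTrajectory N z) :
    IsTrajectory N fun t => w t - z t where
  hasDerivAt_fst t := (hw.hasDerivAt_fst t).sub (hz.hasDerivAt_fst t)
  continuous := hw.continuous.sub hz.continuous
  map_eq_zero t := by rw [map_sub, hw.map_eq_zero, hz.map_eq_zero, sub_zero]

theorem sum {ι : Type*} (s : Finset ι) {z : ι → ℝ → X × X} (hz : ∀ i, IsTrajectory N (z i)) :
    IsTrajectory N fun t => ∑ i ∈ s, z i t where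
  hasDerivAt_fst t := by
    simp only [Prod.fst_sum, Prod.snd_sum]
    exact HasDerivAt.fun_sum fun i _ => (hz i).hasDerivAt_fst t
  continuous := continuous_finsetSum s fun i _ => (hz i).continuous
  map_eq_zero t := by simp [(hz _).map_eq_zero]

theorem integral_smul_comp_sub [CompleteSpace X] [CompleteSpace W] (hw : IsTrajectory N w)
    {k : ℝ → ℝ} (hk : Continuous k) (a b : ℝ) :
    IsTrajectory N fun t => ∫ s in a..b, k s • w (t - s) where
  hasDerivAt_fst t := by
    have fst_integral (r : ℝ) :
        (∫ s in a..b, k s • w (r - s)).1 = ∫ s in a..b, k s • (w (r - s)).1 :=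
      map_integral_smul_comp_sub (ContinuousLinearMap.fst ℝ X X) hk hw.continuous a b r
    have snd_integral :
        (∫ s in a..b, k s • w (t - s)).2 = ∫ s in a..b, k s • (w (t - s)).2 :=
      map_integral_smul_comp_sub (ContinuousLinearMap.snd ℝ X X) hk hw.continuous a b t
    simp only [fst_integral, snd_integral]
    exact hasDerivAt_integral_smul_comp_sub hk hw.hasDerivAt_fst hw.continuous.snd a b t
  continuous := continuous_integral_smul_comp_sub hk hw.continuous a b
  map_eq_zero t := by
    simp [map_integral_smul_comp_sub N hk hw.continuous, hw.map_eq_zero]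

theorem eq_zero_of_fst_eq_zero (hw : IsTrajectory N w) {T t : ℝ} (h0 : ∀ t ≤ T, (w t).1 = 0)
    (ht : t ≤ T) : w t = 0 := by
  have eqOn_Iio : EqOn (fun s => (w s).2) 0 (Iio T) := fun s hs =>
    (hw.hasDerivAt_fst s).unique ((hasDerivAt_const s (0 : X)).congr_of_eventuallyEq
      (eventually_of_mem (Iio_mem_nhds hs) fun r hr => h0 r (le_of_lt hr)))
  have eqOn_Iic := eqOn_Iio.closure hw.continuous.snd continuous_const
  rw [closure_Iio] at eqOn_Iic
  exact Prod.ext (h0 t ht) (eqOn_Iic ht)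

end IsTrajectory

/-- A smooth probability density on `(0, 1)`, used as an approximate unit impulse. -/
structure IsUnitPulse (φ : ℝ → ℝ) : Prop where
  contDiff : ContDiff ℝ 2 φ
  tsupport_subset : tsupport φ ⊆ Ioo 0 1
  nonneg : ∀ r, 0 ≤ φ r
  integral_eq_one : ∫ r, φ r = 1

theorem exists_isUnitPulse {ε : ℝ} (hε : 0 < ε) :
    ∃ φ : ℝ → ℝ, IsUnitPulse φ ∧ Function.support φ ⊆ Metric.ball 0 ε := by
  have hδ : 0 < min ε 1 := lt_min hε one_pos
  let f : ContDiffBump (min ε 1 / 2) := ⟨min ε 1 / 8, min ε 1 / 4, by positivity, by linarith⟩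
  have tsupport_subset : tsupport (f.normed volume) ⊆ Ioo 0 (min ε 1) := by
    rw [f.tsupport_normed_eq, Real.closedBall_eq_Icc]
    refine Icc_subset_Ioo ?_ ?_ <;> simp only [f] <;> linarith
  refine ⟨f.normed volume, ⟨f.contDiff_normed, tsupport_subset.trans
    (Ioo_subset_Ioo_right (min_le_right _ _)), f.nonneg_normed, f.integral_normed⟩,
    (subset_tsupport _).trans (tsupport_subset.trans fun r hr => ?_)⟩
  rw [Metric.mem_ball, Real.dist_eq, sub_zero, abs_of_pos hr.1]
  exact hr.2.trans_le (min_le_left _ _)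

namespace IsUnitPulse

variable {φ : ℝ → ℝ}

theorem support_subset (hφ : IsUnitPulse φ) : Function.support φ ⊆ Ioo 0 1 :=
  (subset_tsupport φ).trans hφ.tsupport_subset

theorem eq_zero_of_one_le (hφ : IsUnitPulse φ) {r : ℝ} (hr : 1 ≤ r) : φ r = 0 :=
  Function.notMem_support.1 fun h => (hφ.support_subset h).2.not_ge hr

theorem intervalIntegral_eq_one (hφ : IsUnitPulse φ) : ∫ r in (0 : ℝ)..1, φ r = 1 := by
  rw [intervalIntegral.integral_eq_integral_of_support_subset
    (hφ.support_subset.trans Ioo_subset_Ioc_self), hφ.integral_eq_one]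

theorem intervalIntegral_mul_comp_sub_comm (hφ : IsUnitPulse φ) {u : ℝ → ℝ}
    (hu : ∀ t ≤ 0, u t = 0) {r T : ℝ} (hrT : r ≤ T) :
    ∫ s in (0 : ℝ)..1, φ s * u (r - s) = ∫ s in (0 : ℝ)..T, u s * φ (r - s) := by
  have hsupp {s : ℝ} (hs : u s * φ (r - s) ≠ 0) : 0 < s ∧ r - s ∈ Ioo (0 : ℝ) 1 :=
    ⟨not_le.1 fun h => hs (by simp [hu s h]), hφ.support_subset (right_ne_zero_of_mul hs)⟩
  have reflect := intervalIntegral.integral_comp_sub_left (a := 0) (b := 1)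
    (fun s => u s * φ (r - s)) r
  simp only [sub_sub_cancel, sub_zero] at reflect
  simp only [mul_comm (φ _), reflect]
  rw [intervalIntegral.integral_eq_integral_of_support_subset,
    intervalIntegral.integral_eq_integral_of_support_subset]
  · exact fun s hs => ⟨(hsupp hs).1, by linarith [(hsupp hs).2.1]⟩
  · exact fun s hs => ⟨by linarith [(hsupp hs).2.2], by linarith [(hsupp hs).2.1]⟩

theorem norm_sub_intervalIntegral_smul_comp_sub_le (hφ : IsUnitPulse φ) {Y : Type*}
    [NormedAddCommGroup Y] [NormedSpace ℝ Y] [CompleteSpace Y]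
    {y : ℝ → Y} (hy : Continuous y) {ε δ t : ℝ} (hδ : 0 ≤ δ)
    (hφε : Function.support φ ⊆ Metric.ball 0 ε)
    (hyε : ∀ s ∈ Metric.ball t ε, dist (y s) (y t) ≤ δ) :
    ‖y t - ∫ s in (0 : ℝ)..1, φ s • y (t - s)‖ ≤ δ := by
  rw [intervalIntegral.integral_eq_integral_of_support_subset, norm_sub_rev, ← dist_eq_norm]
  · exact dist_convolution_le hδ hφε hφ.nonneg hφ.integral_eq_one hy.aestronglyMeasurable hyε
  · exact (Function.support_smul_subset_left φ fun s => y (t - s)).trans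
      (hφ.support_subset.trans Ioo_subset_Ioc_self)

end IsUnitPulse

section OutputBound

variable {X W U Y : Type*} [NormedAddCommGroup X] [NormedSpace ℝ X]
  [NormedAddCommGroup W] [NormedSpace ℝ W] [NormedAddCommGroup U] [NormedSpace ℝ U]
  [NormedAddCommGroup Y] [NormedSpace ℝ Y]

/-- On time intervals of fixed length, the state and the `L¹`-norm of the output `c w` of a
trajectory `w` are controlled by the initial state and the `L¹`-norm of the input `d w`. -/
def EnergyEstimate (N : X × X →L[ℝ] W) (d : X × X →L[ℝ] U) (c : X × X →L[ℝ] Y) : Prop :=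
  ∀ τ : ℝ, 0 ≤ τ → ∃ K : ℝ, 0 ≤ K ∧ ∀ w, IsTrajectory N w → ∀ t₀ : ℝ,
    ‖(w (t₀ + τ)).1‖ ≤ K * (‖(w t₀).1‖ + ∫ t in t₀..t₀ + τ, ‖d (w t)‖) ∧
    ∫ t in t₀..t₀ + τ, ‖c (w t)‖ ≤ K * (‖(w t₀).1‖ + ∫ t in t₀..t₀ + τ, ‖d (w t)‖)

variable {N : X × X →L[ℝ] W} {d : X × X →L[ℝ] U} {c : X × X →L[ℝ] Y} {w : ℝ → X × X}

theorem EnergyEstimate.eq_zero (henergy : EnergyEstimate N d c) (hw : IsTrajectory N w)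
    (h0 : ∀ t ≤ 0, (w t).1 = 0) {T : ℝ} (hd : ∀ t ∈ Icc 0 T, d (w t) = 0) {t : ℝ} (ht : t ≤ T) :
    w t = 0 := by
  refine hw.eq_zero_of_fst_eq_zero (fun r hr => ?_) ht
  rcases le_total r 0 with hr0 | hr0
  · exact h0 r hr0
  obtain ⟨K, _, hK⟩ := henergy r hr0
  have no_input : ∫ s in (0 : ℝ)..0 + r, ‖d (w s)‖ = 0 := by
    rw [intervalIntegral.integral_congr (g := fun _ => (0 : ℝ)), intervalIntegral.integral_zero]
    intro s hs
    rw [zero_add, uIcc_of_le hr0] at hs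
    simp [hd s ⟨hs.1, hs.2.trans hr⟩]
  have hbound := (hK w hw 0).1
  rw [no_input, h0 0 le_rfl] at hbound
  simpa using hbound

/-- The trajectory with zero history and input `φ • d (q, p)`, where `N (q, p) = 0`: the ansatz
`x = φ q + z` with `z' = A z + φ p - φ' q` has this input because `A` is the restriction of the
system to zero input, and `z` is given by Duhamel's formula. -/
noncomputable def pulseResponse (S : C0Semigroup ℝ X) (φ : ℝ → ℝ) (q p : X) (t : ℝ) : X × X :=
  φ t • (q, p) + (S.duhamel φ p t, S.duhamel (deriv φ) p t - φ t • p) -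
    (S.duhamel (deriv φ) q t, S.duhamel (deriv (deriv φ)) q t - deriv φ t • q)

namespace IsUnitPulse

variable {φ : ℝ → ℝ}

theorem eq_zero_of_tsupport_subset {f : ℝ → ℝ} (hf : tsupport f ⊆ Ioo 0 1) {r : ℝ}
    (hr : r ∉ Ioo 0 1) : f r = 0 :=
  image_eq_zero_of_notMem_tsupport fun h => hr (hf h)

theorem tsupport_deriv_subset (hφ : IsUnitPulse φ) : tsupport (deriv φ) ⊆ Ioo 0 1 :=
  _root_.tsupport_deriv_subset.trans hφ.tsupport_subset

theorem hasCompactSupport (hφ : IsUnitPulse φ) : HasCompactSupport φ :=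
  isCompact_Icc.of_isClosed_subset (isClosed_tsupport φ)
    (hφ.tsupport_subset.trans Ioo_subset_Icc_self)

theorem contDiff_deriv (hφ : IsUnitPulse φ) : ContDiff ℝ 1 (deriv φ) :=
  ((contDiff_succ_iff_deriv (n := 1)).1 hφ.contDiff).2.2

theorem pulseResponse_of_nonpos (hφ : IsUnitPulse φ) (S : C0Semigroup ℝ X) (q p : X) {t : ℝ}
    (ht : t ≤ 0) : pulseResponse S φ q p t = 0 := by
  have vanish {f : ℝ → ℝ} (hf : tsupport f ⊆ Ioo 0 1) (r : ℝ) (hr : r ≤ 0) : f r = 0 :=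
    eq_zero_of_tsupport_subset hf fun h => h.1.not_ge hr
  have h0 := vanish hφ.tsupport_subset
  have h1 := vanish hφ.tsupport_deriv_subset
  have h2 := vanish (_root_.tsupport_deriv_subset.trans hφ.tsupport_deriv_subset)
  simp [pulseResponse, h0 t ht, h1 t ht, S.duhamel_of_nonpos h0 _ ht, S.duhamel_of_nonpos h1 _ ht,
    S.duhamel_of_nonpos h2 _ ht]

variable [CompleteSpace X] {S : C0Semigroup ℝ X} {M : ℝ} {q p : X}

theorem isTrajectory_pulseResponse (hφ : IsUnitPulse φ)
    (hS : S.IsGenerator {v | N v = 0 ∧ d v = 0}) (hM : ∀ t, ‖S.T t‖ ≤ M) (hqp : N (q, p) = 0) :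
    IsTrajectory N (pulseResponse S φ q p) where
  hasDerivAt_fst t := by
    have hφ1 : ContDiff ℝ 1 φ := hφ.contDiff.of_le one_le_two
    have := (((hφ1.differentiable one_ne_zero t).hasDerivAt.smul_const q).add
      (S.hasDerivAt_duhamel hM hφ1 hφ.hasCompactSupport p t)).sub
      (S.hasDerivAt_duhamel hM hφ.contDiff_deriv hφ.hasCompactSupport.deriv q t)
    convert! this using 1
    simp only [pulseResponse, Prod.smul_mk, Prod.mk_add_mk, Prod.mk_sub_mk]
    abel
  continuous := by
    have hφ' := hφ.contDiff_deriv
    have hc := hφ.hasCompactSupport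
    have φ_continuous := hφ.contDiff.continuous
    have deriv_continuous := hφ'.continuous
    have z₀ := S.continuous_duhamel hM φ_continuous hc p
    have z₁ (v : X) := S.continuous_duhamel hM deriv_continuous hc.deriv v
    have z₂ := S.continuous_duhamel hM (hφ'.continuous_deriv le_rfl) hc.deriv.deriv q
    unfold pulseResponse
    fun_prop
  map_eq_zero t := by
    have mem_p := hS.duhamel_mem hM (hφ.contDiff.of_le one_le_two) hφ.hasCompactSupport p t
    have mem_q := hS.duhamel_mem hM hφ.contDiff_deriv hφ.hasCompactSupport.deriv q t
    rw [pulseResponse, map_sub, map_add, map_smul, hqp, mem_p.1, mem_q.1]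
    simp

theorem input_pulseResponse (hφ : IsUnitPulse φ) (hS : S.IsGenerator {v | N v = 0 ∧ d v = 0})
    (hM : ∀ t, ‖S.T t‖ ≤ M) (t : ℝ) : d (pulseResponse S φ q p t) = φ t • d (q, p) := by
  have mem_p := hS.duhamel_mem hM (hφ.contDiff.of_le one_le_two) hφ.hasCompactSupport p t
  have mem_q := hS.duhamel_mem hM hφ.contDiff_deriv hφ.hasCompactSupport.deriv q t
  rw [pulseResponse, map_sub, map_add, map_smul, mem_p.2, mem_q.2, add_zero, sub_zero]

theorem pulseResponse_fst_of_one_le (hφ : IsUnitPulse φ) (hM : ∀ t, ‖S.T t‖ ≤ M) {t : ℝ}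
    (ht : 1 ≤ t) :
    (pulseResponse S φ q p t).1 = S.T (t - 1).toNNReal (pulseResponse S φ q p 1).1 := by
  have vanish {f : ℝ → ℝ} (hf : tsupport f ⊆ Ioo 0 1) (r : ℝ) (hr : 1 ≤ r) : f r = 0 :=
    eq_zero_of_tsupport_subset hf fun h => h.2.not_ge hr
  simp only [pulseResponse, Prod.fst_sub, hφ.eq_zero_of_one_le ht, hφ.eq_zero_of_one_le le_rfl,
    zero_smul, zero_add, map_sub]
  rw [S.duhamel_eq_of_ge hM hφ.contDiff.continuous hφ.hasCompactSupport p
      (vanish hφ.tsupport_subset) ht,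
    S.duhamel_eq_of_ge hM hφ.contDiff_deriv.continuous hφ.hasCompactSupport.deriv q
      (vanish hφ.tsupport_deriv_subset) ht]

theorem norm_pulseResponse_fst_natCast_le (hφ : IsUnitPulse φ) {ω K : ℝ} (hω : 0 ≤ ω)
    (hM : ∀ t : ℝ≥0, ‖S.T t‖ ≤ M * Real.exp (-ω * t)) (hK : ‖(pulseResponse S φ q p 1).1‖ ≤ K)
    {k : ℕ} (hk : 1 ≤ k) :
    ‖(pulseResponse S φ q p k).1‖ ≤ M * ((Real.exp (-ω))⁻¹ * Real.exp (-ω) ^ k) * K := by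
  have hk1 : (1 : ℝ) ≤ k := by exact_mod_cast hk
  have hM0 : 0 ≤ M := by simpa using (norm_nonneg _).trans (hM 0)
  have exp_eq : Real.exp (-ω * ((k - 1 : ℝ).toNNReal : ℝ)) =
      (Real.exp (-ω))⁻¹ * Real.exp (-ω) ^ k := by
    rw [Real.coe_toNNReal _ (by linarith), ← Real.exp_nat_mul, ← Real.exp_neg, ← Real.exp_add]
    ring_nf
  have norm_T_le (t : ℝ≥0) : ‖S.T t‖ ≤ M :=
    (hM t).trans <| mul_le_of_le_one_right hM0 <| Real.exp_le_one_iff.2 <|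
      mul_nonpos_of_nonpos_of_nonneg (neg_nonpos.2 hω) t.coe_nonneg
  rw [hφ.pulseResponse_fst_of_one_le norm_T_le hk1, ← exp_eq]
  exact (S.T _).le_of_opNorm_le_of_le (hM _) hK

end IsUnitPulse

theorem integral_le_of_forall_unitInterval_le {f : ℝ → ℝ} (hf : Continuous f)
    (hf0 : ∀ s, 0 ≤ f s) {K r : ℝ} (hr0 : 0 ≤ r) (hr1 : r < 1)
    (h : ∀ k : ℕ, ∫ s in (k : ℝ)..k + 1, f s ≤ K * r ^ k) {t : ℝ} (ht : 0 ≤ t) :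
    ∫ s in (0 : ℝ)..t, f s ≤ K / (1 - r) := by
  have hK : 0 ≤ K := by
    simpa using (intervalIntegral.integral_nonneg (by simp) fun s _ => hf0 s).trans (h 0)
  obtain ⟨m, hm⟩ := exists_nat_ge t
  calc ∫ s in (0 : ℝ)..t, f s ≤ ∫ s in (0 : ℝ)..m, f s :=
        intervalIntegral.integral_mono_interval le_rfl ht hm (ae_of_all _ hf0)
          (hf.intervalIntegrable _ _)
    _ = ∑ k ∈ Finset.range m, ∫ s in (k : ℝ)..((k + 1 : ℕ) : ℝ), f s := by
        rw [intervalIntegral.sum_integral_adjacent_intervals (a := fun k : ℕ => (k : ℝ))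
          fun k _ => hf.intervalIntegrable _ _, Nat.cast_zero]
    _ ≤ ∑ k ∈ Finset.range m, K * r ^ k :=
        Finset.sum_le_sum fun k _ => by simpa using h k
    _ ≤ K * (1 - r)⁻¹ := by
        rw [← Finset.mul_sum]
        exact mul_le_mul_of_nonneg_left (sum_le_hasSum _ (fun k _ => pow_nonneg hr0 k)
          (hasSum_geometric_of_lt_one hr0 hr1)) hK
    _ = K / (1 - r) := (div_eq_mul_inv _ _).symm

theorem EnergyEstimate.exists_integral_norm_pulseResponse_le [CompleteSpace X]
    {S : C0Semigroup ℝ X} (henergy : EnergyEstimate N d c)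
    (hS : S.IsGenerator {v | N v = 0 ∧ d v = 0}) (hstab : S.IsExponentiallyStable) {q p : X}
    (hqp : N (q, p) = 0) :
    ∃ K : ℝ, ∀ φ, IsUnitPulse φ → ∀ t, 0 ≤ t →
      ∫ s in (0 : ℝ)..t, ‖c (pulseResponse S φ q p s)‖ ≤ K := by
  obtain ⟨M', hM'⟩ := hstab.exists_norm_le
  obtain ⟨M, ω, hω, hM⟩ := hstab
  obtain ⟨K, hK, hKw⟩ := henergy 1 zero_le_one
  have hM0 : 0 ≤ M := by simpa using (norm_nonneg _).trans (hM 0)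
  set e := ‖d (q, p)‖
  set r := Real.exp (-ω) with hr
  have hr0 : 0 < r := Real.exp_pos _
  have hr1 : r < 1 := by rwa [hr, Real.exp_lt_one_iff, neg_lt_zero]
  set K₁ := K * e + K * (M * r⁻¹ * (K * e)) with hK₁
  refine ⟨K₁ / (1 - r), fun φ hφ t ht => ?_⟩
  have hw := hφ.isTrajectory_pulseResponse hS hM' hqp
  have input (s : ℝ) : ‖d (pulseResponse S φ q p s)‖ = φ s * e := by
    rw [hφ.input_pulseResponse hS hM', norm_smul, Real.norm_of_nonneg (hφ.nonneg s)]
  have first_interval := hKw _ hw 0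
  simp only [input, hφ.pulseResponse_of_nonpos S q p le_rfl, Prod.fst_zero, norm_zero, zero_add,
    intervalIntegral.integral_mul_const, hφ.intervalIntegral_eq_one, one_mul] at first_interval
  refine integral_le_of_forall_unitInterval_le (c.continuous.comp hw.continuous).norm
    (fun s => norm_nonneg _) hr0.le hr1 (fun k => ?_) ht
  rcases Nat.eq_zero_or_pos k with rfl | hk
  · simpa [hK₁] using first_interval.2.trans (le_add_of_nonneg_right (by positivity))
  have hk1 : (1 : ℝ) ≤ k := by exact_mod_cast hk
  have no_input : ∫ s in (k : ℝ)..k + 1, ‖d (pulseResponse S φ q p s)‖ = 0 := by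
    rw [intervalIntegral.integral_congr (g := fun _ => (0 : ℝ)), intervalIntegral.integral_zero]
    intro s hs
    rw [uIcc_of_le (by linarith)] at hs
    simp [input, hφ.eq_zero_of_one_le (hk1.trans hs.1)]
  have state_le : ‖(pulseResponse S φ q p k).1‖ ≤ M * (r⁻¹ * r ^ k) * (K * e) :=
    hφ.norm_pulseResponse_fst_natCast_le hω.le hM first_interval.1 hk
  calc ∫ s in (k : ℝ)..k + 1, ‖c (pulseResponse S φ q p s)‖
      ≤ K * ‖(pulseResponse S φ q p k).1‖ := by simpa [no_input] using (hKw _ hw k).2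
    _ ≤ K * (M * (r⁻¹ * r ^ k) * (K * e)) := mul_le_mul_of_nonneg_left state_le hK
    _ ≤ K₁ * r ^ k := by
        have : 0 ≤ K * e * r ^ k := by positivity
        rw [hK₁]
        linarith

theorem EnergyEstimate.integral_smul_output_eq [CompleteSpace X] [CompleteSpace W]
    [CompleteSpace U] [CompleteSpace Y] (henergy : EnergyEstimate N d c) {ι : Type*} [Fintype ι]
    {e : ι → U} {φ : ℝ → ℝ} (hφ : IsUnitPulse φ) {z : ι → ℝ → X × X}
    (hz : ∀ i, IsTrajectory N (z i)) (hz0 : ∀ i, ∀ t ≤ 0, z i t = 0)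
    (hzd : ∀ i t, d (z i t) = φ t • e i) (hw : IsTrajectory N w) (hw0 : ∀ t ≤ 0, w t = 0)
    {u : ι → ℝ → ℝ} (hu : ∀ i, Continuous (u i)) (hu0 : ∀ i, ∀ t ≤ 0, u i t = 0)
    (hwd : ∀ t, d (w t) = ∑ i, u i t • e i) {t : ℝ} (ht : 0 ≤ t) :
    ∫ s in (0 : ℝ)..1, φ s • c (w (t - s)) =
      ∑ i, ∫ s in (0 : ℝ)..t, u i s • c (z i (t - s)) := by
  have hφc := hφ.contDiff.continuous
  set D : ℝ → X × X := fun r =>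
    (∑ i, ∫ s in (0 : ℝ)..t, u i s • z i (r - s)) - ∫ s in (0 : ℝ)..1, φ s • w (r - s) with hD
  have D_trajectory : IsTrajectory N D :=
    (IsTrajectory.sum Finset.univ fun i => (hz i).integral_smul_comp_sub (hu i) 0 t).sub
      (hw.integral_smul_comp_sub hφc 0 1)
  have D_of_nonpos (r : ℝ) (hr : r ≤ 0) : D r = 0 := by
    simp only [hD, integral_smul_comp_sub_eq_zero φ hw0 zero_le_one hr,
      integral_smul_comp_sub_eq_zero _ (hz0 _) ht hr, Finset.sum_const_zero, sub_zero]
  have input_D (r : ℝ) (hr : r ∈ Icc 0 t) : d (D r) = 0 := by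
    simp only [hD, map_sub, map_sum, map_integral_smul_comp_sub d (hu _) (hz _).continuous,
      map_integral_smul_comp_sub d hφc hw.continuous, hzd, hwd, Finset.smul_sum, smul_smul]
    rw [intervalIntegral.integral_finsetSum fun i _ =>
      (by have := hu i; fun_prop : Continuous fun s => (φ s * u i (r - s)) • e i
        ).intervalIntegrable _ _, sub_eq_zero]
    refine Finset.sum_congr rfl fun i _ => ?_
    rw [intervalIntegral.integral_smul_const, intervalIntegral.integral_smul_const,
      hφ.intervalIntegral_mul_comp_sub_comm (hu0 i) hr.2]
  have output_D : c (D t) = 0 := by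
    rw [henergy.eq_zero D_trajectory (fun r hr => by rw [D_of_nonpos r hr, Prod.fst_zero]) input_D
      le_rfl, map_zero]
  rw [hD, map_sub, map_sum, map_integral_smul_comp_sub c hφc hw.continuous, sub_eq_zero]
    at output_D
  simp only [← output_D, map_integral_smul_comp_sub c (hu _) (hz _).continuous]

theorem norm_integral_smul_comp_sub_le {v : ℝ → ℝ} {g : ℝ → Y} (hg : Continuous g) {t B K : ℝ}
    (ht : 0 ≤ t) (hv : ∀ s ∈ Icc 0 t, ‖v s‖ ≤ B) (hgK : ∫ s in (0 : ℝ)..t, ‖g s‖ ≤ K) :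
    ‖∫ s in (0 : ℝ)..t, v s • g (t - s)‖ ≤ B * K := by
  have hB : 0 ≤ B := (norm_nonneg _).trans (hv 0 ⟨le_rfl, ht⟩)
  calc ‖∫ s in (0 : ℝ)..t, v s • g (t - s)‖ ≤ ∫ s in (0 : ℝ)..t, B * ‖g (t - s)‖ := by
        refine intervalIntegral.norm_integral_le_of_norm_le ht (ae_of_all _ fun s hs => ?_)
          ((by fun_prop : Continuous fun s => B * ‖g (t - s)‖).intervalIntegrable _ _)
        rw [norm_smul]
        exact mul_le_mul_of_nonneg_right (hv s (Ioc_subset_Icc_self hs)) (norm_nonneg _)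
    _ = B * ∫ s in (0 : ℝ)..t, ‖g s‖ := by
        rw [intervalIntegral.integral_const_mul,
          intervalIntegral.integral_comp_sub_left (fun s => ‖g s‖) t, sub_self, sub_zero]
    _ ≤ B * K := mul_le_mul_of_nonneg_left hgK hB

theorem EnergyEstimate.exists_norm_output_le [CompleteSpace X] [CompleteSpace W]
    [FiniteDimensional ℝ U] [CompleteSpace Y] {S : C0Semigroup ℝ X}
    (henergy : EnergyEstimate N d c) (hS : S.IsGenerator {v | N v = 0 ∧ d v = 0})
    (hstab : S.IsExponentiallyStable) (hsurj : ∀ u, ∃ q p, N (q, p) = 0 ∧ d (q, p) = u) :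
    ∃ C : ℝ, ∀ w, IsTrajectory N w → (∀ t ≤ 0, w t = 0) → ∀ t B : ℝ, 0 ≤ t →
      (∀ s ∈ Icc 0 t, ‖d (w s)‖ ≤ B) → ‖c (w t)‖ ≤ C * B := by
  have : CompleteSpace U := FiniteDimensional.complete ℝ U
  let b := Module.finBasis ℝ U
  let f (i) : U →L[ℝ] ℝ := LinearMap.toContinuousLinearMap (b.coord i)
  choose q p hN hd using fun i => hsurj (b i)
  choose K hK using fun i => henergy.exists_integral_norm_pulseResponse_le hS hstab (hN i)
  obtain ⟨M, hM⟩ := hstab.exists_norm_le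
  refine ⟨∑ i, ‖f i‖ * K i, fun w hw hw0 t B ht hB => le_of_forall_pos_le_add fun δ hδ => ?_⟩
  have y_continuous : Continuous fun s => c (w s) := c.continuous.comp hw.continuous
  obtain ⟨ε, hε, y_near⟩ := Metric.continuousAt_iff.1 (y_continuous.continuousAt (x := t)) δ hδ
  obtain ⟨φ, hφ, hφε⟩ := exists_isUnitPulse hε
  have z_trajectory (i) := hφ.isTrajectory_pulseResponse hS hM (hN i)
  have superposition := henergy.integral_smul_output_eq hφ (e := b) z_trajectory
    (fun i _ hs => hφ.pulseResponse_of_nonpos S _ _ hs)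
    (fun i s => by rw [hφ.input_pulseResponse hS hM, hd]) hw hw0 (u := fun i s => f i (d (w s)))
    (fun i => (f i).continuous.comp (d.continuous.comp hw.continuous))
    (fun i s hs => by simp only [hw0 s hs, map_zero])
    (fun s => (b.sum_repr (d (w s))).symm) ht
  have channel_le (i) : ‖∫ s in (0 : ℝ)..t, f i (d (w s)) •
      c (pulseResponse S φ (q i) (p i) (t - s))‖ ≤ ‖f i‖ * B * K i :=
    norm_integral_smul_comp_sub_le (c.continuous.comp (z_trajectory i).continuous) ht
      (fun s hs => (f i).le_of_opNorm_le_of_le le_rfl (hB s hs)) (hK i φ hφ t ht)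
  calc ‖c (w t)‖ ≤ ‖∫ s in (0 : ℝ)..1, φ s • c (w (t - s))‖ +
          ‖c (w t) - ∫ s in (0 : ℝ)..1, φ s • c (w (t - s))‖ := norm_le_norm_add_norm_sub' _ _
    _ ≤ ∑ i, ‖f i‖ * B * K i + δ := by
        refine add_le_add ?_ (hφ.norm_sub_intervalIntegral_smul_comp_sub_le y_continuous hδ.le hφε
          fun s hs => (y_near hs).le)
        rw [superposition]
        exact (norm_sum_le _ _).trans (Finset.sum_le_sum fun i _ => channel_le i)
    _ = (∑ i, ‖f i‖ * K i) * B + δ := by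
        simp only [Finset.sum_mul, mul_right_comm]

end OutputBound

/-! ### Quasi-dissipative systems -/

section Dissipation

theorem deriv_comp_eq_of_support {X : Type*} [NormedAddCommGroup X] [NormedSpace ℝ X]
    {J : X → ℝ} {ℓ : X →L[ℝ] ℝ} {x : ℝ → X} {x' : X} {t : ℝ} (hx : HasDerivAt x x' t)
    (hJ : DifferentiableAt ℝ (fun s => J (x s)) t) (hle : ∀ y, ℓ y ≤ J y)
    (heq : ℓ (x t) = J (x t)) : deriv (fun s => J (x s)) t = ℓ x' := by
  have hmin : IsLocalMin (fun s => J (x s) - ℓ (x s)) t :=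
    Eventually.of_forall fun s => by simpa [heq] using hle (x s)
  exact sub_eq_zero.1
    (hmin.hasDerivAt_eq_zero (hJ.hasDerivAt.sub (ℓ.hasFDerivAt.comp_hasDerivAt t hx)))

theorem add_mul_integral_le_mul_exp {f : ℝ → ℝ} (hf : Continuous f) {A k t₀ t₁ : ℝ}
    (ht : t₀ ≤ t₁) (hk : 0 ≤ k) (hf0 : ∀ t, 0 ≤ f t)
    (hfA : ∀ t ∈ Icc t₀ t₁, f t ≤ A + k * ∫ s in t₀..t, f s) :
    A + k * ∫ s in t₀..t₁, f s ≤ A * Real.exp (k * (t₁ - t₀)) := by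
  have G_deriv (t : ℝ) : HasDerivAt (fun t => A + k * ∫ s in t₀..t, f s) (k * f t) t :=
    ((hf.integral_hasStrictDerivAt t₀ t).hasDerivAt.const_mul k).const_add A
  have G_nonneg (t : ℝ) (h : t ∈ Icc t₀ t₁) : 0 ≤ A + k * ∫ s in t₀..t, f s :=
    (hf0 t).trans (hfA t h)
  have hA : 0 ≤ A := by simpa using G_nonneg t₀ ⟨le_rfl, ht⟩
  have bound := norm_le_gronwallBound_of_norm_deriv_right_le (δ := A) (K := k) (ε := 0)
    (fun t _ => (G_deriv t).continuousAt.continuousWithinAt)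
    (fun t _ => (G_deriv t).hasDerivWithinAt) (by simp [abs_of_nonneg hA]) (fun t h => by
      rw [add_zero, Real.norm_of_nonneg (mul_nonneg hk (hf0 t)),
        Real.norm_of_nonneg (G_nonneg t (Ico_subset_Icc_self h))]
      exact mul_le_mul_of_nonneg_left (hfA t (Ico_subset_Icc_self h)) hk) t₁ ⟨ht, le_rfl⟩
  rw [gronwallBound_ε0] at bound
  exact (le_abs_self _).trans bound

variable {X W U Y : Type*} [NormedAddCommGroup X] [NormedSpace ℝ X]
  [NormedAddCommGroup W] [NormedSpace ℝ W] [NormedAddCommGroup U] [NormedSpace ℝ U]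
  [NormedAddCommGroup Y] [NormedSpace ℝ Y]
  {N : X × X →L[ℝ] W} {d : X × X →L[ℝ] U} {c : X × X →L[ℝ] Y} {w : ℝ → X × X}

/-- Quasi-dissipativity, with respect to the seminorm `J`, of the system `N (x, x') = 0` with input
`d` and output `c`: in the direction of a support functional of `J` at `x`, the velocity `x'`
dissipates the output, up to the input and a multiple of the state. -/
def IsQuasiDissipative (N : X × X →L[ℝ] W) (d : X × X →L[ℝ] U) (c : X × X →L[ℝ] Y)
    (J : Seminorm ℝ X) (κ C : ℝ) : Prop :=
  ∀ x z, N (x, z) = 0 → ∃ ℓ : X →L[ℝ] ℝ, ℓ x = J x ∧ (∀ y, ℓ y ≤ J y) ∧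
    ℓ z ≤ -(κ * ‖c (x, z)‖) + C * (‖d (x, z)‖ + ‖x‖)

theorem IsTrajectory.absolutelyContinuousOnInterval_seminorm (hw : IsTrajectory N w)
    {J : Seminorm ℝ X} {L : ℝ≥0} (hJ : ∀ x, J x ≤ L * ‖x‖) (t₀ t₁ : ℝ) :
    AbsolutelyContinuousOnInterval (fun t => J (w t).1) t₀ t₁ := by
  have x_contDiff : ContDiff ℝ 1 fun t => (w t).1 := by
    refine contDiff_one_iff_deriv.2 ⟨fun t => (hw.hasDerivAt_fst t).differentiableAt, ?_⟩
    rw [funext fun t => (hw.hasDerivAt_fst t).deriv]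
    exact hw.continuous.snd
  obtain ⟨K, hK⟩ := x_contDiff.contDiffOn.exists_lipschitzOnWith (s := uIcc t₀ t₁) one_ne_zero
    (convex_uIcc t₀ t₁) isCompact_uIcc
  have J_lipschitz : LipschitzWith L J :=
    LipschitzWith.of_dist_le_mul fun x y => by
      rw [Real.dist_eq, dist_eq_norm]
      exact (abs_sub_map_le_sub J x y).trans (hJ _)
  exact (J_lipschitz.comp_lipschitzOnWith hK).absolutelyContinuousOnInterval

namespace IsQuasiDissipative

variable {J : Seminorm ℝ X} {κ C : ℝ}

theorem seminorm_add_integral_le (hN : IsQuasiDissipative N d c J κ C) {L : ℝ≥0}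
    (hJ : ∀ x, J x ≤ L * ‖x‖) (hw : IsTrajectory N w) {t₀ t₁ : ℝ} (ht : t₀ ≤ t₁) :
    J (w t₁).1 + κ * ∫ t in t₀..t₁, ‖c (w t)‖ ≤
      J (w t₀).1 + C * (∫ t in t₀..t₁, ‖d (w t)‖) + C * ∫ t in t₀..t₁, ‖(w t).1‖ := by
  have hcont := hw.continuous
  have hAC := hw.absolutelyContinuousOnInterval_seminorm hJ t₀ t₁
  have deriv_le : ∀ᵐ t ∂volume.restrict (Icc t₀ t₁), deriv (fun s => J (w s).1) t ≤
      -(κ * ‖c (w t)‖) + C * (‖d (w t)‖ + ‖(w t).1‖) := by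
    rw [← uIcc_of_le ht, ae_restrict_iff' measurableSet_uIcc]
    filter_upwards [hAC.ae_differentiableAt] with t hdiff ht
    obtain ⟨ℓ, heq, hle, hdiss⟩ := hN _ _ (hw.map_eq_zero t)
    exact (deriv_comp_eq_of_support (hw.hasDerivAt_fst t) (hdiff ht) hle heq).trans_le hdiss
  have key := intervalIntegral.integral_mono_ae_restrict ht hAC.intervalIntegrable_deriv
    ((by fun_prop : Continuous fun t => -(κ * ‖c (w t)‖) +
      C * (‖d (w t)‖ + ‖(w t).1‖)).intervalIntegrable _ _) deriv_le
  rw [hAC.integral_deriv_eq_sub, intervalIntegral.integral_add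
    ((by fun_prop : Continuous _).intervalIntegrable _ _)
    ((by fun_prop : Continuous _).intervalIntegrable _ _), intervalIntegral.integral_neg,
    intervalIntegral.integral_const_mul, intervalIntegral.integral_const_mul,
    intervalIntegral.integral_add ((by fun_prop : Continuous _).intervalIntegrable _ _)
    ((by fun_prop : Continuous _).intervalIntegrable _ _)] at key
  linarith

theorem seminorm_add_integral_le_mul_exp (hN : IsQuasiDissipative N d c J κ C) (hκ : 0 < κ)
    (hC : 0 ≤ C) {L : ℝ≥0} (hJ : ∀ x, J x ≤ L * ‖x‖) {c₀ : ℝ} (hc₀ : 0 < c₀)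
    (hc₀J : ∀ x, c₀ * ‖x‖ ≤ J x) (hw : IsTrajectory N w) (t₀ : ℝ) {τ : ℝ} (hτ : 0 ≤ τ) :
    J (w (t₀ + τ)).1 + κ * ∫ t in t₀..t₀ + τ, ‖c (w t)‖ ≤
      (L + C) * Real.exp (C / c₀ * τ) * (‖(w t₀).1‖ + ∫ t in t₀..t₀ + τ, ‖d (w t)‖) := by
  have hcont := hw.continuous
  set A := J (w t₀).1 + C * ∫ t in t₀..t₀ + τ, ‖d (w t)‖
  have A_le : A ≤ (L + C) * (‖(w t₀).1‖ + ∫ t in t₀..t₀ + τ, ‖d (w t)‖) := by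
    have input_nonneg : 0 ≤ ∫ t in t₀..t₀ + τ, ‖d (w t)‖ :=
      intervalIntegral.integral_nonneg (by linarith) fun _ _ => norm_nonneg _
    linarith [hJ (w t₀).1, mul_nonneg hC (norm_nonneg (w t₀).1),
      mul_nonneg L.coe_nonneg input_nonneg]
  have energy {t₁ : ℝ} (ht₁ : t₁ ∈ Icc t₀ (t₀ + τ)) :
      J (w t₁).1 + κ * ∫ t in t₀..t₁, ‖c (w t)‖ ≤ A + C * ∫ t in t₀..t₁, ‖(w t).1‖ := by
    have input_mono : ∫ t in t₀..t₁, ‖d (w t)‖ ≤ ∫ t in t₀..t₀ + τ, ‖d (w t)‖ :=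
      intervalIntegral.integral_mono_interval le_rfl ht₁.1 ht₁.2
        (ae_of_all _ fun _ => norm_nonneg _) ((by fun_prop : Continuous _).intervalIntegrable _ _)
    linarith [hN.seminorm_add_integral_le hJ hw ht₁.1, mul_le_mul_of_nonneg_left input_mono hC]
  have ht₁ : t₀ + τ ∈ Icc t₀ (t₀ + τ) := ⟨by linarith, le_rfl⟩
  have gronwall := add_mul_integral_le_mul_exp (f := fun t => c₀ * ‖(w t).1‖) (A := A)
    (k := C / c₀) (by fun_prop) ht₁.1 (by positivity) (fun t => by positivity) fun t ht => by
      rw [intervalIntegral.integral_const_mul, ← mul_assoc, div_mul_cancel₀ _ hc₀.ne']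
      have output_nonneg : 0 ≤ κ * ∫ s in t₀..t, ‖c (w s)‖ :=
        mul_nonneg hκ.le (intervalIntegral.integral_nonneg ht.1 fun _ _ => norm_nonneg _)
      linarith [hc₀J (w t).1, energy ht]
  rw [intervalIntegral.integral_const_mul, ← mul_assoc, div_mul_cancel₀ _ hc₀.ne',
    add_sub_cancel_left] at gronwall
  calc _ ≤ A * Real.exp (C / c₀ * τ) := (energy ht₁).trans gronwall
    _ ≤ (L + C) * (‖(w t₀).1‖ + ∫ t in t₀..t₀ + τ, ‖d (w t)‖) * Real.exp (C / c₀ * τ) := by gcongr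
    _ = _ := mul_right_comm _ _ _

theorem energyEstimate (hN : IsQuasiDissipative N d c J κ C) (hκ : 0 < κ) (hC : 0 ≤ C) {L : ℝ≥0}
    (hJ : ∀ x, J x ≤ L * ‖x‖) {c₀ : ℝ} (hc₀ : 0 < c₀) (hc₀J : ∀ x, c₀ * ‖x‖ ≤ J x) :
    EnergyEstimate N d c := by
  intro τ hτ
  set K := (L + C) * Real.exp (C / c₀ * τ)
  refine ⟨K / c₀ + K / κ, by positivity, fun w hw t₀ => ?_⟩
  have total := hN.seminorm_add_integral_le_mul_exp hκ hC hJ hc₀ hc₀J hw t₀ hτ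
  set D := ‖(w t₀).1‖ + ∫ t in t₀..t₀ + τ, ‖d (w t)‖
  have output_nonneg : 0 ≤ κ * ∫ t in t₀..t₀ + τ, ‖c (w t)‖ :=
    mul_nonneg hκ.le (intervalIntegral.integral_nonneg (by linarith) fun _ _ => norm_nonneg _)
  have hKD : 0 ≤ K * D := (add_nonneg (apply_nonneg J _) output_nonneg).trans total
  rw [add_mul, div_mul_eq_mul_div, div_mul_eq_mul_div]
  constructor
  · refine le_add_of_le_of_nonneg ((le_div_iff₀' hc₀).2 ?_) (div_nonneg hKD hκ.le)
    linarith [hc₀J (w (t₀ + τ)).1]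
  · refine le_add_of_nonneg_of_le (div_nonneg hKD hc₀.le) ((le_div_iff₀' hκ).2 ?_)
    linarith [apply_nonneg J (w (t₀ + τ)).1]

end IsQuasiDissipative

end Dissipation

/-! ### First order differential expressions on `L¹([a,b], E)` -/

/-- The Lebesgue space `L¹([a,b], E)`. -/
abbrev IntervalL1 (E : Type*) [NormedAddCommGroup E] (a b : ℝ) : Type _ :=
  Lp E 1 (volume.restrict (Icc a b))

section IntervalL1

variable {E : Type*} [NormedAddCommGroup E] {a b : ℝ}

theorem IntervalL1.integrableOn (g : IntervalL1 E a b) : IntegrableOn g (Icc a b) :=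
  L1.integrable_coeFn g

theorem intervalIntegrable_of_integrableOn_Icc {g : ℝ → E} (hg : IntegrableOn g (Icc a b))
    {s t : ℝ} (hs : s ∈ Icc a b) (ht : t ∈ Icc a b) : IntervalIntegrable g volume s t :=
  (hg.mono_set (uIcc_subset_Icc hs ht)).intervalIntegrable

end IntervalL1

section L1Operators

variable {E F : Type*} [NormedAddCommGroup E] [NormedSpace ℝ E]
  [NormedAddCommGroup F] [NormedSpace ℝ F]

/-- Multiplication by an essentially bounded operator-valued function, on `L¹`. -/
noncomputable def mulL1 {α : Type*} [MeasurableSpace α] {μ : Measure α} {A : α → E →L[ℝ] F}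
    (hA : MemLp A ∞ μ) : Lp E 1 μ →L[ℝ] Lp F 1 μ :=
  (ContinuousLinearMap.id ℝ (E →L[ℝ] F)).holderL μ ∞ 1 1 (hA.toLp A)

theorem mulL1_ae {α : Type*} [MeasurableSpace α] {μ : Measure α} {A : α → E →L[ℝ] F}
    (hA : MemLp A ∞ μ) (x : Lp E 1 μ) : mulL1 hA x =ᵐ[μ] fun ξ => A ξ (x ξ) := by
  filter_upwards [(ContinuousLinearMap.id ℝ (E →L[ℝ] F)).coeFn_holder (r := 1) (hA.toLp A) x,
    hA.coeFn_toLp] with ξ hx hAξ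
  exact hx.trans (by rw [hAξ, ContinuousLinearMap.id_apply])

variable {a b : ℝ}

theorem intervalIntegral_congr_ae_restrict_Icc {f g : ℝ → E}
    (h : f =ᵐ[volume.restrict (Icc a b)] g) {s t : ℝ} (hs : s ∈ Icc a b) (ht : t ∈ Icc a b) :
    ∫ r in s..t, f r = ∫ r in s..t, g r := by
  refine intervalIntegral.integral_congr_ae ?_
  filter_upwards [(ae_restrict_iff' measurableSet_Icc).1 h] with r hr hrs
  exact hr (uIcc_subset_Icc hs ht (uIoc_subset_uIcc hrs))

theorem integrable_primitive {g : ℝ → E} (hg : IntegrableOn g (Icc a b)) :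
    Integrable (fun ξ => ∫ s in a..ξ, g s) (volume.restrict (Icc a b)) := by
  rcases lt_or_ge b a with hab | hab
  · simp [Icc_eq_empty hab.not_ge]
  · have := intervalIntegral.continuousOn_primitive_interval (μ := volume) (uIcc_of_le hab ▸ hg)
    exact (uIcc_of_le hab ▸ this).integrableOn_compact isCompact_Icc

theorem norm_primitive_le (g : IntervalL1 E a b) {ξ : ℝ} (hξ : ξ ∈ Icc a b) :
    ‖∫ s in a..ξ, g s‖ ≤ ‖g‖ := by
  rw [L1.norm_eq_integral_norm, intervalIntegral.integral_of_le hξ.1]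
  exact (norm_integral_le_integral_norm _).trans <|
    setIntegral_mono_set g.integrableOn.norm (ae_of_all _ fun _ => norm_nonneg _)
      (Eventually.of_forall fun s hs => ⟨hs.1.le, hs.2.trans hξ.2⟩)

theorem primitive_add_ae (f g : IntervalL1 E a b) :
    (fun ξ => ∫ s in a..ξ, (f + g) s) =ᵐ[volume.restrict (Icc a b)]
      (fun ξ => ∫ s in a..ξ, f s) + fun ξ => ∫ s in a..ξ, g s := by
  filter_upwards [ae_restrict_mem measurableSet_Icc] with ξ hξ
  have ha : a ∈ Icc a b := ⟨le_rfl, hξ.1.trans hξ.2⟩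
  rw [intervalIntegral_congr_ae_restrict_Icc (Lp.coeFn_add f g) ha hξ]
  exact intervalIntegral.integral_add (intervalIntegrable_of_integrableOn_Icc f.integrableOn ha hξ)
    (intervalIntegrable_of_integrableOn_Icc g.integrableOn ha hξ)

theorem primitive_smul_ae (c : ℝ) (g : IntervalL1 E a b) :
    (fun ξ => ∫ s in a..ξ, (c • g) s) =ᵐ[volume.restrict (Icc a b)]
      c • fun ξ => ∫ s in a..ξ, g s := by
  filter_upwards [ae_restrict_mem measurableSet_Icc] with ξ hξ
  have ha : a ∈ Icc a b := ⟨le_rfl, hξ.1.trans hξ.2⟩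
  rw [intervalIntegral_congr_ae_restrict_Icc (Lp.coeFn_smul c g) ha hξ]
  exact intervalIntegral.integral_smul c g

/-- The integration operator `g ↦ ∫ₐ g` on `L¹([a,b], E)`. -/
noncomputable def primitiveL1 (E : Type*) [NormedAddCommGroup E] [NormedSpace ℝ E] (a b : ℝ) :
    IntervalL1 E a b →L[ℝ] IntervalL1 E a b :=
  LinearMap.mkContinuous
    { toFun := fun g => (integrable_primitive g.integrableOn).toL1 _
      map_add' := fun f g => by
        rw [← Integrable.toL1_add]
        exact (Integrable.toL1_eq_toL1_iff _ _ _ _).2 (primitive_add_ae f g)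
      map_smul' := fun c g => by
        rw [RingHom.id_apply, ← Integrable.toL1_smul]
        exact (Integrable.toL1_eq_toL1_iff _ _ _ _).2 (primitive_smul_ae c g) }
    ((volume.restrict (Icc a b)).real univ) fun g => by
      refine (L1.norm_of_fun_eq_integral_norm (integrable_primitive g.integrableOn)).trans_le ?_
      calc _ ≤ ∫ _ in Icc a b, ‖g‖ :=
            setIntegral_mono_on (integrable_primitive g.integrableOn).norm
              (integrableOn_const (by simp)) measurableSet_Icc fun ξ hξ => norm_primitive_le g hξ
        _ = _ := by rw [integral_const, smul_eq_mul]

theorem primitiveL1_ae (g : IntervalL1 E a b) :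
    primitiveL1 E a b g =ᵐ[volume.restrict (Icc a b)] fun ξ => ∫ s in a..ξ, g s :=
  (integrable_primitive g.integrableOn).coeFn_toL1

end L1Operators

/-- Coefficients of the first order differential expression `x ↦ P (H x)' + Q (H x)` on `[a,b]`. -/
structure FirstOrderData (E : Type*) [NormedAddCommGroup E] [NormedSpace ℝ E] (a b : ℝ) where
  a_lt_b : a < b
  P : E ≃L[ℝ] E
  Q : ℝ → E →L[ℝ] E
  memLp_Q : MemLp Q ∞ (volume.restrict (Icc a b))
  H : ℝ → E →L[ℝ] E
  memLp_H : MemLp H ∞ (volume.restrict (Icc a b))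

namespace FirstOrderData

variable {E : Type*} [NormedAddCommGroup E] [NormedSpace ℝ E] {a b : ℝ} (D : FirstOrderData E a b)

/-- The relation `z = P (H x)' + Q (H x)` in `L¹([a,b], E)`; here `v` is the absolutely continuous
representative of `H x`, and `g` its weak derivative. -/
structure IsDiff (x z : IntervalL1 E a b) (v g : ℝ → E) : Prop where
  sobolev : IsSobolevOnInterval 1 a b v g
  v_ae : ∀ᵐ ξ ∂volume.restrict (Icc a b), v ξ = D.H ξ (x ξ)
  z_ae : ∀ᵐ ξ ∂volume.restrict (Icc a b), z ξ = D.P (g ξ) + D.Q ξ (v ξ)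

/-- The weak derivative `P⁻¹ (z - Q (H x))` of `H x` when `z = P (H x)' + Q (H x)`. -/
noncomputable def slope : IntervalL1 E a b × IntervalL1 E a b →L[ℝ] IntervalL1 E a b :=
  (D.P.symm : E →L[ℝ] E).compLpL 1 _ ∘L
    (.snd ℝ _ _ - mulL1 D.memLp_Q ∘L mulL1 D.memLp_H ∘L .fst ℝ _ _)

theorem slope_ae (x z : IntervalL1 E a b) : D.slope (x, z) =ᵐ[volume.restrict (Icc a b)]
    fun ξ => D.P.symm (z ξ - D.Q ξ (D.H ξ (x ξ))) := by
  filter_upwards [(D.P.symm : E →L[ℝ] E).coeFn_compLpL (z - mulL1 D.memLp_Q (mulL1 D.memLp_H x)),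
    Lp.coeFn_sub z (mulL1 D.memLp_Q (mulL1 D.memLp_H x)), mulL1_ae D.memLp_Q (mulL1 D.memLp_H x),
    mulL1_ae D.memLp_H x] with ξ hP hsub hQ hH
  exact hP.trans (by rw [hsub, Pi.sub_apply, hQ, hH]; rfl)

variable {D} {x z : IntervalL1 E a b} {v g : ℝ → E}

theorem IsDiff.slope_ae (h : D.IsDiff x z v g) :
    D.slope (x, z) =ᵐ[volume.restrict (Icc a b)] g := by
  filter_upwards [D.slope_ae x z, h.v_ae, h.z_ae] with ξ hslope hv hz
  rw [hslope, hz, ← hv, add_sub_cancel_right, D.P.symm_apply_apply]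

theorem IsDiff.mulL1_ae (h : D.IsDiff x z v g) : mulL1 D.memLp_H x =ᵐ[volume.restrict (Icc a b)]
    fun ξ => v a + primitiveL1 E a b (D.slope (x, z)) ξ := by
  filter_upwards [_root_.mulL1_ae D.memLp_H x, h.v_ae, primitiveL1_ae (D.slope (x, z)),
    ae_restrict_mem measurableSet_Icc] with ξ hH hv hI hξ
  rw [hH, ← hv, hI, h.sobolev.2 ξ hξ, intervalIntegral_congr_ae_restrict_Icc h.slope_ae
    (left_mem_Icc.2 D.a_lt_b.le) hξ]

variable [CompleteSpace E] (D)

/-- The left boundary value `(H x)(a)`, as the mean of the constant function `H x - ∫ₐ (H x)'`. -/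
noncomputable def leftValue : IntervalL1 E a b × IntervalL1 E a b →L[ℝ] E :=
  (b - a)⁻¹ • L1.integralCLM ∘L (mulL1 D.memLp_H ∘L .fst ℝ _ _ - primitiveL1 E a b ∘L D.slope)

/-- The right boundary value `(H x)(b)`. -/
noncomputable def rightValue : IntervalL1 E a b × IntervalL1 E a b →L[ℝ] E :=
  D.leftValue + L1.integralCLM ∘L D.slope

/-- The residual `H x - (H x)(a) - ∫ₐ (H x)'`, whose kernel is the graph of the maximal operator
`x ↦ P (H x)' + Q (H x)`. -/
noncomputable def residual :
    IntervalL1 E a b × IntervalL1 E a b →L[ℝ] IntervalL1 E a b :=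
  mulL1 D.memLp_H ∘L .fst ℝ _ _ - Lp.constL 1 _ ℝ ∘L D.leftValue - primitiveL1 E a b ∘L D.slope

theorem exists_isDiff (h : D.residual (x, z) = 0) : ∃ v g, D.IsDiff x z v g := by
  have hMx : mulL1 D.memLp_H x =
      Lp.const 1 _ (D.leftValue (x, z)) + primitiveL1 E a b (D.slope (x, z)) :=
    sub_eq_iff_eq_add'.1 (sub_eq_zero.1 h)
  have hv : ∀ᵐ ξ ∂volume.restrict (Icc a b),
      D.leftValue (x, z) + ∫ s in a..ξ, D.slope (x, z) s = D.H ξ (x ξ) := by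
    filter_upwards [Filter.EventuallyEq.of_eq (congrArg (⇑) hMx), Lp.coeFn_add
      (Lp.const 1 _ (D.leftValue (x, z))) (primitiveL1 E a b (D.slope (x, z))), Lp.coeFn_const 1 _
      (D.leftValue (x, z)), primitiveL1_ae (D.slope (x, z)), mulL1_ae D.memLp_H x]
      with ξ heq hadd hconst hI hH
    rw [← hH, heq, hadd, Pi.add_apply, hconst, hI, Function.const_apply]
  refine ⟨fun ξ => D.leftValue (x, z) + ∫ s in a..ξ, D.slope (x, z) s, D.slope (x, z),
    ⟨Lp.memLp _, fun ξ _ => by simp⟩, hv, ?_⟩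
  filter_upwards [hv, D.slope_ae x z] with ξ hv hslope
  rw [hv, hslope, D.P.apply_symm_apply, sub_add_cancel]

variable {D}

theorem IsDiff.leftValue_eq (h : D.IsDiff x z v g) : D.leftValue (x, z) = v a := by
  have hconst : (mulL1 D.memLp_H x - primitiveL1 E a b (D.slope (x, z)) : IntervalL1 E a b)
      =ᵐ[volume.restrict (Icc a b)] fun _ => v a := by
    filter_upwards [Lp.coeFn_sub (mulL1 D.memLp_H x) (primitiveL1 E a b (D.slope (x, z))),
      h.mulL1_ae] with ξ hsub hH
    rw [hsub, Pi.sub_apply, hH, add_sub_cancel_right]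
  have hab : b - a ≠ 0 := (sub_pos.2 D.a_lt_b).ne'
  calc D.leftValue (x, z) = (b - a)⁻¹ • ∫ _ in Icc a b, v a := by
        rw [← integral_congr_ae hconst, ← L1.integral_eq_integral, L1.integral_eq]; rfl
    _ = v a := by simp [D.a_lt_b.le, smul_smul, inv_mul_cancel₀ hab]

theorem IsDiff.rightValue_eq (h : D.IsDiff x z v g) : D.rightValue (x, z) = v b := by
  have ha := left_mem_Icc.2 D.a_lt_b.le
  have hb := right_mem_Icc.2 D.a_lt_b.le
  calc D.rightValue (x, z) = v a + ∫ ξ in a..b, D.slope (x, z) ξ := by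
        rw [← h.leftValue_eq, intervalIntegral.integral_of_le D.a_lt_b.le,
          ← integral_Icc_eq_integral_Ioc, ← L1.integral_eq_integral, L1.integral_eq]; rfl
    _ = v b := by
        rw [intervalIntegral_congr_ae_restrict_Icc h.slope_ae ha hb, ← h.sobolev.2 b hb]

theorem IsDiff.residual_eq_zero (h : D.IsDiff x z v g) : D.residual (x, z) = 0 := by
  refine sub_eq_zero.2 (sub_eq_iff_eq_add'.2 (Lp.ext ?_))
  filter_upwards [h.mulL1_ae, Lp.coeFn_add (Lp.const 1 _ (D.leftValue (x, z)))
    (primitiveL1 E a b (D.slope (x, z))), Lp.coeFn_const 1 _ (D.leftValue (x, z))]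
    with ξ hH hadd hconst
  refine hH.trans ?_
  rw [← h.leftValue_eq]
  exact (hadd.trans (by rw [Pi.add_apply, hconst]; rfl)).symm

end FirstOrderData

section AbsolutelyContinuous

variable {X Y Z : Type*} [PseudoMetricSpace X] [PseudoMetricSpace Y] [PseudoMetricSpace Z]
  {E F : Type*} [NormedAddCommGroup E] [NormedSpace ℝ E] [NormedAddCommGroup F] {a b : ℝ}

theorem absolutelyContinuousOnInterval_of_dist_le_add {f : ℝ → X} {g : ℝ → Y} {h : ℝ → Z}
    {C C' : ℝ} (hg : AbsolutelyContinuousOnInterval g a b)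
    (hh : AbsolutelyContinuousOnInterval h a b)
    (hfgh : ∀ s ∈ uIcc a b, ∀ t ∈ uIcc a b,
      dist (f s) (f t) ≤ C * dist (g s) (g t) + C' * dist (h s) (h t)) :
    AbsolutelyContinuousOnInterval f a b := by
  refine squeeze_zero' (Eventually.of_forall fun I => Finset.sum_nonneg fun _ _ => dist_nonneg)
    ?_ (by simpa only [mul_zero, add_zero] using
      (Tendsto.const_mul C hg).add (Tendsto.const_mul C' hh))
  filter_upwards [mem_inf_of_right (mem_principal_self _)] with I hI
  rw [Finset.mul_sum, Finset.mul_sum, ← Finset.sum_add_distrib]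
  exact Finset.sum_le_sum fun i hi => hfgh _ (hI.1 i hi).1 _ (hI.1 i hi).2

theorem absolutelyContinuousOnInterval_norm {f : ℝ → F}
    (hf : AbsolutelyContinuousOnInterval f a b) :
    AbsolutelyContinuousOnInterval (fun ξ => ‖f ξ‖) a b :=
  absolutelyContinuousOnInterval_of_dist_le_add (C := 1) (C' := 0) hf hf fun s _ t _ => by
    simpa [dist_eq_norm (f s)] using dist_norm_norm_le (f s) (f t)

theorem absolutelyContinuousOnInterval_clm_apply [NormedSpace ℝ F] {S : ℝ → E →L[ℝ] F} {v : ℝ → E}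
    (hS : AbsolutelyContinuousOnInterval S a b) (hv : AbsolutelyContinuousOnInterval v a b) :
    AbsolutelyContinuousOnInterval (fun ξ => S ξ (v ξ)) a b := by
  obtain ⟨C, hC⟩ := hS.exists_bound
  obtain ⟨C', hC'⟩ := hv.exists_bound
  refine absolutelyContinuousOnInterval_of_dist_le_add (C := C) (C' := C') hv hS fun s hs t ht => ?_
  calc dist (S s (v s)) (S t (v t)) = ‖S s (v s - v t) + (S s - S t) (v t)‖ := by
        rw [dist_eq_norm, map_sub, sub_apply, sub_add_sub_cancel]
    _ ≤ C * ‖v s - v t‖ + ‖S s - S t‖ * C' :=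
        norm_add_le_of_le ((S s).le_of_opNorm_le (hC s hs) _)
          ((S s - S t).le_opNorm_of_le (hC' t ht))
    _ = C * dist (v s) (v t) + C' * dist (S s) (S t) := by
        rw [dist_eq_norm, dist_eq_norm, mul_comm C']

end AbsolutelyContinuous

namespace IsSobolevOnInterval

variable {E F : Type*} [NormedAddCommGroup E] [NormedSpace ℝ E] [NormedAddCommGroup F]
  [NormedSpace ℝ F] {a b : ℝ} {v g : ℝ → E}

theorem integrableOn (h : IsSobolevOnInterval 1 a b v g) : IntegrableOn g (Icc a b) :=
  memLp_one_iff_integrable.1 h.1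

theorem sub_eq_integral (h : IsSobolevOnInterval 1 a b v g) {s t : ℝ} (hs : s ∈ Icc a b)
    (ht : t ∈ Icc a b) : v t - v s = ∫ r in s..t, g r := by
  have ha : a ∈ Icc a b := left_mem_Icc.2 (hs.1.trans hs.2)
  rw [h.2 s hs, h.2 t ht, add_sub_add_left_eq_sub, intervalIntegral.integral_interval_sub_left
    (intervalIntegrable_of_integrableOn_Icc h.integrableOn ha ht)
    (intervalIntegrable_of_integrableOn_Icc h.integrableOn ha hs)]

theorem absolutelyContinuousOnInterval (h : IsSobolevOnInterval 1 a b v g) (hab : a ≤ b) :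
    AbsolutelyContinuousOnInterval v a b := by
  have ha : a ∈ Icc a b := left_mem_Icc.2 hab
  have hb : b ∈ Icc a b := right_mem_Icc.2 hab
  have hg {s t : ℝ} (hs : s ∈ Icc a b) (ht : t ∈ Icc a b) :
      IntervalIntegrable (fun ξ => ‖g ξ‖) volume s t :=
    intervalIntegrable_of_integrableOn_Icc h.integrableOn.norm hs ht
  have hG := (hg ha hb).absolutelyContinuousOnInterval_intervalIntegral left_mem_uIcc
  refine absolutelyContinuousOnInterval_of_dist_le_add (C := 1) (C' := 0) hG hG ?_
  rw [uIcc_of_le hab]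
  intro s hs t ht
  rw [zero_mul, add_zero, one_mul, dist_eq_norm, Real.dist_eq, h.sub_eq_integral ht hs,
    intervalIntegral.integral_interval_sub_left (hg ha hs) (hg ha ht)]
  exact intervalIntegral.norm_integral_le_abs_integral_norm

theorem ae_hasDerivAt [CompleteSpace E] (h : IsSobolevOnInterval 1 a b v g) :
    ∀ᵐ ξ ∂volume.restrict (Icc a b), HasDerivAt v (g ξ) ξ := by
  rcases lt_or_ge b a with hab | hab
  · simp [Icc_eq_empty hab.not_ge]
  have hg : IntervalIntegrable g volume a b := intervalIntegrable_of_integrableOn_Icc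
    h.integrableOn (left_mem_Icc.2 hab) (right_mem_Icc.2 hab)
  rw [← restrict_Ioo_eq_restrict_Icc, ae_restrict_iff' measurableSet_Ioo]
  filter_upwards [hg.ae_hasDerivAt_integral] with ξ hderiv hξ
  refine ((hderiv (uIcc_of_le hab ▸ Ioo_subset_Icc_self hξ) a left_mem_uIcc).const_add
    (v a)).congr_of_eventuallyEq ?_
  filter_upwards [Ioo_mem_nhds hξ.1 hξ.2] with s hs using h.2 s (Ioo_subset_Icc_self hs)

end IsSobolevOnInterval

section SignFunctional

open NormedSpace (normalize)
open scoped RealInnerProductSpace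

variable {F : Type*} [NormedAddCommGroup F] [InnerProductSpace ℝ F]

theorem inner_normalize_self (c : F) : ⟪normalize c, c⟫ = ‖c‖ := by
  rw [NormedSpace.normalize, real_inner_smul_left, real_inner_self_eq_norm_mul_norm, ← mul_assoc,
    inv_mul_mul_self]

theorem norm_normalize_le_one (c : F) : ‖normalize c‖ ≤ 1 := by
  rw [NormedSpace.normalize, norm_smul, norm_inv, norm_norm]
  exact inv_mul_le_one

theorem inner_normalize_le (c y : F) : ⟪normalize c, y⟫ ≤ ‖y‖ :=
  (real_inner_le_norm _ _).trans
    (mul_le_of_le_one_left (norm_nonneg y) (norm_normalize_le_one c))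

theorem integral_mul_inner_normalize {a b : ℝ} (hab : a ≤ b) {f f' : ℝ → F}
    (hf : AbsolutelyContinuousOnInterval f a b)
    (hf' : ∀ᵐ ξ ∂volume.restrict (Icc a b), HasDerivAt f (f' ξ) ξ) {ρ : ℝ → ℝ} {β : ℝ}
    (hρ : ∀ ξ, HasDerivAt ρ β ξ) :
    ∫ ξ in Icc a b, ρ ξ * ⟪normalize (f ξ), f' ξ⟫ =
      ρ b * ‖f b‖ - ρ a * ‖f a‖ - β * ∫ ξ in Icc a b, ‖f ξ‖ := by
  have norm_ac := absolutelyContinuousOnInterval_norm hf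
  have deriv_ρ : deriv ρ = fun _ => β := funext fun ξ => (hρ ξ).deriv
  have ρ_ac : AbsolutelyContinuousOnInterval ρ a b :=
    ContDiffOn.absolutelyContinuousOnInterval <| ContDiff.contDiffOn <| contDiff_one_iff_deriv.2
      ⟨fun ξ => (hρ ξ).differentiableAt, deriv_ρ ▸ continuous_const⟩
  have deriv_norm : ∀ᵐ ξ ∂volume.restrict (Icc a b),
      ρ ξ * ⟪normalize (f ξ), f' ξ⟫ = ρ ξ * deriv (fun s => ‖f s‖) ξ := by
    filter_upwards [hf', ae_restrict_mem measurableSet_Icc,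
      ae_restrict_of_ae norm_ac.ae_differentiableAt] with ξ hξ hmem hdiff
    rw [deriv_comp_eq_of_support (ℓ := innerSL ℝ (normalize (f ξ))) hξ
      (hdiff (uIcc_of_le hab ▸ hmem)) (inner_normalize_le _) (inner_normalize_self _),
      innerSL_apply_apply]
  have by_parts := ρ_ac.integral_mul_deriv_eq_deriv_mul norm_ac
  simp only [deriv_ρ, intervalIntegral.integral_of_le hab,
    ← integral_Icc_eq_integral_Ioc] at by_parts
  rw [integral_congr_ae deriv_norm, by_parts, integral_const_mul]

variable {α : Type*} [MeasurableSpace α] {μ : Measure α}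

theorem memLp_innerSL_normalize (f : Lp F 1 μ) :
    MemLp (fun ξ => innerSL ℝ (normalize (f ξ))) ∞ μ := by
  have hf : AEStronglyMeasurable (fun ξ => normalize (f ξ)) μ :=
    (Lp.aestronglyMeasurable f).norm.aemeasurable.inv.aestronglyMeasurable.smul
      (Lp.aestronglyMeasurable f)
  refine memLp_top_of_bound ((innerSL ℝ).continuous.comp_aestronglyMeasurable hf) 1
    (ae_of_all _ fun ξ => ?_)
  rw [innerSL_apply_norm]
  exact norm_normalize_le_one (f ξ)

/-- The functional `g ↦ ∫ ⟪f / ‖f‖, g⟫`, which supports the norm of `L¹(μ, F)` at `f`. -/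
noncomputable def signFunctional (f : Lp F 1 μ) : Lp F 1 μ →L[ℝ] ℝ :=
  L1.integralCLM ∘L mulL1 (memLp_innerSL_normalize f)

theorem signFunctional_apply (f g : Lp F 1 μ) :
    signFunctional f g = ∫ ξ, ⟪normalize (f ξ), g ξ⟫ ∂μ := by
  refine Eq.trans ?_ (integral_congr_ae (mulL1_ae (memLp_innerSL_normalize f) g))
  rw [← L1.integral_eq_integral, L1.integral_eq]
  rfl

theorem signFunctional_self (f : Lp F 1 μ) : signFunctional f f = ‖f‖ := by
  simp only [signFunctional_apply, inner_normalize_self, L1.norm_eq_integral_norm]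

theorem signFunctional_le_norm (f g : Lp F 1 μ) : signFunctional f g ≤ ‖g‖ := by
  rw [L1.norm_eq_integral_norm, signFunctional_apply]
  refine integral_mono_ae ?_ (L1.integrable_coeFn g).norm
    (ae_of_all _ fun ξ => inner_normalize_le (f ξ) (g ξ))
  exact (L1.integrable_coeFn _).congr (mulL1_ae (memLp_innerSL_normalize f) g)

end SignFunctional

/-! ### Dissipation of the weighted norm -/

theorem inv_mul_norm_apply_le {V G : Type*} [NormedAddCommGroup V] [NormedSpace ℝ V]
    [NormedAddCommGroup G] [NormedSpace ℝ G] (A : V →L[ℝ] G) (K : ℝ≥0) {p : V} {s : ℝ}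
    (hp : ‖p‖ ≤ K * s) (hs : 0 ≤ s) : (2 * (‖A‖ * K + 1))⁻¹ * ‖A p‖ ≤ s / 2 := by
  rw [inv_mul_le_iff₀ (by positivity)]
  calc ‖A p‖ ≤ ‖A‖ * (K * s) := A.le_opNorm_of_le hp
    _ ≤ ‖A‖ * (K * s) + s := le_add_of_nonneg_right hs
    _ = _ := by ring

theorem exists_mul_norm_sub_norm_le {V F U Y : Type*} [NormedAddCommGroup V] [NormedSpace ℝ V]
    [FiniteDimensional ℝ V] [NormedAddCommGroup F] [NormedSpace ℝ F] [NormedAddCommGroup U]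
    [NormedSpace ℝ U] [NormedAddCommGroup Y] [NormedSpace ℝ Y] {q : V →L[ℝ] F} {B : V →L[ℝ] U}
    (hqB : ∀ p, q p = 0 → B p = 0 → p = 0) (r : V →L[ℝ] F) (O : V →L[ℝ] Y) :
    ∃ δ κ : ℝ, 0 < δ ∧ δ ≤ 1 ∧ 0 < κ ∧ ∀ p, δ * ‖r p‖ - ‖q p‖ ≤ ‖B p‖ - κ * ‖O p‖ := by
  have hker : (q.prod B).toLinearMap.ker = ⊥ := LinearMap.ker_eq_bot'.2 fun p hp =>
    hqB p (congrArg Prod.fst hp) (congrArg Prod.snd hp)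
  obtain ⟨K, -, hK⟩ := LinearMap.exists_antilipschitzWith _ hker
  have hp (p : V) : ‖p‖ ≤ K * (‖q p‖ + ‖B p‖) :=
    ((q.prod B).bound_of_antilipschitz hK p).trans <| mul_le_mul_of_nonneg_left
      (max_le_add_of_nonneg (norm_nonneg (q p)) (norm_nonneg (B p))) K.2
  refine ⟨(2 * (‖r‖ * K + 1))⁻¹, (2 * (‖O‖ * K + 1))⁻¹, by positivity, inv_le_one_of_one_le₀ ?_,
    by positivity, fun p => ?_⟩
  · linarith [mul_nonneg (norm_nonneg r) K.coe_nonneg]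
  · have hs : 0 ≤ ‖q p‖ + ‖B p‖ := by positivity
    linarith [inv_mul_norm_apply_le r K (hp p) hs, inv_mul_norm_apply_le O K (hp p) hs]

theorem memLp_top_clm_comp {E F G α : Type*} [NormedAddCommGroup E] [NormedSpace ℝ E]
    [NormedAddCommGroup F] [NormedSpace ℝ F] [NormedAddCommGroup G] [NormedSpace ℝ G]
    [MeasurableSpace α] {μ : Measure α} {A : α → F →L[ℝ] G} {B : α → E →L[ℝ] F}
    (hA : MemLp A ∞ μ) (hB : MemLp B ∞ μ) : MemLp (fun ξ => A ξ ∘L B ξ) ∞ μ :=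
  ContinuousLinearMap.memLp_of_bilin ∞ (.compL ℝ E F G) hA hB

theorem memLp_top_restrict_Icc_of_continuous {F : Type*} [NormedAddCommGroup F] {a b : ℝ}
    {f : ℝ → F} (hf : Continuous f) : MemLp f ∞ (volume.restrict (Icc a b)) := by
  obtain ⟨C, hC⟩ := isCompact_Icc.exists_bound_of_continuousOn (s := Icc a b) hf.continuousOn
  exact memLp_top_of_bound hf.aestronglyMeasurable C
    ((ae_restrict_mem measurableSet_Icc).mono fun ξ hξ => hC ξ hξ)

namespace FirstOrderData

variable {E : Type*} [NormedAddCommGroup E] [NormedSpace ℝ E] [CompleteSpace E] {a b : ℝ}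
  (D : FirstOrderData E a b)

/-- The pair of boundary values `((H x)(b), (H x)(a))`, in the order used by the boundary
matrices. -/
noncomputable def boundaryValue : IntervalL1 E a b × IntervalL1 E a b →L[ℝ] E × E :=
  D.rightValue.prod D.leftValue

variable {D} {x z : IntervalL1 E a b} {v g : ℝ → E}

theorem IsDiff.boundaryValue_eq (h : D.IsDiff x z v g) : D.boundaryValue (x, z) = (v b, v a) :=
  Prod.ext h.rightValue_eq h.leftValue_eq

end FirstOrderData

/-- First order data with a `C¹`-diagonalisation of the principal part: the operators `coord i ξ`
and `vec i ξ` are the rows of `S ξ` and the columns of `S⁻¹ ξ` for a matrix `S` such that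
`S P H S⁻¹` is diagonal with entries `σ i * d i`. To avoid one-sided derivatives, they are
differentiable on all of `ℝ`, but they are inverse to each other only on `[a,b]`. -/
structure DiagForm (𝕜 E ι : Type*) [RCLike 𝕜] [NormedAddCommGroup E] [NormedSpace ℝ E] [Fintype ι]
    (a b : ℝ) extends FirstOrderData E a b where
  coord : ι → ℝ → E →L[ℝ] 𝕜
  coordDeriv : ι → ℝ → E →L[ℝ] 𝕜
  vec : ι → ℝ → 𝕜 →L[ℝ] E
  vecDeriv : ι → ℝ → 𝕜 →L[ℝ] E
  hasDerivAt_coord : ∀ i ξ, HasDerivAt (coord i) (coordDeriv i ξ) ξ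
  continuous_coordDeriv : ∀ i, Continuous (coordDeriv i)
  hasDerivAt_vec : ∀ i ξ, HasDerivAt (vec i) (vecDeriv i ξ) ξ
  continuous_vecDeriv : ∀ i, Continuous (vecDeriv i)
  sum_vec_coord : ∀ ξ ∈ Icc a b, ∀ e, ∑ i, vec i ξ (coord i ξ e) = e
  coord_sum_vec : ∀ ξ ∈ Icc a b, ∀ (c : ι → 𝕜) i, coord i ξ (∑ j, vec j ξ (c j)) = c i
  d : ι → ℝ → ℝ
  continuous_d : ∀ i, Continuous (d i)
  d_pos : ∀ i ξ, 0 < d i ξ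
  σ : ι → ℝ
  σ_eq : ∀ i, σ i = 1 ∨ σ i = -1
  coord_P_H : ∀ ξ ∈ Icc a b, ∀ e i, coord i ξ (P (H ξ e)) = σ i • d i ξ • coord i ξ e

namespace DiagForm

variable {𝕜 E ι : Type*} [RCLike 𝕜] [NormedAddCommGroup E] [NormedSpace ℝ E] [Fintype ι]
  {a b : ℝ} (D : DiagForm 𝕜 E ι a b) (i : ι)

theorem continuous_coord : Continuous (D.coord i) :=
  continuous_iff_continuousAt.2 fun ξ => (D.hasDerivAt_coord i ξ).continuousAt

theorem continuous_vec : Continuous (D.vec i) :=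
  continuous_iff_continuousAt.2 fun ξ => (D.hasDerivAt_vec i ξ).continuousAt

theorem exists_norm_le_mul_sum_norm_coord :
    ∃ K : ℝ, 0 < K ∧ ∀ ξ ∈ Icc a b, ∀ e, ‖e‖ ≤ K * ∑ i, ‖D.coord i ξ e‖ := by
  choose K hK using fun i => isCompact_Icc.exists_bound_of_continuousOn (s := Icc a b)
    (D.continuous_vec i).continuousOn
  refine ⟨∑ i, |K i| + 1, by positivity, fun ξ hξ e => ?_⟩
  calc ‖e‖ = ‖∑ i, D.vec i ξ (D.coord i ξ e)‖ := by rw [D.sum_vec_coord ξ hξ]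
    _ ≤ ∑ i, (∑ j, |K j| + 1) * ‖D.coord i ξ e‖ := by
        refine norm_sum_le_of_le _ fun i _ => (D.vec i ξ).le_of_opNorm_le ?_ _
        calc ‖D.vec i ξ‖ ≤ |K i| := (hK i ξ hξ).trans (le_abs_self _)
          _ ≤ ∑ j, |K j| :=
              Finset.single_le_sum (fun j _ => abs_nonneg (K j)) (Finset.mem_univ i)
          _ ≤ _ := le_add_of_nonneg_right zero_le_one
    _ = _ := (Finset.mul_sum _ _ _).symm

section InflowOutflow

open Classical in
/-- The values of the characteristic variables `(S P v)ᵢ` at the ends where they leave `[a,b]`, as a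
function of `(v b, v a)`. The variable with `σ i = 1` is transported from `b` to `a`. -/
noncomputable def outgoing : E × E →L[ℝ] PiLp 1 fun _ : ι => 𝕜 :=
  (PiLp.continuousLinearEquiv 1 ℝ fun _ : ι => 𝕜).symm.toContinuousLinearMap ∘L
    .pi fun i => if D.σ i = 1 then D.coord i a ∘L D.P ∘L .snd ℝ _ _ else
      D.coord i b ∘L D.P ∘L .fst ℝ _ _

open Classical in
/-- The values of the characteristic variables `(S P v)ᵢ` at the ends where they enter `[a,b]`, as
a function of `(v b, v a)`. -/
noncomputable def incoming : E × E →L[ℝ] PiLp 1 fun _ : ι => 𝕜 :=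
  (PiLp.continuousLinearEquiv 1 ℝ fun _ : ι => 𝕜).symm.toContinuousLinearMap ∘L
    .pi fun i => if D.σ i = 1 then D.coord i b ∘L D.P ∘L .fst ℝ _ _ else
      D.coord i a ∘L D.P ∘L .snd ℝ _ _

variable {D i} (p : E × E)

theorem outgoing_of_pos (h : D.σ i = 1) : D.outgoing p i = D.coord i a (D.P p.2) := by
  simp [outgoing, h]

theorem outgoing_of_neg (h : D.σ i = -1) : D.outgoing p i = D.coord i b (D.P p.1) := by
  simp [outgoing, h, show (-1 : ℝ) ≠ 1 by norm_num]

theorem incoming_of_pos (h : D.σ i = 1) : D.incoming p i = D.coord i b (D.P p.1) := by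
  simp [incoming, h]

theorem incoming_of_neg (h : D.σ i = -1) : D.incoming p i = D.coord i a (D.P p.2) := by
  simp [incoming, h, show (-1 : ℝ) ≠ 1 by norm_num]

end InflowOutflow

/-- The end of `[a,b]` at which the `i`-th characteristic variable enters. -/
noncomputable def inEnd : ℝ := if D.σ i = 1 then b else a

/-- The distance of `ξ` to the inflow end, relative to the length of `[a,b]`. -/
noncomputable def inDist (ξ : ℝ) : ℝ := D.σ i * (D.inEnd i - ξ) / (b - a)

theorem σ_mul_self : D.σ i * D.σ i = 1 := by
  rcases D.σ_eq i with h | h <;> rw [h] <;> norm_num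

variable {D i} in
theorem inDist_of_pos (h : D.σ i = 1) (ξ : ℝ) : D.inDist i ξ = (b - ξ) / (b - a) := by
  simp [inDist, inEnd, h]

variable {D i} in
theorem inDist_of_neg (h : D.σ i = -1) (ξ : ℝ) : D.inDist i ξ = (ξ - a) / (b - a) := by
  simp [inDist, inEnd, h, show (-1 : ℝ) ≠ 1 by norm_num]

theorem inDist_mem_Icc {ξ : ℝ} (hξ : ξ ∈ Icc a b) : D.inDist i ξ ∈ Icc 0 1 := by
  have hab := sub_pos.2 D.a_lt_b
  rcases D.σ_eq i with h | h
  · rw [inDist_of_pos h]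
    exact ⟨div_nonneg (sub_nonneg.2 hξ.2) hab.le,
      (div_le_one hab).2 (sub_le_sub_left hξ.1 b)⟩
  · rw [inDist_of_neg h]
    exact ⟨div_nonneg (sub_nonneg.2 hξ.1) hab.le,
      (div_le_one hab).2 (sub_le_sub_right hξ.2 a)⟩

theorem hasDerivAt_inDist (ξ : ℝ) : HasDerivAt (D.inDist i) (-(D.σ i / (b - a))) ξ := by
  refine ((((hasDerivAt_id ξ).const_sub (D.inEnd i)).const_mul (D.σ i)).div_const
    (b - a)).congr_deriv ?_
  rw [mul_neg_one, neg_div]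

/-- The affine weight with value `δ` at the inflow end and `1` at the outflow end. -/
noncomputable def weight (δ : ℝ) (ξ : ℝ) : ℝ := δ + (1 - δ) * D.inDist i ξ

variable {δ : ℝ}

theorem hasDerivAt_weight (ξ : ℝ) :
    HasDerivAt (D.weight i δ) ((1 - δ) * -(D.σ i / (b - a))) ξ :=
  ((D.hasDerivAt_inDist i ξ).const_mul (1 - δ)).const_add δ

theorem continuous_weight : Continuous (D.weight i δ) :=
  continuous_iff_continuousAt.2 fun ξ => (D.hasDerivAt_weight i ξ).continuousAt

theorem le_weight (hδ : δ ≤ 1) {ξ : ℝ} (hξ : ξ ∈ Icc a b) : δ ≤ D.weight i δ ξ :=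
  le_add_of_nonneg_right (mul_nonneg (sub_nonneg.2 hδ) (D.inDist_mem_Icc i hξ).1)

theorem σ_mul_weight_sub_weight (p : E × E) :
    D.σ i * (D.weight i δ b * ‖D.coord i b (D.P p.1)‖ - D.weight i δ a * ‖D.coord i a (D.P p.2)‖)
      = δ * ‖D.incoming p i‖ - ‖D.outgoing p i‖ := by
  have hab := (sub_pos.2 D.a_lt_b).ne'
  rcases D.σ_eq i with h | h
  · rw [incoming_of_pos p h, outgoing_of_pos p h, weight, weight, inDist_of_pos h,
      inDist_of_pos h, h, div_self hab]
    ring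
  · rw [incoming_of_neg p h, outgoing_of_neg p h, weight, weight, inDist_of_neg h,
      inDist_of_neg h, h, div_self hab]
    ring

theorem memLp_coord : MemLp (D.coord i) ∞ (volume.restrict (Icc a b)) :=
  memLp_top_restrict_Icc_of_continuous (D.continuous_coord i)

theorem memLp_weight_smul_coord :
    MemLp (fun ξ => D.weight i δ ξ • D.coord i ξ) ∞ (volume.restrict (Icc a b)) :=
  memLp_top_restrict_Icc_of_continuous ((D.continuous_weight i).smul (D.continuous_coord i))

theorem memLp_principal :
    MemLp (fun ξ => D.coord i ξ ∘L D.P ∘L D.H ξ) ∞ (volume.restrict (Icc a b)) :=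
  memLp_top_clm_comp (D.memLp_coord i) <|
    memLp_top_clm_comp (memLp_const (D.P : E →L[ℝ] E)) D.memLp_H

theorem memLp_lowerOrder :
    MemLp (fun ξ => (D.weight i δ ξ • D.coord i ξ) ∘L D.Q ξ ∘L D.H ξ -
      (D.weight i δ ξ • D.coordDeriv i ξ) ∘L D.P ∘L D.H ξ) ∞ (volume.restrict (Icc a b)) := by
  have hderiv : MemLp (fun ξ => D.weight i δ ξ • D.coordDeriv i ξ) ∞ (volume.restrict (Icc a b)) :=
    memLp_top_restrict_Icc_of_continuous ((D.continuous_weight i).smul (D.continuous_coordDeriv i))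
  exact (memLp_top_clm_comp (D.memLp_weight_smul_coord i)
      (memLp_top_clm_comp D.memLp_Q D.memLp_H)).sub
    (memLp_top_clm_comp hderiv (memLp_top_clm_comp (memLp_const (D.P : E →L[ℝ] E)) D.memLp_H))

/-- The `i`-th characteristic variable `(S P H x)ᵢ`, as an operator on `L¹`. -/
noncomputable def principal : IntervalL1 E a b →L[ℝ] IntervalL1 𝕜 a b :=
  mulL1 (D.memLp_principal i)

variable (δ) in
/-- The weighted `i`-th coordinate `weight i δ • (S x)ᵢ`, as an operator on `L¹`. -/
noncomputable def weightedCoord : IntervalL1 E a b →L[ℝ] IntervalL1 𝕜 a b :=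
  mulL1 (D.memLp_weight_smul_coord (δ := δ) i)

variable (δ) in
/-- The bounded part of the weighted `i`-th coordinate of the differential expression: if
`z = P (H x)' + Q (H x)`, then `weight • (S z)ᵢ = weight • (S P H x)ᵢ' + lowerOrder x`. -/
noncomputable def lowerOrder : IntervalL1 E a b →L[ℝ] IntervalL1 𝕜 a b :=
  mulL1 (D.memLp_lowerOrder (δ := δ) i)

variable (δ) in
/-- The map whose norm `∑ i, ‖weight i δ • (S x)ᵢ‖` is the storage function of the system. -/
noncomputable def storageMap : IntervalL1 E a b →L[ℝ] PiLp 1 fun _ : ι => IntervalL1 𝕜 a b :=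
  (PiLp.continuousLinearEquiv 1 ℝ fun _ : ι => IntervalL1 𝕜 a b).symm.toContinuousLinearMap ∘L
    .pi fun i => D.weightedCoord i δ

theorem norm_storageMap (x : IntervalL1 E a b) :
    ‖D.storageMap δ x‖ = ∑ i, ‖D.weightedCoord i δ x‖ :=
  PiLp.norm_eq_of_L1 _

theorem norm_apply_le_ae {K : ℝ} (hK : 0 < K) (hδ₀ : 0 < δ) (hδ₁ : δ ≤ 1)
    (hcoord : ∀ ξ ∈ Icc a b, ∀ e, ‖e‖ ≤ K * ∑ i, ‖D.coord i ξ e‖) (x : IntervalL1 E a b) :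
    ∀ᵐ ξ ∂volume.restrict (Icc a b), ‖x ξ‖ ≤ K / δ * ∑ i, ‖D.weightedCoord i δ x ξ‖ := by
  filter_upwards [ae_all_iff.2 fun i => mulL1_ae (D.memLp_weight_smul_coord (δ := δ) i) x,
    ae_restrict_mem measurableSet_Icc] with ξ hx hξ
  rw [div_mul_eq_mul_div, le_div_iff₀' hδ₀]
  calc δ * ‖x ξ‖ ≤ δ * (K * ∑ i, ‖D.coord i ξ (x ξ)‖) := by gcongr; exact hcoord ξ hξ (x ξ)
    _ = K * ∑ i, δ * ‖D.coord i ξ (x ξ)‖ := by rw [← Finset.mul_sum]; ring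
    _ ≤ K * ∑ i, ‖D.weightedCoord i δ x ξ‖ := by
        gcongr with i
        rw [weightedCoord, hx, smul_apply, norm_smul]
        gcongr
        exact (D.le_weight i hδ₁ hξ).trans (le_abs_self _)

theorem exists_mul_norm_le_norm_storageMap (hδ₀ : 0 < δ) (hδ₁ : δ ≤ 1) :
    ∃ c₀ : ℝ, 0 < c₀ ∧ ∀ x, c₀ * ‖x‖ ≤ ‖D.storageMap δ x‖ := by
  obtain ⟨K, hK, hcoord⟩ := D.exists_norm_le_mul_sum_norm_coord
  refine ⟨δ / K, by positivity, fun x => ?_⟩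
  have integrable_norm (i : ι) : Integrable (fun ξ => ‖D.weightedCoord i δ x ξ‖)
      (volume.restrict (Icc a b)) := (L1.integrable_coeFn _).norm
  rw [← inv_div, inv_mul_le_iff₀ (by positivity)]
  calc ‖x‖ = ∫ ξ in Icc a b, ‖x ξ‖ := L1.norm_eq_integral_norm x
    _ ≤ ∫ ξ in Icc a b, K / δ * ∑ i, ‖D.weightedCoord i δ x ξ‖ :=
        integral_mono_ae (L1.integrable_coeFn x).norm
          ((integrable_finsetSum _ fun i _ => integrable_norm i).const_mul _)
          (D.norm_apply_le_ae hK hδ₀ hδ₁ hcoord x)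
    _ = K / δ * ‖D.storageMap δ x‖ := by
        rw [integral_const_mul, integral_finsetSum _ fun i _ => integrable_norm i,
          norm_storageMap]
        simp only [L1.norm_eq_integral_norm]

section Dissipation

open scoped RealInnerProductSpace

variable {D} {x z : IntervalL1 E a b} {v g : ℝ → E}

theorem principal_ae (h : D.IsDiff x z v g) :
    D.principal i x =ᵐ[volume.restrict (Icc a b)] fun ξ => D.coord i ξ (D.P (v ξ)) := by
  filter_upwards [mulL1_ae (D.memLp_principal i) x, h.v_ae] with ξ hx hv
  rw [hv]
  exact hx

theorem weightedCoord_sub_lowerOrder_ae (h : D.IsDiff x z v g) :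
    (D.weightedCoord i δ z - D.lowerOrder i δ x : IntervalL1 𝕜 a b) =ᵐ[volume.restrict (Icc a b)]
      fun ξ => D.weight i δ ξ • (D.coordDeriv i ξ (D.P (v ξ)) + D.coord i ξ (D.P (g ξ))) := by
  filter_upwards [Lp.coeFn_sub (D.weightedCoord i δ z) (D.lowerOrder i δ x),
    mulL1_ae (D.memLp_weight_smul_coord (δ := δ) i) z,
    mulL1_ae (D.memLp_lowerOrder (δ := δ) i) x, h.v_ae, h.z_ae] with ξ hsub hcoord hlower hv hz
  rw [hsub, Pi.sub_apply, weightedCoord, lowerOrder, hcoord, hlower, hz]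
  simp only [sub_apply, smul_apply, ContinuousLinearMap.comp_apply,
    ContinuousLinearEquiv.coe_coe, ← hv, map_add, smul_add]
  abel

theorem normalize_weightedCoord_ae (hδ₀ : 0 < δ) (hδ₁ : δ ≤ 1) (h : D.IsDiff x z v g) :
    ∀ᵐ ξ ∂volume.restrict (Icc a b),
      NormedSpace.normalize (D.weightedCoord i δ x ξ) =
        D.σ i • NormedSpace.normalize (D.coord i ξ (D.P (v ξ))) := by
  filter_upwards [mulL1_ae (D.memLp_weight_smul_coord (δ := δ) i) x, h.v_ae,
    ae_restrict_mem measurableSet_Icc] with ξ hcoord hv hξ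
  rw [weightedCoord, hcoord, smul_apply, hv, D.coord_P_H ξ hξ,
    NormedSpace.normalize_smul_of_pos (hδ₀.trans_le (D.le_weight i hδ₁ hξ)), smul_comm,
    NormedSpace.normalize_smul_of_pos (D.d_pos i ξ)]
  rcases D.σ_eq i with hσ | hσ <;> simp [hσ, NormedSpace.normalize_neg]

theorem absolutelyContinuousOnInterval_coord (D : DiagForm 𝕜 E ι a b) :
    AbsolutelyContinuousOnInterval (D.coord i) a b := by
  refine ContDiffOn.absolutelyContinuousOnInterval <| ContDiff.contDiffOn <|
    contDiff_one_iff_deriv.2 ⟨fun ξ => (D.hasDerivAt_coord i ξ).differentiableAt, ?_⟩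
  rw [show deriv (D.coord i) = D.coordDeriv i from
    funext fun ξ => (D.hasDerivAt_coord i ξ).deriv]
  exact D.continuous_coordDeriv i

theorem absolutelyContinuousOnInterval_coord_apply (h : D.IsDiff x z v g) :
    AbsolutelyContinuousOnInterval (fun s => D.coord i s (D.P (v s))) a b := by
  have v_ac := h.sobolev.absolutelyContinuousOnInterval D.a_lt_b.le
  have Pv_ac : AbsolutelyContinuousOnInterval (fun s => D.P (v s)) a b := by
    refine absolutelyContinuousOnInterval_of_dist_le_add (C := ‖(D.P : E →L[ℝ] E)‖) (C' := 0)
      v_ac v_ac fun s _ t _ => ?_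
    rw [dist_eq_norm, dist_eq_norm, ← map_sub, zero_mul, add_zero]
    exact (D.P : E →L[ℝ] E).le_opNorm (v s - v t)
  exact absolutelyContinuousOnInterval_clm_apply (D.absolutelyContinuousOnInterval_coord i) Pv_ac

variable [CompleteSpace E]

theorem hasDerivAt_coord_apply_ae (h : D.IsDiff x z v g) :
    ∀ᵐ ξ ∂volume.restrict (Icc a b), HasDerivAt (fun s => D.coord i s (D.P (v s)))
      (D.coordDeriv i ξ (D.P (v ξ)) + D.coord i ξ (D.P (g ξ))) ξ := by
  filter_upwards [h.sobolev.ae_hasDerivAt] with ξ hv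
  have hP : HasDerivAt (fun s => D.P (v s)) (D.P (g ξ)) ξ := D.P.hasFDerivAt.comp_hasDerivAt ξ hv
  exact (D.hasDerivAt_coord i ξ).clm_apply hP

theorem σ_mul_integral_inner_normalize_coord (h : D.IsDiff x z v g) :
    D.σ i * ∫ ξ in Icc a b, D.weight i δ ξ * ⟪NormedSpace.normalize (D.coord i ξ (D.P (v ξ))),
        D.coordDeriv i ξ (D.P (v ξ)) + D.coord i ξ (D.P (g ξ))⟫ =
      δ * ‖D.incoming (v b, v a) i‖ - ‖D.outgoing (v b, v a) i‖ +
        (1 - δ) / (b - a) * ∫ ξ in Icc a b, ‖D.coord i ξ (D.P (v ξ))‖ := by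
  have coord_ac := absolutelyContinuousOnInterval_coord_apply i h
  have coord_deriv := hasDerivAt_coord_apply_ae i h
  rw [integral_mul_inner_normalize D.a_lt_b.le coord_ac coord_deriv (D.hasDerivAt_weight i),
    ← D.σ_mul_weight_sub_weight i]
  linear_combination (1 - δ) / (b - a) * (∫ ξ in Icc a b, ‖D.coord i ξ (D.P (v ξ))‖) *
    D.σ_mul_self i

theorem signFunctional_weightedCoord_sub_lowerOrder (hδ₀ : 0 < δ) (hδ₁ : δ ≤ 1)
    (h : D.IsDiff x z v g) :
    signFunctional (D.weightedCoord i δ x) (D.weightedCoord i δ z - D.lowerOrder i δ x) =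
      δ * ‖D.incoming (v b, v a) i‖ - ‖D.outgoing (v b, v a) i‖ +
        (1 - δ) / (b - a) * ‖D.principal i x‖ := by
  have pointwise : ∀ᵐ ξ ∂volume.restrict (Icc a b),
      ⟪NormedSpace.normalize (D.weightedCoord i δ x ξ),
        (D.weightedCoord i δ z - D.lowerOrder i δ x : IntervalL1 𝕜 a b) ξ⟫ =
      D.σ i * (D.weight i δ ξ * ⟪NormedSpace.normalize (D.coord i ξ (D.P (v ξ))),
        D.coordDeriv i ξ (D.P (v ξ)) + D.coord i ξ (D.P (g ξ))⟫) := by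
    filter_upwards [normalize_weightedCoord_ae i hδ₀ hδ₁ h,
      weightedCoord_sub_lowerOrder_ae (δ := δ) i h] with ξ hx hz
    rw [hx, hz, real_inner_smul_left, real_inner_smul_right]
  have norm_principal : ‖D.principal i x‖ = ∫ ξ in Icc a b, ‖D.coord i ξ (D.P (v ξ))‖ := by
    rw [L1.norm_eq_integral_norm]
    refine integral_congr_ae ?_
    filter_upwards [principal_ae i h] with ξ hξ
    rw [hξ]
  rw [signFunctional_apply, integral_congr_ae pointwise, integral_const_mul, norm_principal,
    σ_mul_integral_inner_normalize_coord i h]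

theorem sum_signFunctional_weightedCoord_le (hδ₀ : 0 < δ) (hδ₁ : δ ≤ 1) (h : D.IsDiff x z v g) :
    ∑ i, signFunctional (D.weightedCoord i δ x) (D.weightedCoord i δ z) ≤
      δ * ‖D.incoming (v b, v a)‖ - ‖D.outgoing (v b, v a)‖ +
        (∑ i, ((1 - δ) / (b - a) * ‖D.principal i‖ + ‖D.lowerOrder i δ‖)) * ‖x‖ := by
  have hab := sub_pos.2 D.a_lt_b
  rw [PiLp.norm_eq_of_L1, PiLp.norm_eq_of_L1, Finset.mul_sum, Finset.sum_mul,
    ← Finset.sum_sub_distrib, ← Finset.sum_add_distrib]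
  refine Finset.sum_le_sum fun i _ => ?_
  have top_order := signFunctional_weightedCoord_sub_lowerOrder i hδ₀ hδ₁ h
  have low_order : signFunctional (D.weightedCoord i δ x) (D.lowerOrder i δ x) ≤
      ‖D.lowerOrder i δ‖ * ‖x‖ :=
    (signFunctional_le_norm _ _).trans ((D.lowerOrder i δ).le_opNorm x)
  have principal_le : (1 - δ) / (b - a) * ‖D.principal i x‖ ≤
      (1 - δ) / (b - a) * (‖D.principal i‖ * ‖x‖) :=
    mul_le_mul_of_nonneg_left ((D.principal i).le_opNorm x)
      (div_nonneg (sub_nonneg.2 hδ₁) hab.le)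
  rw [map_sub] at top_order
  linarith

variable (D) {U Y : Type*} [NormedAddCommGroup U] [NormedSpace ℝ U]
  [NormedAddCommGroup Y] [NormedSpace ℝ Y]

theorem isQuasiDissipative (hδ₀ : 0 < δ) (hδ₁ : δ ≤ 1) {B : E × E →L[ℝ] U} {O : E × E →L[ℝ] Y}
    {κ : ℝ} (hB : ∀ p, δ * ‖D.incoming p‖ - ‖D.outgoing p‖ ≤ ‖B p‖ - κ * ‖O p‖) :
    ∃ C, 0 ≤ C ∧ IsQuasiDissipative D.residual (B ∘L D.boundaryValue) (O ∘L D.boundaryValue)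
      ((normSeminorm ℝ _).comp (D.storageMap δ).toLinearMap) κ C := by
  have hab := sub_pos.2 D.a_lt_b
  set C := ∑ i, ((1 - δ) / (b - a) * ‖D.principal i‖ + ‖D.lowerOrder i δ‖)
  have hC : 0 ≤ C := Finset.sum_nonneg fun i _ => add_nonneg (mul_nonneg
    (div_nonneg (sub_nonneg.2 hδ₁) hab.le) (ContinuousLinearMap.opNorm_nonneg _))
    (ContinuousLinearMap.opNorm_nonneg _)
  refine ⟨1 + C, by positivity, fun x z hxz => ⟨∑ i, signFunctional (D.weightedCoord i δ x) ∘L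
    D.weightedCoord i δ, ?_, fun y => ?_, ?_⟩⟩
  · simp only [sum_apply, ContinuousLinearMap.comp_apply, signFunctional_self]
    exact (D.norm_storageMap x).symm
  · simp only [sum_apply, ContinuousLinearMap.comp_apply]
    exact (Finset.sum_le_sum fun i _ => signFunctional_le_norm _ _).trans_eq
      (D.norm_storageMap y).symm
  · obtain ⟨v, g, h⟩ := D.exists_isDiff hxz
    simp only [sum_apply, ContinuousLinearMap.comp_apply, h.boundaryValue_eq]
    have := sum_signFunctional_weightedCoord_le hδ₀ hδ₁ h
    nlinarith [hB (v b, v a), norm_nonneg (B (v b, v a)), norm_nonneg x]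

theorem energyEstimate [FiniteDimensional ℝ E] {B : E × E →L[ℝ] U}
    (hB : ∀ p, D.outgoing p = 0 → B p = 0 → p = 0)
    (O : E × E →L[ℝ] Y) :
    EnergyEstimate D.residual (B ∘L D.boundaryValue) (O ∘L D.boundaryValue) := by
  obtain ⟨δ, κ, hδ₀, hδ₁, hκ, hBO⟩ := exists_mul_norm_sub_norm_le hB D.incoming O
  obtain ⟨C, hC, hdiss⟩ := D.isQuasiDissipative hδ₀ hδ₁ hBO
  obtain ⟨c₀, hc₀, hcoercive⟩ := D.exists_mul_norm_le_norm_storageMap hδ₀ hδ₁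
  exact hdiss.energyEstimate hκ hC (L := ‖D.storageMap δ‖₊) (D.storageMap δ).le_opNorm hc₀
    hcoercive

end Dissipation

end DiagForm

/-! ### Boundary layers -/

theorem setIntegral_sub_midpoint {a b : ℝ} (hab : a ≤ b) :
    ∫ ξ in Icc a b, (ξ - (a + b) / 2) = 0 := by
  rw [integral_Icc_eq_integral_Ioc, ← intervalIntegral.integral_of_le hab,
    intervalIntegral.integral_sub (continuous_id'.intervalIntegrable _ _) intervalIntegrable_const,
    integral_id, intervalIntegral.integral_const, smul_eq_mul]
  ring

theorem setIntegral_sub_midpoint_mul_nonneg {a b : ℝ} (hab : a ≤ b) {f : ℝ → ℝ} (hf : Monotone f)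
    (hfc : Continuous f) : 0 ≤ ∫ ξ in Icc a b, (ξ - (a + b) / 2) * f ξ := by
  set m := (a + b) / 2
  have continuous_sub : Continuous fun ξ => ξ - m := continuous_id.sub continuous_const
  have integrable_mul : IntegrableOn (fun ξ => (ξ - m) * f ξ) (Icc a b) :=
    (continuous_sub.mul hfc).integrableOn_Icc
  have integrable_const : IntegrableOn (fun ξ => (ξ - m) * f m) (Icc a b) :=
    (continuous_sub.mul continuous_const).integrableOn_Icc
  calc 0 ≤ ∫ ξ in Icc a b, ((ξ - m) * f ξ - (ξ - m) * f m) := by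
        refine integral_nonneg fun ξ => ?_
        rw [← mul_sub]
        rcases le_total m ξ with h | h
        · exact mul_nonneg (sub_nonneg.2 h) (sub_nonneg.2 (hf h))
        · exact mul_nonneg_of_nonpos_of_nonpos (sub_nonpos.2 h) (sub_nonpos.2 (hf h))
    _ = ∫ ξ in Icc a b, (ξ - m) * f ξ := by
        rw [integral_sub integrable_mul integrable_const, integral_mul_const,
          setIntegral_sub_midpoint hab, zero_mul, sub_zero]

theorem exists_ae_norm_le_of_memLp_top {α F : Type*} [NormedAddCommGroup F] [MeasurableSpace α]
    {μ : Measure α} {f : α → F} (hf : MemLp f ∞ μ) : ∃ C, 0 ≤ C ∧ ∀ᵐ x ∂μ, ‖f x‖ ≤ C := by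
  refine ⟨(eLpNorm f ∞ μ).toReal, ENNReal.toReal_nonneg, ?_⟩
  filter_upwards [ae_le_eLpNormEssSup (f := f) (μ := μ)] with x hx
  rw [← eLpNorm_exponent_top] at hx
  rw [← toReal_enorm]
  exact ENNReal.toReal_mono hf.eLpNorm_ne_top hx

namespace DiagForm

variable {𝕜 E ι : Type*} [RCLike 𝕜] [NormedAddCommGroup E] [NormedSpace ℝ E] [Fintype ι]
  {a b : ℝ} (D : DiagForm 𝕜 E ι a b) (i : ι)

section Profile

/-- The travel time from `a` to `ξ` along the `i`-th characteristic. -/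
noncomputable def travelTime (ξ : ℝ) : ℝ := ∫ s in a..ξ, (D.d i s)⁻¹

theorem hasDerivAt_travelTime (ξ : ℝ) : HasDerivAt (D.travelTime i) (D.d i ξ)⁻¹ ξ := by
  have hc : Continuous fun ξ => (D.d i ξ)⁻¹ :=
    (D.continuous_d i).inv₀ fun ξ => (D.d_pos i ξ).ne'
  exact intervalIntegral.integral_hasDerivAt_right (hc.intervalIntegrable _ _)
    hc.aestronglyMeasurable.stronglyMeasurableAtFilter hc.continuousAt

/-- The exponential solution of `σ d e' = l e` with value `1` at the inflow end. -/
noncomputable def profile (l ξ : ℝ) : ℝ :=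
  Real.exp (l * (D.σ i * (D.travelTime i ξ - D.travelTime i (D.inEnd i))))

variable (l ξ : ℝ)

theorem profile_inEnd : D.profile i l (D.inEnd i) = 1 := by
  rw [profile, sub_self, mul_zero, mul_zero, Real.exp_zero]

theorem profile_pos : 0 < D.profile i l ξ := Real.exp_pos _

theorem hasDerivAt_profile :
    HasDerivAt (D.profile i l) (D.profile i l ξ * (l * (D.σ i / D.d i ξ))) ξ := by
  rw [div_eq_mul_inv]
  exact ((((D.hasDerivAt_travelTime i ξ).sub_const _).const_mul (D.σ i)).const_mul l).exp

theorem continuous_profile : Continuous (D.profile i l) :=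
  continuous_iff_continuousAt.2 fun ξ => (D.hasDerivAt_profile i l ξ).continuousAt

theorem continuous_inDist : Continuous (D.inDist i) :=
  continuous_iff_continuousAt.2 fun ξ => (D.hasDerivAt_inDist i ξ).continuousAt

variable {l}

theorem monotone_σ_mul_profile (hl : 0 ≤ l) : Monotone fun ξ => D.σ i * D.profile i l ξ := by
  refine monotone_of_hasDerivAt_nonneg (fun ξ => (D.hasDerivAt_profile i l ξ).const_mul (D.σ i))
    fun ξ => ?_
  have hσ : D.σ i * (D.profile i l ξ * (l * (D.σ i / D.d i ξ))) =
      D.profile i l ξ * (l / D.d i ξ) := by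
    linear_combination D.profile i l ξ * (l / D.d i ξ) * D.σ_mul_self i
  rw [hσ]
  exact mul_nonneg (D.profile_pos i l ξ).le (div_nonneg hl (D.d_pos i ξ).le)

theorem one_sub_inDist : 1 - D.inDist i ξ = 1 / 2 + D.σ i * (ξ - (a + b) / 2) / (b - a) := by
  have hab : b - a ≠ 0 := (sub_pos.2 D.a_lt_b).ne'
  rcases D.σ_eq i with h | h
  · rw [inDist_of_pos h, h]
    field_simp
    ring
  · rw [inDist_of_neg h, h]
    field_simp
    ring

/-- Chebyshev's sum inequality: `1 - inDist`, with mean `1 / 2`, and the profile are monotone in the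
same direction. -/
theorem integral_profile_le (hl : 0 ≤ l) :
    ∫ ξ in Icc a b, D.profile i l ξ ≤
      2 * ∫ ξ in Icc a b, (1 - D.inDist i ξ) * D.profile i l ξ := by
  have hp := D.continuous_profile i l
  have chebyshev := setIntegral_sub_midpoint_mul_nonneg D.a_lt_b.le
    (D.monotone_σ_mul_profile i hl) (continuous_const.mul hp)
  have integrable_half : IntegrableOn (fun ξ => 1 / 2 * D.profile i l ξ) (Icc a b) :=
    (continuous_const.mul hp).integrableOn_Icc
  have integrable_sub_mul : IntegrableOn
      (fun ξ => (b - a)⁻¹ * ((ξ - (a + b) / 2) * (D.σ i * D.profile i l ξ))) (Icc a b) :=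
    (by fun_prop : Continuous _).integrableOn_Icc
  have split : ∫ ξ in Icc a b, (1 - D.inDist i ξ) * D.profile i l ξ =
      1 / 2 * (∫ ξ in Icc a b, D.profile i l ξ) +
        (b - a)⁻¹ * ∫ ξ in Icc a b, (ξ - (a + b) / 2) * (D.σ i * D.profile i l ξ) := by
    rw [← integral_const_mul, ← integral_const_mul, ← integral_add integrable_half
      integrable_sub_mul]
    refine integral_congr_ae (ae_of_all _ fun ξ => ?_)
    simp only [one_sub_inDist]
    ring
  have := mul_nonneg (inv_pos.2 (sub_pos.2 D.a_lt_b)).le chebyshev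
  linarith

end Profile

section Coordinates

/-- The vector function with coordinates `w` with respect to `vec`. -/
noncomputable def ofCoord (w : ι → ℝ → 𝕜) (ξ : ℝ) : E := ∑ i, D.vec i ξ (w i ξ)

/-- The derivative of `ofCoord w` if `w` has derivative `w'`. -/
noncomputable def ofCoordDeriv (w w' : ι → ℝ → 𝕜) (ξ : ℝ) : E :=
  ∑ i, (D.vecDeriv i ξ (w i ξ) + D.vec i ξ (w' i ξ))

variable {D} {w w' : ι → ℝ → 𝕜} {ξ : ℝ}

theorem hasDerivAt_ofCoord (hw : ∀ i, HasDerivAt (w i) (w' i ξ) ξ) :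
    HasDerivAt (D.ofCoord w) (D.ofCoordDeriv w w' ξ) ξ :=
  HasDerivAt.fun_sum fun i _ => (D.hasDerivAt_vec i ξ).clm_apply (hw i)

theorem continuous_ofCoord (hw : ∀ i, Continuous (w i)) : Continuous (D.ofCoord w) :=
  continuous_finsetSum _ fun i _ => (D.continuous_vec i).clm_apply (hw i)

theorem continuous_ofCoordDeriv (hw : ∀ i, Continuous (w i)) (hw' : ∀ i, Continuous (w' i)) :
    Continuous (D.ofCoordDeriv w w') :=
  continuous_finsetSum _ fun i _ => ((D.continuous_vecDeriv i).clm_apply (hw i)).add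
    ((D.continuous_vec i).clm_apply (hw' i))

variable {x z : IntervalL1 E a b} {v g : ℝ → E}

theorem isSobolevOnInterval_ofCoord [CompleteSpace E] (hw : ∀ i ξ, HasDerivAt (w i) (w' i ξ) ξ)
    (hw' : ∀ i, Continuous (w' i)) : IsSobolevOnInterval 1 a b (fun ξ => D.P.symm (D.ofCoord w ξ))
      fun ξ => D.P.symm (D.ofCoordDeriv w w' ξ) := by
  have hwc (i : ι) : Continuous (w i) :=
    continuous_iff_continuousAt.2 fun ξ => (hw i ξ).continuousAt
  have hg : Continuous fun ξ => D.P.symm (D.ofCoordDeriv w w' ξ) :=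
    D.P.symm.continuous.comp (continuous_ofCoordDeriv hwc hw')
  have hv (ξ : ℝ) : HasDerivAt (fun ξ => D.P.symm (D.ofCoord w ξ))
      (D.P.symm (D.ofCoordDeriv w w' ξ)) ξ :=
    D.P.symm.hasFDerivAt.comp_hasDerivAt ξ (hasDerivAt_ofCoord fun i => hw i ξ)
  refine ⟨memLp_one_iff_integrable.2 hg.integrableOn_Icc, fun ξ _ => ?_⟩
  rw [intervalIntegral.integral_eq_sub_of_hasDerivAt (fun s _ => hv s)
    (hg.intervalIntegrable _ _), add_sub_cancel]

theorem coord_H_eq_iff (hξ : ξ ∈ Icc a b) {e : E} {c : 𝕜} :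
    D.coord i ξ (D.P (D.H ξ e)) = c ↔ D.coord i ξ e = (D.σ i / D.d i ξ) • c := by
  have hd := (D.d_pos i ξ).ne'
  rw [D.coord_P_H ξ hξ, smul_smul]
  constructor
  · rintro rfl
    rw [smul_smul, div_mul_eq_mul_div, ← mul_assoc, D.σ_mul_self, one_mul, div_self hd, one_smul]
  · intro h
    rw [h, smul_smul, mul_div_assoc', mul_right_comm, D.σ_mul_self, one_mul, div_self hd, one_smul]

theorem ext_coord (hξ : ξ ∈ Icc a b) {e f : E} (h : ∀ i, D.coord i ξ e = D.coord i ξ f) :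
    e = f := by
  rw [← D.sum_vec_coord ξ hξ e, ← D.sum_vec_coord ξ hξ f]
  simp only [h]

theorem H_eq_iff (hξ : ξ ∈ Icc a b) {e f : E} :
    D.H ξ e = f ↔ e = ∑ i, D.vec i ξ ((D.σ i / D.d i ξ) • D.coord i ξ (D.P f)) := by
  rw [← D.P.injective.eq_iff]
  constructor
  · intro h
    refine ext_coord (D := D) hξ fun i => ?_
    rw [D.coord_sum_vec ξ hξ]
    exact (coord_H_eq_iff i hξ).1 (congrArg _ h)
  · rintro rfl
    refine ext_coord (D := D) hξ fun i => (coord_H_eq_iff i hξ).2 ?_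
    rw [D.coord_sum_vec ξ hξ]

theorem coord_ofCoord (hξ : ξ ∈ Icc a b) : D.coord i ξ (D.ofCoord w ξ) = w i ξ :=
  D.coord_sum_vec ξ hξ (fun i => w i ξ) i

variable (D) in
theorem continuous_σ_div_d : Continuous fun ξ => D.σ i / D.d i ξ :=
  continuous_const.div (D.continuous_d i) fun ξ => (D.d_pos i ξ).ne'

theorem exists_isDiff_ofCoord [CompleteSpace E] (hw : ∀ i ξ, HasDerivAt (w i) (w' i ξ) ξ)
    (hw' : ∀ i, Continuous (w' i)) :
    ∃ x z, D.IsDiff x z (fun ξ => D.P.symm (D.ofCoord w ξ))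
      fun ξ => D.P.symm (D.ofCoordDeriv w w' ξ) := by
  have hwc (i : ι) : Continuous (w i) :=
    continuous_iff_continuousAt.2 fun ξ => (hw i ξ).continuousAt
  have hx : IntegrableOn (D.ofCoord fun i ξ => (D.σ i / D.d i ξ) • w i ξ) (Icc a b) :=
    (continuous_ofCoord fun i => (D.continuous_σ_div_d i).smul (hwc i)).integrableOn_Icc
  have hv : IntegrableOn (fun ξ => D.P.symm (D.ofCoord w ξ)) (Icc a b) :=
    (D.P.symm.continuous.comp (continuous_ofCoord hwc)).integrableOn_Icc
  have hw'' : IntegrableOn (D.ofCoordDeriv w w') (Icc a b) :=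
    (continuous_ofCoordDeriv hwc hw').integrableOn_Icc
  refine ⟨hx.toL1 _, hw''.toL1 _ + mulL1 D.memLp_Q (hv.toL1 _),
    isSobolevOnInterval_ofCoord hw hw', ?_, ?_⟩
  · filter_upwards [hx.coeFn_toL1, ae_restrict_mem measurableSet_Icc] with ξ hxξ hξ
    refine ((H_eq_iff hξ).2 ?_).symm
    rw [hxξ]
    simp only [D.P.apply_symm_apply, coord_ofCoord _ hξ]
    rfl
  · filter_upwards [Lp.coeFn_add (hw''.toL1 _) (mulL1 D.memLp_Q (hv.toL1 _)), hw''.coeFn_toL1,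
      mulL1_ae D.memLp_Q (hv.toL1 _), hv.coeFn_toL1] with ξ hadd hderiv hQ hvξ
    rw [hadd, Pi.add_apply, hderiv, hQ, hvξ, D.P.apply_symm_apply]

theorem exists_boundaryValue_eq [CompleteSpace E] (p : E × E) :
    ∃ q, D.residual q = 0 ∧ D.boundaryValue q = p := by
  have hab := sub_pos.2 D.a_lt_b
  let w (i : ι) (ξ : ℝ) : 𝕜 :=
    ((ξ - a) / (b - a)) • (D.coord i b (D.P p.1) - D.coord i a (D.P p.2)) + D.coord i a (D.P p.2)
  have hw (i : ι) (ξ : ℝ) : HasDerivAt (w i)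
      ((1 / (b - a)) • (D.coord i b (D.P p.1) - D.coord i a (D.P p.2))) ξ :=
    ((((hasDerivAt_id ξ).sub_const a).div_const (b - a)).smul_const _).add_const _
  obtain ⟨x, z, h⟩ := exists_isDiff_ofCoord (D := D) hw fun i => continuous_const
  have left_value : D.ofCoord w a = D.P p.2 := by
    simp [ofCoord, w, D.sum_vec_coord a (left_mem_Icc.2 D.a_lt_b.le)]
  have right_value : D.ofCoord w b = D.P p.1 := by
    simp [ofCoord, w, div_self hab.ne', D.sum_vec_coord b (right_mem_Icc.2 D.a_lt_b.le)]
  refine ⟨(x, z), h.residual_eq_zero, ?_⟩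
  rw [h.boundaryValue_eq, left_value, right_value, D.P.symm_apply_apply, D.P.symm_apply_apply]

end Coordinates

section Layer

/-- The coordinates of a solution of `P (H x)' = l x` up to bounded terms. For large `l` it is
concentrated at the inflow ends, where its coordinates are `c`; it vanishes at the outflow ends. -/
noncomputable def layer (l : ℝ) (c : ι → 𝕜) (i : ι) (ξ : ℝ) : 𝕜 :=
  ((1 - D.inDist i ξ) * D.profile i l ξ) • c i

/-- The derivative of `layer`. -/
noncomputable def layerDeriv (l : ℝ) (c : ι → 𝕜) (i : ι) (ξ : ℝ) : 𝕜 :=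
  (D.σ i / (b - a) * D.profile i l ξ) • c i + l • (D.σ i / D.d i ξ) • D.layer l c i ξ

/-- The factor by which `layer` fails to solve `P (H x)' + Q (H x) = l x`, which does not depend
on `l`. -/
noncomputable def layerDefect (ξ : ℝ) : 𝕜 →L[ℝ] E :=
  (1 - D.inDist i ξ) • (D.vecDeriv i ξ + D.Q ξ ∘L D.P.symm ∘L D.vec i ξ) +
    (D.σ i / (b - a)) • D.vec i ξ

variable (l : ℝ) (c : ι → 𝕜)

theorem hasDerivAt_layer (ξ : ℝ) : HasDerivAt (D.layer l c i) (D.layerDeriv l c i ξ) ξ := by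
  refine ((((D.hasDerivAt_inDist i ξ).const_sub 1).mul
    (D.hasDerivAt_profile i l ξ)).smul_const (c i)).congr_deriv ?_
  rw [layerDeriv, layer, smul_smul, smul_smul, ← add_smul]
  congr 1
  ring

theorem continuous_layer : Continuous (D.layer l c i) :=
  continuous_iff_continuousAt.2 fun ξ => (D.hasDerivAt_layer i l c ξ).continuousAt

theorem continuous_layerDeriv : Continuous (D.layerDeriv l c i) :=
  ((continuous_const.mul (D.continuous_profile i l)).smul continuous_const).add
    (((D.continuous_σ_div_d i).smul (D.continuous_layer i l c)).const_smul l)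

theorem memLp_vec : MemLp (D.vec i) ∞ (volume.restrict (Icc a b)) :=
  memLp_top_restrict_Icc_of_continuous (D.continuous_vec i)

theorem memLp_reaction : MemLp (fun ξ => D.vecDeriv i ξ + D.Q ξ ∘L D.P.symm ∘L D.vec i ξ) ∞
    (volume.restrict (Icc a b)) :=
  (memLp_top_restrict_Icc_of_continuous (D.continuous_vecDeriv i)).add <|
    memLp_top_clm_comp D.memLp_Q <|
      memLp_top_clm_comp (memLp_const (D.P.symm : E →L[ℝ] E)) (D.memLp_vec i)

theorem memLp_layerDefect : MemLp (D.layerDefect i) ∞ (volume.restrict (Icc a b)) := by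
  have memLp_inDist : MemLp (fun ξ => 1 - D.inDist i ξ) ∞ (volume.restrict (Icc a b)) :=
    memLp_top_restrict_Icc_of_continuous (continuous_const.sub (D.continuous_inDist i))
  have memLp_σ_smul_vec : MemLp (fun ξ => (D.σ i / (b - a)) • D.vec i ξ) ∞
      (volume.restrict (Icc a b)) :=
    memLp_top_restrict_Icc_of_continuous ((D.continuous_vec i).const_smul (D.σ i / (b - a)))
  exact (MemLp.smul (D.memLp_reaction i) memLp_inDist).add memLp_σ_smul_vec

variable {D} {l c} {p : E × E}

theorem layer_incoming_left (hp : D.outgoing p = 0) :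
    D.layer l (D.incoming p) i a = D.coord i a (D.P p.2) := by
  have out_zero : D.outgoing p i = 0 := by rw [hp, PiLp.zero_apply]
  rcases D.σ_eq i with h | h
  · rw [outgoing_of_pos p h] at out_zero
    rw [layer, out_zero, inDist_of_pos h, div_self (sub_pos.2 D.a_lt_b).ne', sub_self, zero_mul,
      zero_smul]
  · have inEnd_eq : D.inEnd i = a := by simp [inEnd, h, show (-1 : ℝ) ≠ 1 by norm_num]
    have profile_eq := D.profile_inEnd i l
    rw [inEnd_eq] at profile_eq
    rw [layer, incoming_of_neg p h, inDist_of_neg h, profile_eq, sub_self, zero_div, sub_zero,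
      one_mul, one_smul]

theorem layer_incoming_right (hp : D.outgoing p = 0) :
    D.layer l (D.incoming p) i b = D.coord i b (D.P p.1) := by
  have out_zero : D.outgoing p i = 0 := by rw [hp, PiLp.zero_apply]
  rcases D.σ_eq i with h | h
  · have inEnd_eq : D.inEnd i = b := if_pos h
    have profile_eq := D.profile_inEnd i l
    rw [inEnd_eq] at profile_eq
    rw [layer, incoming_of_pos p h, inDist_of_pos h, profile_eq, sub_self, zero_div, sub_zero,
      one_mul, one_smul]
  · rw [outgoing_of_neg p h] at out_zero
    rw [layer, out_zero, inDist_of_neg h, div_self (sub_pos.2 D.a_lt_b).ne', sub_self, zero_mul,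
      zero_smul]

variable {x z : IntervalL1 E a b}

theorem sub_smul_layer_ae (h : D.IsDiff x z (fun ξ => D.P.symm (D.ofCoord (D.layer l c) ξ))
    fun ξ => D.P.symm (D.ofCoordDeriv (D.layer l c) (D.layerDeriv l c) ξ)) :
    (z - l • x : IntervalL1 E a b) =ᵐ[volume.restrict (Icc a b)]
      fun ξ => ∑ i, D.profile i l ξ • D.layerDefect i ξ (c i) := by
  filter_upwards [Lp.coeFn_sub z (l • x), Lp.coeFn_smul l x, h.v_ae, h.z_ae,
    ae_restrict_mem measurableSet_Icc] with ξ hsub hsmul hv hz hξ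
  have hx : x ξ = ∑ i, D.vec i ξ ((D.σ i / D.d i ξ) • D.layer l c i ξ) := by
    rw [(H_eq_iff hξ).1 hv.symm]
    simp only [D.P.apply_symm_apply, coord_ofCoord _ hξ]
  rw [hsub, Pi.sub_apply, hsmul, Pi.smul_apply, hx, hz, D.P.apply_symm_apply, ofCoordDeriv, ofCoord,
    map_sum, map_sum, Finset.smul_sum, ← Finset.sum_add_distrib, ← Finset.sum_sub_distrib]
  refine Finset.sum_congr rfl fun i _ => ?_
  simp only [layerDeriv, layer, layerDefect, add_apply, smul_apply,
    ContinuousLinearMap.comp_apply, ContinuousLinearEquiv.coe_coe, map_add, map_smul]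
  module

theorem integral_profile_mul_norm_le (hl : 0 ≤ l) {g : ℝ → E}
    (h : D.IsDiff x z (fun ξ => D.P.symm (D.ofCoord (D.layer l c) ξ)) g) :
    ∫ ξ in Icc a b, D.profile i l ξ * ‖c i‖ ≤ 2 * (‖D.principal i‖ * ‖x‖) := by
  have norm_principal : ‖D.principal i x‖ =
      (∫ ξ in Icc a b, (1 - D.inDist i ξ) * D.profile i l ξ) * ‖c i‖ := by
    rw [L1.norm_eq_integral_norm, ← integral_mul_const]
    refine integral_congr_ae ?_
    filter_upwards [principal_ae i h, ae_restrict_mem measurableSet_Icc] with ξ hx hξ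
    rw [hx, D.P.apply_symm_apply, coord_ofCoord _ hξ, layer, norm_smul, Real.norm_of_nonneg]
    exact mul_nonneg (sub_nonneg.2 (D.inDist_mem_Icc i hξ).2) (D.profile_pos i l ξ).le
  calc ∫ ξ in Icc a b, D.profile i l ξ * ‖c i‖
      = (∫ ξ in Icc a b, D.profile i l ξ) * ‖c i‖ := integral_mul_const _ _
    _ ≤ (2 * ∫ ξ in Icc a b, (1 - D.inDist i ξ) * D.profile i l ξ) * ‖c i‖ := by
        gcongr
        exact D.integral_profile_le i hl
    _ = 2 * ‖D.principal i x‖ := by rw [norm_principal, mul_assoc]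
    _ ≤ 2 * (‖D.principal i‖ * ‖x‖) := by
        gcongr
        exact (D.principal i).le_opNorm x

variable (D) in
theorem exists_norm_sub_smul_layer_le : ∃ C, 0 ≤ C ∧ ∀ l, 0 ≤ l → ∀ c x z,
    D.IsDiff x z (fun ξ => D.P.symm (D.ofCoord (D.layer l c) ξ))
      (fun ξ => D.P.symm (D.ofCoordDeriv (D.layer l c) (D.layerDeriv l c) ξ)) →
    ‖z - l • x‖ ≤ C * ‖x‖ := by
  choose K hK hbound using fun i => exists_ae_norm_le_of_memLp_top (D.memLp_layerDefect i)
  have hC : 0 ≤ ∑ i, K i * (2 * ‖D.principal i‖) := Finset.sum_nonneg fun i _ =>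
    mul_nonneg (hK i) (mul_nonneg zero_le_two (ContinuousLinearMap.opNorm_nonneg _))
  refine ⟨_, hC, fun l hl c x z h => ?_⟩
  have integrable_profile (i : ι) : IntegrableOn (fun ξ => K i * (D.profile i l ξ * ‖c i‖))
      (Icc a b) :=
    (continuous_const.mul ((D.continuous_profile i l).mul continuous_const)).integrableOn_Icc
  calc ‖z - l • x‖ = ∫ ξ in Icc a b, ‖(z - l • x : IntervalL1 E a b) ξ‖ :=
        L1.norm_eq_integral_norm _
    _ ≤ ∫ ξ in Icc a b, ∑ i, K i * (D.profile i l ξ * ‖c i‖) := by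
        refine integral_mono_ae (L1.integrable_coeFn _).norm
          (integrable_finsetSum _ fun i _ => integrable_profile i) ?_
        filter_upwards [sub_smul_layer_ae h, ae_all_iff.2 hbound] with ξ hξ hKξ
        rw [hξ]
        refine norm_sum_le_of_le _ fun i _ => ?_
        rw [norm_smul, Real.norm_of_nonneg (D.profile_pos i l ξ).le, mul_left_comm]
        exact mul_le_mul_of_nonneg_left ((D.layerDefect i ξ).le_of_opNorm_le (hKξ i) _)
          (D.profile_pos i l ξ).le
    _ = ∑ i, K i * ∫ ξ in Icc a b, D.profile i l ξ * ‖c i‖ := by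
        rw [integral_finsetSum _ fun i _ => integrable_profile i]
        simp only [integral_const_mul]
    _ ≤ ∑ i, K i * (2 * (‖D.principal i‖ * ‖x‖)) := Finset.sum_le_sum fun i _ =>
        mul_le_mul_of_nonneg_left (integral_profile_mul_norm_le i hl h) (hK i)
    _ = (∑ i, K i * (2 * ‖D.principal i‖)) * ‖x‖ := by
        rw [Finset.sum_mul]
        exact Finset.sum_congr rfl fun i _ => by ring

variable [CompleteSpace E] {U : Type*} [NormedAddCommGroup U] [NormedSpace ℝ U]
  {S : C0Semigroup ℝ (IntervalL1 E a b)} {B : E × E →L[ℝ] U}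

/-- Otherwise, the boundary layers with inflow values `incoming p` would contradict the resolvent
estimate for large `l`. -/
theorem eq_zero_of_outgoing_eq_zero
    (hS : S.IsGenerator {q | D.residual q = 0 ∧ B (D.boundaryValue q) = 0}) {M : ℝ}
    (hM : ∀ t, ‖S.T t‖ ≤ M) (hp : D.outgoing p = 0) (hB : B p = 0) : p = 0 := by
  have ha := left_mem_Icc.2 D.a_lt_b.le
  have hb := right_mem_Icc.2 D.a_lt_b.le
  obtain ⟨C, hC, hbound⟩ := D.exists_norm_sub_smul_layer_le
  have hM₀ : 0 ≤ M := (ContinuousLinearMap.opNorm_nonneg _).trans (hM 0)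
  set l := M * C + 1 with hl
  have hl₀ : 0 < l := by positivity
  obtain ⟨x, z, h⟩ := exists_isDiff_ofCoord (D := D)
    (fun i => D.hasDerivAt_layer i l (D.incoming p))
    fun i => D.continuous_layerDeriv i l (D.incoming p)
  set v := fun ξ => D.P.symm (D.ofCoord (D.layer l (D.incoming p)) ξ)
  have boundary_eq : (v b, v a) = p := by
    simp only [v, ofCoord, layer_incoming_left _ hp, layer_incoming_right _ hp,
      D.sum_vec_coord a ha, D.sum_vec_coord b hb, D.P.symm_apply_apply]
  have hx : x = 0 := by
    have resolvent_estimate : l * ‖x‖ ≤ M * (C * ‖x‖) :=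
      (hS.mul_norm_le hM ⟨h.residual_eq_zero, by rw [h.boundaryValue_eq, boundary_eq, hB]⟩
        hl₀).trans (mul_le_mul_of_nonneg_left (hbound l hl₀.le _ x z h) hM₀)
    rw [hl] at resolvent_estimate
    exact norm_le_zero_iff.1 (by linarith)
  have v_ae_zero : v =ᵐ[volume.restrict (Icc a b)] 0 := by
    filter_upwards [h.v_ae, hx ▸ Lp.coeFn_zero E 1 (volume.restrict (Icc a b))] with ξ hv hxξ
    rw [hv, hxξ, Pi.zero_apply, map_zero]
  have v_continuous : Continuous v :=
    D.P.symm.continuous.comp (continuous_ofCoord fun i => D.continuous_layer i l _)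
  have v_zero := Measure.eqOn_Icc_of_ae_eq volume D.a_lt_b.ne v_ae_zero v_continuous.continuousOn
    continuousOn_const
  rw [← boundary_eq, v_zero ha, v_zero hb]
  rfl

end Layer

end DiagForm

/-! ### Output bound for systems in diagonal form -/

theorem hasDerivAt_indicator_Ici {X : Type*} [NormedAddCommGroup X] [NormedSpace ℝ X]
    {x x' : ℝ → X} (hx : ∀ t ∈ Ici (0 : ℝ), HasDerivWithinAt x (x' t) (Ici 0) t) (hx0 : x 0 = 0)
    (hx'0 : x' 0 = 0) (t : ℝ) :
    HasDerivAt ((Ici 0).indicator x) ((Ici 0).indicator x' t) t := by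
  have hneg (s : ℝ) (hs : s ∈ Iic 0) : (Ici 0).indicator x s = 0 := by
    rcases eq_or_lt_of_le (mem_Iic.1 hs) with rfl | hs
    · rw [indicator_of_mem self_mem_Ici, hx0]
    · exact indicator_of_notMem (notMem_Ici.2 hs) _
  rcases lt_trichotomy t 0 with ht | rfl | ht
  · rw [indicator_of_notMem (notMem_Ici.2 ht)]
    exact (hasDerivAt_const t (0 : X)).congr_of_eventuallyEq <|
      eventually_of_mem (Iic_mem_nhds ht) hneg
  · have left_deriv : HasDerivWithinAt ((Ici 0).indicator x) (x' 0) (Iic 0) 0 := by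
      rw [hx'0]
      exact (hasDerivWithinAt_const 0 _ (0 : X)).congr hneg (hneg 0 self_mem_Iic)
    have right_deriv : HasDerivWithinAt ((Ici 0).indicator x) (x' 0) (Ici 0) 0 :=
      (hx 0 self_mem_Ici).congr (fun s hs => indicator_of_mem hs _)
        (indicator_of_mem self_mem_Ici _)
    have two_sided := left_deriv.union right_deriv
    rw [indicator_of_mem self_mem_Ici]
    rwa [Iic_union_Ici, hasDerivWithinAt_univ] at two_sided
  · rw [indicator_of_mem (mem_Ici.2 ht.le)]
    exact ((hx t ht.le).hasDerivAt (Ici_mem_nhds ht)).congr_of_eventuallyEq <|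
      eventually_of_mem (Ici_mem_nhds ht) fun s hs => indicator_of_mem hs _

theorem continuous_indicator_Ici {X : Type*} [TopologicalSpace X] [Zero X] {f : ℝ → X}
    (hf : ContinuousOn f (Ici 0)) (hf0 : f 0 = 0) : Continuous ((Ici (0 : ℝ)).indicator f) := by
  refine continuous_indicator (fun t ht => ?_) (by rwa [closure_Ici])
  rw [frontier_Ici, mem_singleton_iff] at ht
  rw [ht, hf0]

theorem C0Semigroup.IsGenerator.eq_zero_of_zero_mem {X : Type*} [NormedAddCommGroup X]
    [NormedSpace ℝ X] {S : C0Semigroup ℝ X} {A : Set (X × X)} (hS : S.IsGenerator A) {z : X}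
    (hz : (0, z) ∈ A) : z = 0 := by
  refine tendsto_nhds_unique ((hS 0 z).1 hz) (tendsto_const_nhds.congr fun h => ?_)
  rw [_root_.map_zero, sub_zero, smul_zero]

theorem FirstOrderData.IsDiff.eqOn_zero {E : Type*} [NormedAddCommGroup E] [NormedSpace ℝ E]
    {a b : ℝ} {D : FirstOrderData E a b} {z : IntervalL1 E a b} {v g : ℝ → E}
    (h : D.IsDiff 0 z v g) : EqOn v 0 (Icc a b) := by
  refine Measure.eqOn_Icc_of_ae_eq volume D.a_lt_b.ne ?_ ?_ continuousOn_const
  · filter_upwards [h.v_ae, Lp.coeFn_zero E 1 (volume.restrict (Icc a b))] with ξ hv hzero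
    rw [hv, hzero, Pi.zero_apply, map_zero]
  · have hg : IntegrableOn g (uIcc a b) := by
      rw [uIcc_of_le D.a_lt_b.le]
      exact memLp_one_iff_integrable.1 h.sobolev.1
    have := intervalIntegral.continuousOn_primitive_interval hg
    rw [uIcc_of_le D.a_lt_b.le] at this
    exact (continuousOn_const.add this).congr h.sobolev.2

namespace FirstOrderData

variable {E U : Type*} [NormedAddCommGroup E] [NormedSpace ℝ E] [CompleteSpace E]
  [NormedAddCommGroup U] [NormedSpace ℝ U] {a b : ℝ} {D : FirstOrderData E a b}

theorem isTrajectory_indicator {S : C0Semigroup ℝ (IntervalL1 E a b)} {B : E × E →L[ℝ] U}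
    (hS : S.IsGenerator {q | D.residual q = 0 ∧ B (D.boundaryValue q) = 0})
    {x x' : ℝ → IntervalL1 E a b} {v g : ℝ → ℝ → E}
    (hx : ∀ t ∈ Ici (0 : ℝ), HasDerivWithinAt x (x' t) (Ici 0) t) (hx' : ContinuousOn x' (Ici 0))
    (hx0 : x 0 = 0) (hD : ∀ t ∈ Ici (0 : ℝ), D.IsDiff (x t) (x' t) (v t) (g t)) :
    IsTrajectory D.residual ((Ici (0 : ℝ)).indicator fun t => (x t, x' t)) ∧
      ∀ t ≤ 0, (Ici (0 : ℝ)).indicator (fun t => (x t, x' t)) t = 0 := by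
  have hD0 := hD 0 self_mem_Ici
  rw [hx0] at hD0
  have hx'0 : x' 0 = 0 := hS.eq_zero_of_zero_mem ⟨hD0.residual_eq_zero, by
    rw [hD0.boundaryValue_eq, hD0.eqOn_zero (left_mem_Icc.2 D.a_lt_b.le),
      hD0.eqOn_zero (right_mem_Icc.2 D.a_lt_b.le)]
    exact map_zero B⟩
  have hxx'0 : (x 0, x' 0) = 0 := by rw [hx0, hx'0]; rfl
  refine ⟨⟨fun t => ?_, ?_, fun t => ?_⟩, fun t ht => ?_⟩
  · convert hasDerivAt_indicator_Ici hx hx0 hx'0 t using 1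
    · ext1 s
      by_cases hs : s ∈ Ici (0 : ℝ) <;> simp [hs]
    · by_cases ht : t ∈ Ici (0 : ℝ) <;> simp [ht]
  · exact continuous_indicator_Ici
      (ContinuousOn.prodMk (fun t ht => (hx t ht).continuousWithinAt) hx') hxx'0
  · by_cases ht : t ∈ Ici (0 : ℝ)
    · rw [indicator_of_mem ht, (hD t ht).residual_eq_zero]
    · rw [indicator_of_notMem ht, map_zero]
  · rcases eq_or_lt_of_le ht with rfl | ht
    · rw [indicator_of_mem self_mem_Ici, hxx'0]
    · exact indicator_of_notMem (notMem_Ici.2 ht) _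

end FirstOrderData

theorem DiagForm.exists_norm_output_le {𝕜 E ι U Y : Type*} [RCLike 𝕜] [NormedAddCommGroup E]
    [NormedSpace ℝ E] [FiniteDimensional ℝ E] [CompleteSpace E] [Fintype ι]
    [NormedAddCommGroup U] [NormedSpace ℝ U] [FiniteDimensional ℝ U]
    [NormedAddCommGroup Y] [NormedSpace ℝ Y] [CompleteSpace Y] {a b : ℝ} {D : DiagForm 𝕜 E ι a b}
    {S : C0Semigroup ℝ (IntervalL1 E a b)} {B : E × E →L[ℝ] U}
    (hS : S.IsGenerator {q | D.residual q = 0 ∧ B (D.boundaryValue q) = 0})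
    (hstab : S.IsExponentiallyStable) (hB : Function.Surjective B) (O : E × E →L[ℝ] Y) :
    ∃ C, ∀ (x x' : ℝ → IntervalL1 E a b) (v g : ℝ → ℝ → E),
      (∀ t ∈ Ici (0 : ℝ), HasDerivWithinAt x (x' t) (Ici 0) t) → ContinuousOn x' (Ici 0) →
      x 0 = 0 → (∀ t ∈ Ici (0 : ℝ), D.IsDiff (x t) (x' t) (v t) (g t)) → ∀ t β : ℝ, 0 ≤ t →
      (∀ s ∈ Icc 0 t, ‖B (v s b, v s a)‖ ≤ β) → ‖O (v t b, v t a)‖ ≤ C * β := by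
  obtain ⟨M, hM⟩ := hstab.exists_norm_le
  have henergy := D.energyEstimate
    (fun p hp hBp => D.eq_zero_of_outgoing_eq_zero hS hM hp hBp) O
  have hsurj (u : U) :
      ∃ q p, D.residual (q, p) = 0 ∧ (B ∘L D.boundaryValue) (q, p) = u := by
    obtain ⟨e, rfl⟩ := hB u
    obtain ⟨⟨q, p⟩, hres, hbv⟩ := D.exists_boundaryValue_eq e
    exact ⟨q, p, hres, congrArg B hbv⟩
  obtain ⟨C, hC⟩ := henergy.exists_norm_output_le hS hstab hsurj
  refine ⟨C, fun x x' v g hx hx' hx0 hD t β ht hβ => ?_⟩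
  obtain ⟨htraj, hzero⟩ := FirstOrderData.isTrajectory_indicator hS hx hx' hx0 hD
  have hbv (s : ℝ) (hs : 0 ≤ s) :
      D.boundaryValue ((Ici (0 : ℝ)).indicator (fun t => (x t, x' t)) s) = (v s b, v s a) := by
    rw [indicator_of_mem (mem_Ici.2 hs), (hD s hs).boundaryValue_eq]
  have := hC _ htraj hzero t β ht fun s hs => by
    rw [ContinuousLinearMap.comp_apply, hbv s hs.1]
    exact hβ s hs
  rwa [ContinuousLinearMap.comp_apply, hbv t ht] at this

/-! ### Matrices and diagonal forms -/

theorem exists_hasDerivAt_extension_of_contDiffOn {F : Type*} [NormedAddCommGroup F]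
    [NormedSpace ℝ F] [CompleteSpace F] {f : ℝ → F} {a b : ℝ} (hab : a < b)
    (hf : ContDiffOn ℝ 1 f (Icc a b)) :
    ∃ g g' : ℝ → F, (∀ ξ, HasDerivAt g (g' ξ) ξ) ∧ Continuous g' ∧ EqOn g f (Icc a b) := by
  have hd : ContinuousOn (derivWithin f (Icc a b)) (Icc a b) :=
    hf.continuousOn_derivWithin (uniqueDiffOn_Icc hab) le_rfl
  set g' := IccExtend hab.le ((Icc a b).domRestrict (derivWithin f (Icc a b)))
  have hc : Continuous g' := hd.domRestrict.Icc_extend'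
  refine ⟨fun ξ => f a + ∫ s in a..ξ, g' s, g', fun ξ => ?_, hc, fun ξ hξ => ?_⟩
  · exact (intervalIntegral.integral_hasDerivAt_right (hc.intervalIntegrable _ _)
      hc.aestronglyMeasurable.stronglyMeasurableAtFilter hc.continuousAt).const_add _
  · have hderiv (s : ℝ) (hs : s ∈ Ioo a ξ) : HasDerivWithinAt f (g' s) (Ioi s) s := by
      have hs' : s ∈ Icc a b := ⟨hs.1.le, hs.2.le.trans hξ.2⟩
      have := (hf.differentiableOn one_ne_zero s hs').hasDerivWithinAt
      rw [show g' s = derivWithin f (Icc a b) s from IccExtend_of_mem _ _ hs']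
      exact (this.hasDerivAt (Icc_mem_nhds hs.1 (hs.2.trans_le hξ.2))).hasDerivWithinAt
    simp only [intervalIntegral.integral_eq_sub_of_hasDeriv_right_of_le hξ.1
      (hf.continuousOn.mono (Icc_subset_Icc_right hξ.2)) hderiv (hc.intervalIntegrable _ _),
      add_sub_cancel]

section DiagFormConstruction

variable {𝕜 E ι : Type*} [RCLike 𝕜] [NormedAddCommGroup E] [NormedSpace ℝ E] [Fintype ι]
  {a b : ℝ}

theorem exists_diagForm_of_hasDerivAt (hab : a < b) (P : E ≃L[ℝ] E) {Q : ℝ → E →L[ℝ] E}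
    (hQ : MemLp Q ∞ (volume.restrict (Icc a b))) {coord coordDeriv : ι → ℝ → E →L[ℝ] 𝕜}
    {vec vecDeriv : ι → ℝ → 𝕜 →L[ℝ] E}
    (hcoord : ∀ i ξ, HasDerivAt (coord i) (coordDeriv i ξ) ξ)
    (hcoordDeriv : ∀ i, Continuous (coordDeriv i))
    (hvec : ∀ i ξ, HasDerivAt (vec i) (vecDeriv i ξ) ξ) (hvecDeriv : ∀ i, Continuous (vecDeriv i))
    (sum_vec_coord : ∀ ξ ∈ Icc a b, ∀ e, ∑ i, vec i ξ (coord i ξ e) = e)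
    (coord_sum_vec : ∀ ξ ∈ Icc a b, ∀ (c : ι → 𝕜) i, coord i ξ (∑ j, vec j ξ (c j)) = c i)
    {d : ι → ℝ → ℝ} (hd : ∀ i, Continuous (d i)) (d_pos : ∀ i ξ, 0 < d i ξ) {σ : ι → ℝ}
    (hσ : ∀ i, σ i = 1 ∨ σ i = -1) {H : ℝ → E →L[ℝ] E}
    (hH : ∀ᵐ ξ ∂volume.restrict (Icc a b), ∀ e i,
      coord i ξ (P (H ξ e)) = σ i • d i ξ • coord i ξ e) :
    ∃ D : DiagForm 𝕜 E ι a b, D.P = P ∧ D.Q = Q ∧ ∀ᵐ ξ ∂volume.restrict (Icc a b), D.H ξ = H ξ := by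
  have hcoord_cont (i : ι) : Continuous (coord i) :=
    continuous_iff_continuousAt.2 fun ξ => (hcoord i ξ).continuousAt
  have hvec_cont (i : ι) : Continuous (vec i) :=
    continuous_iff_continuousAt.2 fun ξ => (hvec i ξ).continuousAt
  let G (ξ : ℝ) : E →L[ℝ] E := ∑ j, vec j ξ ∘L ((σ j * d j ξ) • coord j ξ)
  have hG : Continuous G := continuous_finsetSum _ fun j _ =>
    (hvec_cont j).clm_comp ((continuous_const.mul (hd j)).smul (hcoord_cont j))
  have hG_apply (ξ : ℝ) (e : E) : G ξ e = ∑ j, vec j ξ (σ j • d j ξ • coord j ξ e) := by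
    simp only [G, sum_apply, ContinuousLinearMap.comp_apply, smul_apply, mul_smul]
  let D : DiagForm 𝕜 E ι a b :=
    { a_lt_b := hab, P := P, Q := Q, memLp_Q := hQ
      H := fun ξ => (P.symm : E →L[ℝ] E) ∘L G ξ
      memLp_H := memLp_top_restrict_Icc_of_continuous (continuous_const.clm_comp hG)
      coord := coord, coordDeriv := coordDeriv, vec := vec, vecDeriv := vecDeriv
      hasDerivAt_coord := hcoord, continuous_coordDeriv := hcoordDeriv
      hasDerivAt_vec := hvec, continuous_vecDeriv := hvecDeriv
      sum_vec_coord := sum_vec_coord, coord_sum_vec := coord_sum_vec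
      d := d, continuous_d := hd, d_pos := d_pos, σ := σ, σ_eq := hσ
      coord_P_H := fun ξ hξ e i => by
        rw [ContinuousLinearMap.comp_apply, ContinuousLinearEquiv.coe_coe, P.apply_symm_apply,
          hG_apply, coord_sum_vec ξ hξ] }
  refine ⟨D, rfl, rfl, ?_⟩
  filter_upwards [hH, ae_restrict_mem measurableSet_Icc] with ξ hHξ hξ
  ext e
  rw [ContinuousLinearMap.comp_apply, ContinuousLinearEquiv.coe_coe, P.symm_apply_eq, hG_apply]
  simp only [← hHξ, sum_vec_coord ξ hξ]

theorem exists_diagForm_of_contDiffOn [FiniteDimensional ℝ E] (hab : a < b) (P : E ≃L[ℝ] E)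
    {Q : ℝ → E →L[ℝ] E} (hQ : MemLp Q ∞ (volume.restrict (Icc a b))) {coord : ι → ℝ → E →L[ℝ] 𝕜}
    {vec : ι → ℝ → 𝕜 →L[ℝ] E} (hcoord : ∀ i, ContDiffOn ℝ 1 (coord i) (Icc a b))
    (hvec : ∀ i, ContDiffOn ℝ 1 (vec i) (Icc a b))
    (sum_vec_coord : ∀ ξ ∈ Icc a b, ∀ e, ∑ i, vec i ξ (coord i ξ e) = e)
    (coord_sum_vec : ∀ ξ ∈ Icc a b, ∀ (c : ι → 𝕜) i, coord i ξ (∑ j, vec j ξ (c j)) = c i)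
    {d : ι → ℝ → ℝ} (hd : ∀ i, ContinuousOn (d i) (Icc a b)) (d_pos : ∀ i, ∀ ξ ∈ Icc a b, 0 < d i ξ)
    {σ : ι → ℝ} (hσ : ∀ i, σ i = 1 ∨ σ i = -1) {H : ℝ → E →L[ℝ] E}
    (hH : ∀ᵐ ξ ∂volume.restrict (Icc a b), ∀ e i,
      coord i ξ (P (H ξ e)) = σ i • d i ξ • coord i ξ e) :
    ∃ D : DiagForm 𝕜 E ι a b, D.P = P ∧ D.Q = Q ∧ ∀ᵐ ξ ∂volume.restrict (Icc a b), D.H ξ = H ξ := by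
  have : CompleteSpace E := FiniteDimensional.complete ℝ E
  choose coord₁ coordDeriv hcoord₁ hcoordDeriv coord_eq using fun i =>
    exists_hasDerivAt_extension_of_contDiffOn hab (hcoord i)
  choose vec₁ vecDeriv hvec₁ hvecDeriv vec_eq using fun i =>
    exists_hasDerivAt_extension_of_contDiffOn hab (hvec i)
  let d₁ (i : ι) : ℝ → ℝ := IccExtend hab.le ((Icc a b).domRestrict (d i))
  have d_eq (i : ι) : EqOn (d₁ i) (d i) (Icc a b) := fun ξ hξ => IccExtend_of_mem _ _ hξ
  refine exists_diagForm_of_hasDerivAt hab P hQ hcoord₁ hcoordDeriv hvec₁ hvecDeriv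
    (fun ξ hξ e => ?_) (fun ξ hξ c i => ?_) (d := d₁) (fun i => (hd i).domRestrict.Icc_extend')
    (fun i ξ => d_pos i _ (Subtype.coe_prop _)) hσ ?_
  · simpa only [vec_eq _ hξ, coord_eq _ hξ] using sum_vec_coord ξ hξ e
  · simpa only [vec_eq _ hξ, coord_eq _ hξ] using coord_sum_vec ξ hξ c i
  · filter_upwards [hH, ae_restrict_mem measurableSet_Icc] with ξ hHξ hξ e i
    rw [coord_eq i hξ, d_eq i hξ, hHξ]

end DiagFormConstruction

section Matrix

variable {𝕜 ι : Type*} [RCLike 𝕜]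

section Determinant

variable {s : Set ℝ} {k : WithTop ℕ∞}

theorem contDiffOn_det [Fintype ι] [DecidableEq ι] {A : ℝ → Matrix ι ι 𝕜}
    (hA : ∀ i j, ContDiffOn ℝ k (fun ξ => A ξ i j) s) :
    ContDiffOn ℝ k (fun ξ => (A ξ).det) s := by
  simp only [Matrix.det_apply]
  exact ContDiffOn.sum fun τ _ => (contDiffOn_prod fun i _ => hA (τ i) i).const_smul _

theorem contDiffOn_inv_apply [Fintype ι] [DecidableEq ι] {A : ℝ → Matrix ι ι 𝕜}
    (hA : ∀ i j, ContDiffOn ℝ k (fun ξ => A ξ i j) s) (hunit : ∀ ξ ∈ s, IsUnit (A ξ)) (i j : ι) :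
    ContDiffOn ℝ k (fun ξ => (A ξ)⁻¹ i j) s := by
  have hdet (ξ : ℝ) (hξ : ξ ∈ s) : (A ξ).det ≠ 0 :=
    ((A ξ).isUnit_iff_isUnit_det.1 (hunit ξ hξ)).ne_zero
  simp only [Matrix.inv_def, Ring.inverse_eq_inv', Matrix.smul_apply, smul_eq_mul,
    Matrix.adjugate_apply]
  refine ((contDiffOn_det hA).inv hdet).mul (contDiffOn_det fun i' j' => ?_)
  rcases eq_or_ne i' j with rfl | hi'
  · simpa only [Matrix.updateRow_self] using contDiffOn_const
  · simpa only [Matrix.updateRow_ne hi'] using hA i' j'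

end Determinant

variable [Fintype ι] [DecidableEq ι]

/-- The real-linear operator on Euclidean space given by a matrix. -/
noncomputable def euclideanCLM (A : Matrix ι ι 𝕜) :
    EuclideanSpace 𝕜 ι →L[ℝ] EuclideanSpace 𝕜 ι :=
  (Matrix.toEuclideanCLM (𝕜 := 𝕜) A).restrictScalars ℝ

theorem euclideanCLM_apply (A : Matrix ι ι 𝕜) (v : EuclideanSpace 𝕜 ι) :
    euclideanCLM A v = A.toEuclideanLin v := rfl

theorem exists_clm_eq_euclideanCLM (𝕜 ι : Type*) [RCLike 𝕜] [Fintype ι] [DecidableEq ι] :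
    ∃ T : (ι → ι → 𝕜) →L[ℝ] EuclideanSpace 𝕜 ι →L[ℝ] EuclideanSpace 𝕜 ι,
      ∀ A : Matrix ι ι 𝕜, T (fun i j => A i j) = euclideanCLM A := by
  let ℓ : (ι → ι → 𝕜) →ₗ[ℝ] EuclideanSpace 𝕜 ι →L[ℝ] EuclideanSpace 𝕜 ι :=
    { toFun := fun A => euclideanCLM (Matrix.of A)
      map_add' := fun A B => by
        ext v i
        simp [euclideanCLM_apply, ← Matrix.of_add_of]
      map_smul' := fun c A => by
        ext v i
        simp [euclideanCLM_apply, ← Matrix.smul_of, Matrix.smul_mulVec] }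
  exact ⟨LinearMap.toContinuousLinearMap ℓ, fun A => rfl⟩

theorem contDiffOn_euclideanCLM {A : ℝ → Matrix ι ι 𝕜} {s : Set ℝ} {k : WithTop ℕ∞}
    (hA : ∀ i j, ContDiffOn ℝ k (fun ξ => A ξ i j) s) :
    ContDiffOn ℝ k (fun ξ => euclideanCLM (A ξ)) s := by
  obtain ⟨T, hT⟩ := exists_clm_eq_euclideanCLM 𝕜 ι
  simp only [← hT]
  exact (ContinuousLinearMap.contDiff (E := ι → ι → 𝕜)
    (F := EuclideanSpace 𝕜 ι →L[ℝ] EuclideanSpace 𝕜 ι) T).comp_contDiffOn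
    (contDiffOn_pi.2 fun i => contDiffOn_pi.2 fun j => hA i j)

theorem memLp_euclideanCLM {α : Type*} [MeasurableSpace α] {μ : Measure α} {p : ℝ≥0∞}
    {A : α → Matrix ι ι 𝕜} (hA : ∀ i j, MemLp (fun ξ => A ξ i j) p μ) :
    MemLp (fun ξ => euclideanCLM (A ξ)) p μ := by
  obtain ⟨T, hT⟩ := exists_clm_eq_euclideanCLM 𝕜 ι
  simp only [← hT]
  exact ContinuousLinearMap.comp_memLp' (E := ι → ι → 𝕜)
    (F := EuclideanSpace 𝕜 ι →L[ℝ] EuclideanSpace 𝕜 ι) T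
    (MemLp.of_eval fun i => MemLp.of_eval fun j => hA i j)

theorem euclideanCLM_mul_apply (A B : Matrix ι ι 𝕜) (v : EuclideanSpace 𝕜 ι) :
    euclideanCLM (A * B) v = euclideanCLM A (euclideanCLM B v) := by
  simp [euclideanCLM_apply, Matrix.toLpLin_apply, Matrix.mulVec_mulVec]

theorem euclideanCLM_diagonal_apply (d : ι → 𝕜) (v : EuclideanSpace 𝕜 ι) (i : ι) :
    euclideanCLM (Matrix.diagonal d) v i = d i * v i :=
  Matrix.mulVec_diagonal d v.ofLp i

theorem euclideanCLM_apply_inv_apply {A : Matrix ι ι 𝕜} (hA : IsUnit A) (v : EuclideanSpace 𝕜 ι) :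
    euclideanCLM A (euclideanCLM A⁻¹ v) = v := by
  rw [← euclideanCLM_mul_apply, A.mul_nonsing_inv (A.isUnit_iff_isUnit_det.1 hA)]
  simp [euclideanCLM_apply]

theorem euclideanCLM_inv_apply_apply {A : Matrix ι ι 𝕜} (hA : IsUnit A) (v : EuclideanSpace 𝕜 ι) :
    euclideanCLM A⁻¹ (euclideanCLM A v) = v := by
  rw [← euclideanCLM_mul_apply, A.nonsing_inv_mul (A.isUnit_iff_isUnit_det.1 hA)]
  simp [euclideanCLM_apply]

theorem euclideanCLM_conj_diagonal_apply {S : Matrix ι ι 𝕜} (hS : IsUnit S) (σ δ : ι → 𝕜)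
    (v : EuclideanSpace 𝕜 ι) (i : ι) :
    euclideanCLM S (euclideanCLM (S⁻¹ * Matrix.diagonal σ * Matrix.diagonal δ * S) v) i =
      σ i * (δ i * euclideanCLM S v i) := by
  simp only [euclideanCLM_mul_apply, euclideanCLM_apply_inv_apply hS, euclideanCLM_diagonal_apply]

/-- The action of a matrix on the stacked vector `[e; f]` of a pair `(e, f)`, used for the pair
`(v b, v a)` of boundary values. -/
noncomputable def boundaryCLM (W : Matrix ι (ι ⊕ ι) 𝕜) :
    EuclideanSpace 𝕜 ι × EuclideanSpace 𝕜 ι →L[ℝ] EuclideanSpace 𝕜 ι :=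
  LinearMap.toContinuousLinearMap
    { toFun := fun q => W.toEuclideanLin (WithLp.toLp 2 (Sum.elim q.1.ofLp q.2.ofLp))
      map_add' := fun q r => by
        rw [← map_add]
        congr 1
        ext (i | i) <;> rfl
      map_smul' := fun c q => by
        rw [RingHom.id_apply, ← LinearMap.map_smul_of_tower]
        congr 1
        ext (i | i) <;> rfl }

theorem surjective_boundaryCLM {W : Matrix ι (ι ⊕ ι) 𝕜} (hW : W.rank = Fintype.card ι) :
    Function.Surjective (boundaryCLM W) := by
  intro u
  have range_eq_top : LinearMap.range W.mulVecLin = ⊤ := by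
    refine Submodule.eq_top_of_finrank_eq ?_
    rw [Module.finrank_fintype_fun_eq_card, ← hW]
    rfl
  obtain ⟨w, hw⟩ := LinearMap.range_eq_top.1 range_eq_top u.ofLp
  refine ⟨(WithLp.toLp 2 (w ∘ Sum.inl), WithLp.toLp 2 (w ∘ Sum.inr)), ?_⟩
  change WithLp.toLp 2 (W.mulVec (Sum.elim (w ∘ Sum.inl) (w ∘ Sum.inr))) = u
  rw [Sum.elim_comp_inl_inr, ← Matrix.mulVecLin_apply, hw]

end Matrix

/-! ### Boundary control systems -/

namespace HBCS

variable {𝕜 : Type*} [RCLike 𝕜] {n : ℕ} (sys : HBCS 𝕜 n)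

theorem exists_diagForm_data (h_diag : sys.IsC1Diagonalisable) :
    ∃ (S : ℝ → Matrix (Fin n) (Fin n) 𝕜) (d : Fin n → ℝ → ℝ) (σ : Fin n → ℝ),
      (∀ i j, ContDiffOn ℝ 1 (fun ξ => S ξ i j) (Icc sys.a sys.b)) ∧
      (∀ ξ ∈ Icc sys.a sys.b, IsUnit (S ξ)) ∧
      (∀ i, ContinuousOn (d i) (Icc sys.a sys.b)) ∧
      (∀ i, ∀ ξ ∈ Icc sys.a sys.b, 0 < d i ξ) ∧ (∀ i, σ i = 1 ∨ σ i = -1) ∧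
      ∀ᵐ ξ ∂sys.μ, ∀ e i, euclideanCLM (S ξ) (euclideanCLM sys.P₁ (euclideanCLM (sys.H ξ) e)) i =
        σ i • d i ξ • euclideanCLM (S ξ) e i := by
  obtain ⟨S, HD, m, -, hS, hHD, hSHD, hdiag⟩ := h_diag
  refine ⟨S, fun i ξ => RCLike.re (HD ξ i i), fun i => if (i : ℕ) < m then 1 else -1, hS,
    fun ξ hξ => (hSHD ξ hξ).1,
    fun i => RCLike.continuous_re.comp_continuousOn (hHD i i).continuousOn,
    fun i ξ hξ => (RCLike.pos_iff.1 (hSHD ξ hξ).2.2.diag_pos).1, fun i => ite_eq_or_eq .., ?_⟩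
  filter_upwards [hdiag, ae_restrict_mem measurableSet_Icc] with ξ hdiagξ hξ e i
  obtain ⟨hSξ, hHDξ, hpos⟩ := hSHD ξ hξ
  have diag_real : (RCLike.re (HD ξ i i) : 𝕜) = HD ξ i i :=
    RCLike.conj_eq_iff_re.1 (RCLike.conj_eq_iff_im.2 (RCLike.pos_iff.1 hpos.diag_pos).2)
  rw [← euclideanCLM_mul_apply sys.P₁, hdiagξ, ← hHDξ.diagonal_diag,
    euclideanCLM_conj_diagonal_apply hSξ, Matrix.diagonal_apply_eq, Matrix.diag_apply,
    RCLike.real_smul_eq_coe_mul, RCLike.real_smul_eq_coe_mul, diag_real]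
  split_ifs <;> simp

theorem exists_diagForm (hP₁ : IsUnit sys.P₁)
    (hP₀ : ∀ i j, MemLp (fun ξ => sys.P₀ ξ i j) ∞ sys.μ) (h_diag : sys.IsC1Diagonalisable) :
    ∃ D : DiagForm 𝕜 (EuclideanSpace 𝕜 (Fin n)) (Fin n) sys.a sys.b,
      (∀ e, D.P e = euclideanCLM sys.P₁ e) ∧ (∀ ξ, D.Q ξ = euclideanCLM (sys.P₀ ξ)) ∧
      ∀ᵐ ξ ∂sys.μ, D.H ξ = euclideanCLM (sys.H ξ) := by
  obtain ⟨S, d, σ, hS, hSunit, hd, d_pos, hσ, hH⟩ := sys.exists_diagForm_data h_diag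
  let P : EuclideanSpace 𝕜 (Fin n) ≃L[ℝ] EuclideanSpace 𝕜 (Fin n) :=
    .equivOfInverse (euclideanCLM sys.P₁) (euclideanCLM sys.P₁⁻¹)
      (euclideanCLM_inv_apply_apply hP₁) (euclideanCLM_apply_inv_apply hP₁)
  let e (i : Fin n) : EuclideanSpace 𝕜 (Fin n) := EuclideanSpace.basisFun (Fin n) 𝕜 i
  have sum_smul_e (c : EuclideanSpace 𝕜 (Fin n)) : ∑ i, c i • e i = c :=
    (EuclideanSpace.basisFun (Fin n) 𝕜).sum_repr c
  have sum_vec_coord (ξ : ℝ) (hξ : ξ ∈ Icc sys.a sys.b) (v : EuclideanSpace 𝕜 (Fin n)) :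
      ∑ i, euclideanCLM (S ξ)⁻¹ (euclideanCLM (S ξ) v i • e i) = v := by
    rw [← map_sum, sum_smul_e, euclideanCLM_inv_apply_apply (hSunit ξ hξ)]
  have coord_sum_vec (ξ : ℝ) (hξ : ξ ∈ Icc sys.a sys.b) (c : Fin n → 𝕜) (i : Fin n) :
      euclideanCLM (S ξ) (∑ j, euclideanCLM (S ξ)⁻¹ (c j • e j)) i = c i := by
    rw [← map_sum, sum_smul_e (WithLp.toLp 2 c), euclideanCLM_apply_inv_apply (hSunit ξ hξ)]
  obtain ⟨D, hDP, hDQ, hDH⟩ := exists_diagForm_of_contDiffOn sys.a_lt_b P (memLp_euclideanCLM hP₀)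
    (coord := fun i ξ => (EuclideanSpace.proj (𝕜 := 𝕜) i).restrictScalars ℝ ∘L euclideanCLM (S ξ))
    (vec := fun i ξ => euclideanCLM (S ξ)⁻¹ ∘L
      (ContinuousLinearMap.toSpanSingleton 𝕜 (e i)).restrictScalars ℝ)
    (fun i => contDiffOn_const.clm_comp (contDiffOn_euclideanCLM hS))
    (fun i => (contDiffOn_euclideanCLM (contDiffOn_inv_apply hS hSunit)).clm_comp contDiffOn_const)
    sum_vec_coord coord_sum_vec hd d_pos hσ (H := fun ξ => euclideanCLM (sys.H ξ)) hH
  exact ⟨D, fun v => by rw [hDP]; rfl, fun ξ => by rw [hDQ], hDH⟩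

variable {sys}

theorem isDiffExpr_one_iff {D : FirstOrderData (EuclideanSpace 𝕜 (Fin n)) sys.a sys.b}
    (hP : ∀ e, D.P e = euclideanCLM sys.P₁ e) (hQ : ∀ ξ, D.Q ξ = euclideanCLM (sys.P₀ ξ))
    (hH : ∀ᵐ ξ ∂sys.μ, D.H ξ = euclideanCLM (sys.H ξ)) (x z : sys.StateSpace 1)
    (v : ℝ → EuclideanSpace 𝕜 (Fin n)) :
    sys.IsDiffExpr 1 x z v ↔ ∃ g, D.IsDiff x z v g := by
  have v_ae_iff : (∀ᵐ ξ ∂sys.μ, v ξ = (sys.H ξ).toEuclideanLin (x ξ)) ↔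
      ∀ᵐ ξ ∂sys.μ, v ξ = D.H ξ (x ξ) := by
    refine eventually_congr ?_
    filter_upwards [hH] with ξ hHξ
    rw [hHξ, euclideanCLM_apply]
  have z_eq (g : ℝ → EuclideanSpace 𝕜 (Fin n)) (ξ : ℝ) : D.P (g ξ) + D.Q ξ (v ξ) =
      sys.P₁.toEuclideanLin (g ξ) + (sys.P₀ ξ).toEuclideanLin (v ξ) := by
    rw [hP, hQ, euclideanCLM_apply, euclideanCLM_apply]
  constructor
  · rintro ⟨hv, g, hg, hz⟩
    exact ⟨g, hg, v_ae_iff.1 hv, by simpa only [z_eq] using hz⟩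
  · rintro ⟨g, hg, hv, hz⟩
    exact ⟨v_ae_iff.2 hv, g, hg, by simpa only [z_eq] using hz⟩

theorem operatorGraph_one_eq {D : FirstOrderData (EuclideanSpace 𝕜 (Fin n)) sys.a sys.b}
    (hD : ∀ x z v, sys.IsDiffExpr 1 x z v ↔ ∃ g, D.IsDiff x z v g) :
    sys.operatorGraph 1 =
      {q | D.residual q = 0 ∧ boundaryCLM sys.W_B (D.boundaryValue q) = 0} := by
  ext ⟨x, z⟩
  constructor
  · rintro ⟨v, hv, hbv⟩
    obtain ⟨g, h⟩ := (hD x z v).1 hv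
    exact ⟨h.residual_eq_zero, by rw [h.boundaryValue_eq]; exact hbv⟩
  · rintro ⟨hres, hbv⟩
    obtain ⟨v, g, h⟩ := D.exists_isDiff hres
    rw [h.boundaryValue_eq] at hbv
    exact ⟨v, (hD x z v).2 ⟨g, h⟩, hbv⟩

theorem isDiffExpr_one_of_two {ι : sys.StateSpace 2 →L[ℝ] sys.StateSpace 1}
    (hι : ∀ x, ι x =ᵐ[sys.μ] x) {x z : sys.StateSpace 2} {v : ℝ → EuclideanSpace 𝕜 (Fin n)}
    (h : sys.IsDiffExpr 2 x z v) : sys.IsDiffExpr 1 (ι x) (ι z) v := by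
  obtain ⟨hv, g, ⟨hg, hvg⟩, hz⟩ := h
  refine ⟨?_, g, ⟨hg.mono_exponent (by norm_num), hvg⟩, ?_⟩
  · filter_upwards [hv, hι x] with ξ hvξ hxξ
    rw [hvξ, hxξ]
  · filter_upwards [hz, hι z] with ξ hzξ hιξ
    rw [hιξ, hzξ]

end HBCS

namespace C0Semigroup

variable {𝕜 X : Type*} [RCLike 𝕜] [NormedAddCommGroup X] [NormedSpace 𝕜 X] [NormedSpace ℝ X]
  [IsScalarTower ℝ 𝕜 X]

/-- A semigroup of `𝕜`-linear operators as a semigroup of real-linear operators. -/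
noncomputable def restrictReal (S : C0Semigroup 𝕜 X) : C0Semigroup ℝ X where
  T t := (S.T t).restrictScalars ℝ
  map_zero := by
    rw [S.map_zero]
    rfl
  map_add s t := by
    rw [S.map_add]
    rfl
  strongly_continuous := S.strongly_continuous

theorem IsGenerator.restrictReal {S : C0Semigroup 𝕜 X} {A : Set (X × X)} (h : S.IsGenerator A) :
    S.restrictReal.IsGenerator A := fun x z => by
  have inv_smul (r : ℝ) (w : X) : (r : 𝕜)⁻¹ • w = r⁻¹ • w := by
    rw [← RCLike.ofReal_inv, ← algebraMap_smul 𝕜 r⁻¹ w]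
  rw [h x z]
  simp only [inv_smul]
  rfl

theorem IsExponentiallyStable.restrictReal {S : C0Semigroup 𝕜 X} (h : S.IsExponentiallyStable) :
    S.restrictReal.IsExponentiallyStable := by
  obtain ⟨M, ω, hω, hM⟩ := h
  exact ⟨M, ω, hω, fun t => (ContinuousLinearMap.norm_restrictScalars (S.T t)).trans_le (hM t)⟩

end C0Semigroup

section Lebesgue

variable {E : Type*} [NormedAddCommGroup E]

theorem exists_inclusion_L2_L1 {α : Type*} [MeasurableSpace α] (μ : Measure α) [IsFiniteMeasure μ]
    [NormedSpace ℝ E] : ∃ ι : Lp E 2 μ →L[ℝ] Lp E 1 μ, ∀ x, ι x =ᵐ[μ] x := by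
  have hid : MemLp (fun _ : α => ContinuousLinearMap.id ℝ E) 2 μ := memLp_const _
  refine ⟨(ContinuousLinearMap.id ℝ (E →L[ℝ] E)).holderL μ 2 2 1 (hid.toLp _), fun x => ?_⟩
  filter_upwards [(ContinuousLinearMap.id ℝ (E →L[ℝ] E)).coeFn_holder (r := 1) (hid.toLp _) x,
    hid.coeFn_toLp] with ξ hholder hidξ
  rw [hidξ] at hholder
  exact hholder

theorem enorm_le_eLpNorm_top_of_continuousOn {u : ℝ → E} {a b : ℝ} (hab : a < b)
    (hu : ContinuousOn u (Icc a b)) {s : ℝ} (hs : s ∈ Icc a b) :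
    ‖u s‖ₑ ≤ eLpNorm u ∞ (volume.restrict (Icc a b)) := by
  set β := eLpNorm u ∞ (volume.restrict (Icc a b)) with hβ
  have max_ae_eq : (fun s => max ‖u s‖ₑ β) =ᵐ[volume.restrict (Icc a b)] fun _ => β := by
    filter_upwards [ae_le_eLpNormEssSup (f := u) (μ := volume.restrict (Icc a b))] with s hs
    exact max_eq_right (by rwa [hβ, eLpNorm_exponent_top])
  have := Measure.eqOn_Icc_of_ae_eq volume hab.ne max_ae_eq (hu.enorm.sup continuousOn_const)
    continuousOn_const hs
  exact (le_max_left _ _).trans_eq this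

theorem eLpNorm_top_le_of_forall_norm_le {F : Type*} [NormedAddCommGroup F] {u : ℝ → E} {y : ℝ → F}
    {t C : ℝ} (ht : 0 < t) (hu : ContinuousOn u (Icc 0 t))
    (h : ∀ s ∈ Icc 0 t, ∀ β : ℝ, (∀ r ∈ Icc 0 s, ‖u r‖ ≤ β) → ‖y s‖ ≤ C * β) :
    eLpNorm y ∞ (volume.restrict (Icc 0 t)) ≤
      (C.toNNReal + 1 : ℝ≥0) * eLpNorm u ∞ (volume.restrict (Icc 0 t)) := by
  have norm_u_le {s : ℝ} (hs : s ∈ Icc 0 t) := enorm_le_eLpNorm_top_of_continuousOn ht hu hs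
  generalize eLpNorm u ∞ (volume.restrict (Icc 0 t)) = β at norm_u_le ⊢
  induction β with
  | top => simp
  | coe β =>
    rw [eLpNorm_exponent_top]
    refine eLpNormEssSup_le_of_ae_enorm_bound ?_
    filter_upwards [ae_restrict_mem measurableSet_Icc] with s hs
    have := h s hs β fun r hr => ?_
    · rw [← ENNReal.coe_mul, enorm_le_coe, ← NNReal.coe_le_coe, coe_nnnorm]
      calc ‖y s‖ ≤ C * β := this
        _ ≤ (C.toNNReal + 1 : ℝ≥0) * β := by
            gcongr
            exact (Real.le_coe_toNNReal C).trans (NNReal.coe_le_coe.2 le_self_add)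
    · exact enorm_le_coe.1 (norm_u_le ⟨hr.1, hr.2.trans hs.2⟩)

end Lebesgue

theorem HBCS.exists_norm_output_le {𝕜 : Type*} [RCLike 𝕜] {n : ℕ} (sys : HBCS 𝕜 n)
    (hP₁ : IsUnit sys.P₁) (hP₀ : ∀ i j, MemLp (fun ξ => sys.P₀ ξ i j) ∞ sys.μ)
    (hW_B : sys.W_B.rank = n) (h_diag : sys.IsC1Diagonalisable)
    (h_stable : sys.IsExponentiallyStableOn 1) :
    ∃ C : ℝ, ∀ u x y, sys.IsClassicalSolution u x y → x 0 = 0 → ∀ t β : ℝ, 0 ≤ t →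
      (∀ s ∈ Icc 0 t, ‖u s‖ ≤ β) → ‖y t‖ ≤ C * β := by
  obtain ⟨D, hDP, hDQ, hDH⟩ := sys.exists_diagForm hP₁ hP₀ h_diag
  have isDiff_iff := isDiffExpr_one_iff hDP hDQ hDH
  obtain ⟨S, hS, hstab⟩ := h_stable
  rw [operatorGraph_one_eq isDiff_iff] at hS
  have hB : Function.Surjective (boundaryCLM sys.W_B) :=
    surjective_boundaryCLM (by rw [hW_B, Fintype.card_fin])
  obtain ⟨C, hC⟩ := DiagForm.exists_norm_output_le hS.restrictReal hstab.restrictReal hB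
    (boundaryCLM sys.W_C)
  obtain ⟨ι, hι⟩ := exists_inclusion_L2_L1 (E := EuclideanSpace 𝕜 (Fin n)) sys.μ
  refine ⟨C, ?_⟩
  rintro u x y ⟨-, -, x', hx', hsol⟩ hx0 t β ht hβ
  have hv : ∀ s ∈ Ici (0 : ℝ), ∃ v g, D.IsDiff (ι (x s)) (ι (x' s)) v g ∧
      u s = boundaryCLM sys.W_B (v sys.b, v sys.a) ∧
      y s = boundaryCLM sys.W_C (v sys.b, v sys.a) := fun s hs => by
    obtain ⟨-, v, hv, hu, hy⟩ := hsol s hs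
    obtain ⟨g, hg⟩ := (isDiff_iff _ _ _).1 (isDiffExpr_one_of_two hι hv)
    exact ⟨v, g, hg, hu, hy⟩
  choose! v g hD hu hy using hv
  rw [hy t ht]
  exact hC (fun s => ι (x s)) (fun s => ι (x' s)) v g
    (fun s hs => ι.hasFDerivAt.comp_hasDerivWithinAt s (hsol s hs).1)
    (ι.continuous.comp_continuousOn hx') (by rw [hx0, map_zero]) hD t β ht
    fun s hs => by rw [← hu s hs.1]; exact hβ s hs

theorem mainTheorem2_general {𝕜 : Type*} [RCLike 𝕜] {n : ℕ} (sys : HBCS 𝕜 n)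
    (hP₁ : IsUnit sys.P₁) (hP₀ : ∀ i j, MemLp (fun ξ => sys.P₀ ξ i j) ∞ sys.μ)
    (hW_B : sys.W_B.rank = n) (h_diag : sys.IsC1Diagonalisable)
    (h_stable : sys.IsExponentiallyStableOn 1) :
    ∃ c : ℝ≥0, 0 < c ∧ ∀ u x y, sys.IsClassicalSolution u x y → x 0 = 0 → ∀ t : ℝ, 0 < t →
      eLpNorm y ∞ (volume.restrict (Icc 0 t)) ≤ c * eLpNorm u ∞ (volume.restrict (Icc 0 t)) := by
  obtain ⟨C, hC⟩ := sys.exists_norm_output_le hP₁ hP₀ hW_B h_diag h_stable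
  refine ⟨C.toNNReal + 1, by positivity, fun u x y hsol hx0 t ht => ?_⟩
  exact eLpNorm_top_le_of_forall_norm_le ht (hsol.1.mono Icc_subset_Ici_self)
    fun s hs β => hC u x y hsol hx0 s β hs.1

theorem mainTheorem2 {𝕜 : Type*} [RCLike 𝕜] {n : ℕ} (sys : HBCS 𝕜 n)
    (h_standing : sys.StandingAssumptions) (h_diag : sys.IsC1Diagonalisable)
    (h_stable : sys.IsExponentiallyStableOn 1) : sys.IsBIBOStable := by
  obtain ⟨c, hc, h⟩ := mainTheorem2_general sys h_standing.P₁_isUnit h_standing.P₀_bounded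
    h_standing.W_B_fullRank h_diag h_stable
  exact ⟨c, hc, fun u x y hsol hx0 _ _ => h u x y hsol hx0⟩
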